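/- **Setting.** Let $M$ be a connected smooth manifold with a *Liouville structure*: a smooth 1-form $\alpha$ such that $\omega=d\alpha$ is symplectic and the vector field $L$ defined by $i_L\omega=\alpha$ is complete, with flow $L^t$, and such that a starshaped domain exists. Here a *starshaped domain* is an open set $U\subset M$ with compact closure whose boundary $P$ is a connected smooth hypersurface transversal to $L$, with $M=U\sqcup\bigcup_{t\ge 0}L^tP$. Put $\mathrm{Core}(M)=\bigcap_{t>0}L^{-t}(U)$ (this does not depend on the starshaped domain $U$) and $M_*=M\setminus \mathrm{Core}(M)$. The group $\mathbb R_+$ acts on $M_*$ by $c*z=L^{\log c}z$; the quotient $P_\infty=M_*/\mathbb R_+$ with the contact structure induced by $\ker\alpha$ is the ideal contact boundary, and its contactomorphisms are identified with their lifts, the $\mathbb R_+$-equivariant symplectomorphisms of $M_*$. A *contact Hamiltonian* is a smooth function $F$ on $M_*$ with $F(c*z)=cF(z)$, extended by $0$ to $\mathrm{Core}(M)$; it is *positive* if $F>0$ on $M_*$. A path $f_t$ is generated by $F_t$ if $\partial_t f_t=(\mathrm{sgrad}\,F_t)\circ f_t$ on $M_*$, where $\omega(\cdot,\mathrm{sgrad}\,F)=dF$.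 Let $V=M\times S^1$, $S^1=\mathbb R/\mathbb Z$, with the contact structure $\xi=\ker(\alpha-dt)$. For open $U_1,U_2,W\subset V$, a *contact squeezing of $U_1$ into $U_2$ inside $W$* is a contact isotopy $\Psi_s:\overline{U_1}\to V$, $s\in[0,1]$ (a smooth family of embeddings, defined near $\overline{U_1}$, that preserve $\xi$), with $\Psi_0=\mathrm{id}$, $\Psi_1(\overline{U_1})\subset U_2$, $\overline{U_2}\subset W$ and $\Psi_s(\overline{U_1})\subset W$ for all $s$. If $W=V$ we omit "inside $W$". The squeezing is *through fiberwise starshaped domains* if every $\Psi_s(U_1)$ is an open set with smooth compact boundary transversal to the fibers $M\times\{t\}$ that meets each fiber in a starshaped domain. **Theorem.** Let $E$ be a positive contact Hamiltonian, and let $A(R)=\{E<R\}\times S^1\subset V$ for $R>0$. Let $\{f_{t,s}\}$, $t\in S^1$, $s\in[0,1]$, be a smooth homotopy of loops of contactomorphisms of the ideal contact boundary with $f_{0,s}=\mathrm{id}$ for all $s$ and $f_{t,0}=\mathrm{id}$ for all $t$, and let $F_s(z,t)$ be the contact Hamiltonian that generates the loop $\{f_{t,s}\}_{t\in S^1}$.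 Suppose that the loop $\{f_{t,1}\}$ is positive, that is, $F_1>0$ on $M_*\times S^1$, and that for some $\mu>0$ $$F_s(z,t)>-\mu E(z)\qquad\text{for all } z\in M_*,\ t\in S^1,\ s\in[0,1].$$ Then: (i) there exists $\gamma>0$ such that, for every $R$ with $0<R<\mu^{-1}$, there is a contact squeezing of $A(R)$ into $A\!\left(\frac{R}{1+\gamma R}\right)$ through fiberwise starshaped domains; (ii) for every $R$ with $0<R<\mu^{-1}$ and every $\rho>\frac{1}{R^{-1}-\mu}$, there is a contact squeezing of $A(R)$ into itself inside $A(\rho)$ through fiberwise starshaped domains. -/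

import Mathlib

open scoped Manifold ContDiff
open Set

namespace ContactSqueezing

section Boundary

variable {E H N : Type*} [NormedAddCommGroup E] [NormedSpace ℝ E] [TopologicalSpace H]
  (I : ModelWithCorners ℝ E H) [TopologicalSpace N] [ChartedSpace H N]

/-- `g` is a smooth defining function near `x` for the boundary of the open set `D`: near `x` the
set `D` is `{g < 0}`, and `dg ≠ 0` at `x`. An open set has smooth boundary if such a function exists
at each of its boundary points; the tangent space of the boundary at `x` is then `ker dg_x`. -/
def IsBoundaryDefiningAt (D : Set N) (x : N) (g : N → ℝ) : Prop :=
  (∃ O : Set N, IsOpen O ∧ x ∈ O ∧ ContMDiffOn I 𝓘(ℝ, ℝ) ∞ g O ∧ D ∩ O = {y ∈ O | g y < 0}) ∧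
    mfderiv I 𝓘(ℝ, ℝ) g x ≠ 0

end Boundary

section Forms

variable {d : ℕ} {M : Type*} [TopologicalSpace M] [ChartedSpace (EuclideanSpace ℝ (Fin d)) M]

/-- The 1-form `α` written in the chart around `x₀` (its pull-back under the inverse chart). -/
noncomputable def chartForm (α : ∀ x : M, TangentSpace (𝓡 d) x →L[ℝ] ℝ) (x₀ : M)
    (y : EuclideanSpace ℝ (Fin d)) : EuclideanSpace ℝ (Fin d) →L[ℝ] ℝ :=
  (α ((extChartAt (𝓡 d) x₀).symm y)).comp
    (mfderiv 𝓘(ℝ, EuclideanSpace ℝ (Fin d)) (𝓡 d) (extChartAt (𝓡 d) x₀).symm y)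

/-- Smoothness of a 1-form: all its coordinate expressions are smooth. -/
def IsSmoothForm (α : ∀ x : M, TangentSpace (𝓡 d) x →L[ℝ] ℝ) : Prop :=
  ∀ x₀ : M, ContDiffOn ℝ ∞ (chartForm α x₀) (extChartAt (𝓡 d) x₀).target

/-- The exterior derivative `dα` of a 1-form at `x`, computed in the chart around `x`:
`dα(v, w) = D_v A (w) - D_w A (v)`, where `A` is the coordinate expression of `α`.
(Mathlib's identification of `T_x M` with the model space is the derivative of this chart.) -/
noncomputable def dForm (α : ∀ x : M, TangentSpace (𝓡 d) x →L[ℝ] ℝ) (x : M)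
    (v w : TangentSpace (𝓡 d) x) : ℝ :=
  let D := fderiv ℝ (chartForm α x) (extChartAt (𝓡 d) x x)
  let v' : EuclideanSpace ℝ (Fin d) := v
  let w' : EuclideanSpace ℝ (Fin d) := w
  D v' w' - D w' v'

/-- A starshaped domain for the vector field `L` with flow `flow`: an open set `U` with compact
closure, whose boundary `P` is a connected smooth hypersurface transversal to `L`, such that
`M = U ⊔ ⋃_{t ≥ 0} L^t P`. -/
structure IsStarshaped (L : ∀ x : M, TangentSpace (𝓡 d) x) (flow : ℝ → M → M)
    (U : Set M) : Prop where
  isOpen : IsOpen U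
  isCompact_closure : IsCompact (closure U)
  isConnected_frontier : IsConnected (frontier U)
  transversal : ∀ x ∈ frontier U, ∃ g : M → ℝ,
    IsBoundaryDefiningAt (𝓡 d) U x g ∧ mfderiv (𝓡 d) 𝓘(ℝ, ℝ) g x (L x) ≠ (0 : ℝ)
  disjoint : Disjoint U (⋃ t ∈ Ici (0 : ℝ), flow t '' frontier U)
  cover : U ∪ (⋃ t ∈ Ici (0 : ℝ), flow t '' frontier U) = univ

end Forms

/-- A Liouville structure on the manifold `M`: a smooth 1-form `α` (the Liouville form) such that
`ω = dα` is symplectic, whose dual field `L`, `i_L ω = α`, is complete (with flow `flow`), and such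
that a starshaped domain exists. The field and its flow are determined by `α`. -/
structure Liouville (d : ℕ) (M : Type*) [TopologicalSpace M]
    [ChartedSpace (EuclideanSpace ℝ (Fin d)) M] [IsManifold (𝓡 d) ∞ M] where
  α : ∀ x : M, TangentSpace (𝓡 d) x →L[ℝ] ℝ
  smooth_α : IsSmoothForm α
  nondegenerate : ∀ (x : M) (v : TangentSpace (𝓡 d) x), (∀ w, dForm α x v w = 0) → v = 0
  L : ∀ x : M, TangentSpace (𝓡 d) x
  smooth_L : ContMDiff (𝓡 d) (𝓡 d).tangent ∞ (fun x => (⟨x, L x⟩ : TangentBundle (𝓡 d) M))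
  contraction : ∀ (x : M) (v : TangentSpace (𝓡 d) x), dForm α x (L x) v = α x v
  flow : ℝ → M → M
  flow_zero : ∀ x, flow 0 x = x
  flow_integral : ∀ x, IsMIntegralCurve (I := 𝓡 d) (fun t => flow t x) L
  exists_starshaped : ∃ U : Set M, IsStarshaped L flow U

/-- `dt` on `S¹ = ℝ/ℤ`, where `t ∈ ℝ/ℤ` corresponds to `e^{2πit}` on the unit circle. -/
noncomputable def dtForm (θ : Circle) (τ : TangentSpace (𝓡 1) θ) : ℝ :=
  let w : ℂ := mfderiv (𝓡 1) 𝓘(ℝ, ℂ) (fun z : Circle => (z : ℂ)) θ τ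
  (2 * Real.pi)⁻¹ * ((starRingEnd ℂ) (θ : ℂ) * w).im

namespace Liouville

variable {d : ℕ} {M : Type*} [TopologicalSpace M] [ChartedSpace (EuclideanSpace ℝ (Fin d)) M]
  [IsManifold (𝓡 d) ∞ M] (S : Liouville d M)

/-- The symplectic form `ω = dα`. -/
noncomputable def symp (x : M) (v w : TangentSpace (𝓡 d) x) : ℝ := dForm S.α x v w

/-- `⋂_{t > 0} L^{-t}(U)`, for a starshaped domain `U` (the choice of `U` does not matter). -/
def core : Set M := {x | ∃ U : Set M, IsStarshaped S.L S.flow U ∧ ∀ t > 0, S.flow t x ∈ U}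

/-- `M_* = M \ Core(M)`, the symplectization of the ideal contact boundary `P = M_*/ℝ₊`; here
`c ∈ ℝ₊` acts by the time `log c` flow of `L`. -/
def star : Set M := S.coreᶜ

/-- Contact Hamiltonians of the ideal contact boundary: smooth functions on `M_*`, equivariant
under the `ℝ₊`-action, extended by `0` to the core. -/
structure IsContactHamiltonian (F : M → ℝ) : Prop where
  smooth : ContMDiffOn (𝓡 d) 𝓘(ℝ, ℝ) ∞ F S.star
  equivariant : ∀ z ∈ S.star, ∀ c > 0, F (S.flow (Real.log c) z) = c * F z
  core : ∀ z ∈ S.core, F z = 0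

/-- `φ` restricts to an `ℝ₊`-equivariant symplectomorphism of `M_*`; these are the lifts of the
contactomorphisms of the ideal contact boundary. -/
structure IsEquivariantSymplecto (φ : M → M) : Prop where
  bijOn : BijOn φ S.star S.star
  smooth : ContMDiffOn (𝓡 d) (𝓡 d) ∞ φ S.star
  equivariant : ∀ z ∈ S.star, ∀ c > 0, φ (S.flow (Real.log c) z) = S.flow (Real.log c) (φ z)
  symplectic : ∀ z ∈ S.star, ∀ v w : TangentSpace (𝓡 d) z,
    S.symp (φ z) (mfderiv (𝓡 d) (𝓡 d) φ z v) (mfderiv (𝓡 d) (𝓡 d) φ z w) = S.symp z v w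

/-- `f t s`, `s ∈ [0,1]`, is a smooth homotopy, through loops (1-periodic in `t`) of
contactomorphisms of the ideal contact boundary based at the identity, which starts at `s = 0`
with the constant loop. The contactomorphisms are given by their lifts to `M_*`. -/
structure IsLoopHomotopy (f : ℝ → ℝ → M → M) : Prop where
  smooth : ContMDiffOn (𝓘(ℝ, ℝ).prod (𝓘(ℝ, ℝ).prod (𝓡 d))) (𝓡 d) ∞
    (fun q : ℝ × ℝ × M => f q.1 q.2.1 q.2.2) (univ ×ˢ Icc (0 : ℝ) 1 ×ˢ S.star)
  symplecto : ∀ t, ∀ s ∈ Icc (0 : ℝ) 1, S.IsEquivariantSymplecto (f t s)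
  periodic : ∀ t, ∀ s ∈ Icc (0 : ℝ) 1, ∀ z ∈ S.star, f (t + 1) s z = f t s z
  based : ∀ s ∈ Icc (0 : ℝ) 1, ∀ z ∈ S.star, f 0 s z = z
  constant : ∀ t, ∀ z ∈ S.star, f t 0 z = z

/-- The time-dependent contact Hamiltonian `F t` generates the path `f t`:
`∂f_t/∂t = (sgrad F_t)(f_t)` on `M_*`, where `ω(·, sgrad F) = dF`. -/
def Generates (F : ℝ → M → ℝ) (f : ℝ → M → M) : Prop :=
  ∀ t, S.IsContactHamiltonian (F t) ∧
    ∀ z ∈ S.star, ∀ w : TangentSpace (𝓡 d) (f t z),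
      S.symp (f t z) w (mfderiv 𝓘(ℝ, ℝ) (𝓡 d) (fun τ => f τ z) t (1 : ℝ)) =
        mfderiv (𝓡 d) 𝓘(ℝ, ℝ) (F t) (f t z) w

/-- The contact form `α - dt` of the prequantization space `V = M × S¹`. -/
noncomputable def contactForm (p : M × Circle)
    (v : TangentSpace ((𝓡 d).prod (𝓡 1)) p) : ℝ :=
  S.α p.1 (v.1 : TangentSpace (𝓡 d) p.1) - dtForm p.2 (v.2 : TangentSpace (𝓡 1) p.2)

/-- `Ψ s`, `s ∈ [0,1]`, is a contact isotopy of the closed set `K ⊆ V` starting with the identity: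
a smooth family, defined on a neighbourhood of `K`, of embeddings (injective immersions between
manifolds of equal dimension) that preserve the contact structure `ξ = ker (α - dt)`. -/
def IsContactIsotopyOn (K : Set (M × Circle)) (Ψ : ℝ → M × Circle → M × Circle) : Prop :=
  ∃ O : Set (M × Circle), IsOpen O ∧ K ⊆ O ∧
    ContMDiffOn (𝓘(ℝ, ℝ).prod ((𝓡 d).prod (𝓡 1))) ((𝓡 d).prod (𝓡 1)) ∞
      (fun q : ℝ × M × Circle => Ψ q.1 q.2) (Icc (0 : ℝ) 1 ×ˢ O) ∧
    (∀ p ∈ O, Ψ 0 p = p) ∧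
    ∀ s ∈ Icc (0 : ℝ) 1, InjOn (Ψ s) O ∧ ∀ p ∈ O,
      Function.Injective (mfderiv ((𝓡 d).prod (𝓡 1)) ((𝓡 d).prod (𝓡 1)) (Ψ s) p) ∧
      ∀ v : TangentSpace ((𝓡 d).prod (𝓡 1)) p,
        S.contactForm (Ψ s p) (mfderiv ((𝓡 d).prod (𝓡 1)) ((𝓡 d).prod (𝓡 1)) (Ψ s) p v) = 0 ↔
          S.contactForm p v = 0

/-- `Ψ` is a contact squeezing of the open set `U₁` into `U₂` inside `W`. -/
structure IsSqueezing (U₁ U₂ W : Set (M × Circle)) (Ψ : ℝ → M × Circle → M × Circle) :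
    Prop where
  isotopy : S.IsContactIsotopyOn (closure U₁) Ψ
  final : Ψ 1 '' closure U₁ ⊆ U₂
  closure_subset : closure U₂ ⊆ W
  inside : ∀ s ∈ Icc (0 : ℝ) 1, Ψ s '' closure U₁ ⊆ W

/-- Fiberwise starshaped domains of `V = M × S¹`: open sets with smooth compact boundary
transversal to the fibers `M × {θ}`, which they intersect along starshaped domains. -/
structure IsFiberwiseStarshaped (D : Set (M × Circle)) : Prop where
  isOpen : IsOpen D
  isCompact_frontier : IsCompact (frontier D)
  fiber : ∀ θ : Circle, IsStarshaped S.L S.flow {x | (x, θ) ∈ D}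
  transversal : ∀ p ∈ frontier D, ∃ g : M × Circle → ℝ,
    IsBoundaryDefiningAt ((𝓡 d).prod (𝓡 1)) D p g ∧
    ∃ v : TangentSpace (𝓡 d) p.1,
      mfderiv ((𝓡 d).prod (𝓡 1)) 𝓘(ℝ, ℝ) g p
        ((v, (0 : TangentSpace (𝓡 1) p.2)) : TangentSpace (𝓡 d) p.1 × TangentSpace (𝓡 1) p.2)
        ≠ (0 : ℝ)

end Liouville

/-- `A(R) = {E < R} × S¹`. -/
def sublevel {M : Type*} (E : M → ℝ) (R : ℝ) : Set (M × Circle) := {x | E x < R} ×ˢ univ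

/-- There is a contact squeezing of `U₁` into `U₂` inside `W` through fiberwise starshaped
domains. -/
def Liouville.SqueezesStarshaped {d : ℕ} {M : Type*} [TopologicalSpace M]
    [ChartedSpace (EuclideanSpace ℝ (Fin d)) M] [IsManifold (𝓡 d) ∞ M] (S : Liouville d M)
    (U₁ U₂ W : Set (M × Circle)) : Prop :=
  ∃ Ψ : ℝ → M × Circle → M × Circle, S.IsSqueezing U₁ U₂ W Ψ ∧
    ∀ s ∈ Icc (0 : ℝ) 1, S.IsFiberwiseStarshaped (Ψ s '' U₁)

end ContactSqueezing

open scoped Topology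
universe u

/-! Let e be the flow on M_* of sgrad E. The contact Hamiltonian E/R generates the path e_{t/R}, and
A(R) is the domain {E/R < 1} of M × S¹. The idea is to deform E/R through 1-periodic contact
Hamiltonians H_s whose paths of contactomorphisms all end, at t = 1, at the same map e_{1/R}. Such a
deformation comes with a contact isotopy of M × S¹ carrying {H_0 < 1} onto {H_s < 1}, so a squeezing
problem becomes a problem of bounding H_s from below by multiples of E.

The paths are Θ_{t,s} = e_{τ(t,s)} ∘ f_{χ(t),χ(s)}, where χ is a smooth step from 0 to 1 and τ(t,s)
= t/R + c(s)(t - χ(t)). The correction t - χ(t) vanishes at t = 0 and at t = 1, so it redistributes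
time without changing the endpoint. The generator in the direction of t is H = (1/R + c(s)(1 -
χ'(t)))E + χ'(t) F_{χ(s)} ∘ e_{-τ}. As s grows, the speed c moves from 0 to -μ, then stays at -μ
while the loop is deformed, and finally moves from -μ to γ, where γ > 0 is a lower bound for F_1/E.
Since F_s > -μE, this gives H_0 = E/R, H_s ≥ (1/R - μ)E throughout, and H_1 ≥ (1/R + γ)E
(`neg_le_speed`, `exists_deformation`).

Let K be the generator of Θ in the direction of s. Equality of mixed derivatives of Θ becomes ∂_s H
- ∂_t K + dH(sgrad K) = 0 (`zero_curvature`). The contact field of K for α - dt has M-component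
sgrad K - (∂_t K)L and t-component dK(L) - K, which is zero by homogeneity. Hence H - 1 satisfies u'
= -(∂_t K)u along its trajectories, and its sign is preserved (`hasDerivAt_level`, `level_lt_iff`).
The same factor -∂_t K governs the evolution of α - dt, so ker(α - dt) is preserved
(`contactForm_transport`). Only a neighbourhood of the hypersurfaces {H_s = 1} matters, so K can be
multiplied by a cut-off function of E. This removes the singularity at the core and makes the
contact field complete.

The images {H_s < 1} are fiberwise starshaped because a positive function of degree one grows
exponentially along L (`isFiberwiseStarshaped_sublevel`). The bounds on H_s then say that the
isotopy stays in {E ≤ 1/(1/R - μ)} and ends in {E ≤ R/(1 + γR)}. The general foundations needed are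
smooth dependence of flows on initial data, naturality of the exterior derivative, and Cartan's
formula. -/

namespace ContactSqueezing

/-! ### Superposition operators on spaces of continuous paths. -/

section Superposition

variable {K : Type*} [TopologicalSpace K] [CompactSpace K]

/-- Pointwise application of a continuous family of linear maps, as a continuous linear map. -/
noncomputable def pointwiseApply (K : Type*) [TopologicalSpace K] [CompactSpace K]
    (E F : Type*) [NormedAddCommGroup E] [NormedSpace ℝ E]
    [NormedAddCommGroup F] [NormedSpace ℝ F] :
    C(K, E →L[ℝ] F) →L[ℝ] (C(K, E) →L[ℝ] C(K, F)) :=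
  LinearMap.mkContinuous₂
    (LinearMap.mk₂ ℝ (fun (A : C(K, E →L[ℝ] F)) (h : C(K, E)) =>
      (⟨fun τ => A τ (h τ), A.continuous.clm_apply h.continuous⟩ : C(K, F)))
      (fun _ _ _ => by ext; simp) (fun _ _ _ => by ext; simp) (fun _ _ _ => by ext; simp)
      (fun _ _ _ => by ext; simp)) 1
    (fun A h => by
      rw [one_mul]
      refine (ContinuousMap.norm_le _ (by positivity)).2 fun τ => ?_
      exact ((A τ).le_opNorm _).trans
        (mul_le_mul (A.norm_coe_le_norm τ) (h.norm_coe_le_norm τ) (norm_nonneg _)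
        (@norm_nonneg C(K, E →L[ℝ] F) _ A)))

@[simp]
theorem pointwiseApply_apply {E F : Type*} [NormedAddCommGroup E] [NormedSpace ℝ E]
    [NormedAddCommGroup F] [NormedSpace ℝ F] (A : C(K, E →L[ℝ] F)) (h : C(K, E)) (τ : K) :
    pointwiseApply K E F A h τ = A τ (h τ) := rfl

/-- The derivative is h ↦ (τ ↦ Dv(γ(τ)) h(τ)). Since γ ↦ Dv ∘ γ is continuous in the supremum norm,
the mean value inequality at each τ gives a remainder bound uniform in τ. -/
theorem hasFDerivAt_postcomp {E F : Type*} [NormedAddCommGroup E] [NormedSpace ℝ E]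
    [NormedAddCommGroup F] [NormedSpace ℝ F] {v : E → F} (hv : ContDiff ℝ 1 v) (γ : C(K, E)) :
    HasFDerivAt (fun γ : C(K, E) => (⟨v, hv.continuous⟩ : C(E, F)).comp γ)
      (pointwiseApply K E F
        ((⟨fderiv ℝ v, hv.continuous_fderiv (by simp)⟩ : C(E, E →L[ℝ] F)).comp γ)) γ := by
  set D : C(E, E →L[ℝ] F) := ⟨fderiv ℝ v, hv.continuous_fderiv (by simp)⟩
  have hD : Continuous fun γ : C(K, E) => D.comp γ := ContinuousMap.continuous_postcomp D
  rw [hasFDerivAt_iff_isLittleO_nhds_zero, Asymptotics.isLittleO_iff]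
  intro c hc
  obtain ⟨δ, hδ, hδ'⟩ := (Metric.continuous_iff (α := C(K, E)) (β := C(K, E →L[ℝ] F))).1 hD γ c hc
  filter_upwards [Metric.ball_mem_nhds (0 : C(K, E)) hδ] with h hh
  rw [mem_ball_zero_iff] at hh
  refine (ContinuousMap.norm_le _ (by positivity)).2 fun τ => ?_
  -- A point of the segment is the value at τ of the path γ + θh, which is δ-close to γ in the
  -- supremum norm; δ therefore serves for every τ.
  have key : ∀ y ∈ segment ℝ (γ τ) (γ τ + h τ), ‖fderiv ℝ v y - fderiv ℝ v (γ τ)‖ ≤ c := by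
    intro y hy
    rw [segment_eq_image'] at hy
    obtain ⟨θ, hθ, rfl⟩ := hy
    have h1 : dist (γ + θ • h) γ < δ := by
      rw [dist_eq_norm, add_sub_cancel_left, norm_smul, Real.norm_of_nonneg hθ.1]
      exact lt_of_le_of_lt (mul_le_of_le_one_left (norm_nonneg _) hθ.2) hh
    have h2 := (ContinuousMap.dist_le hc.le).1 (hδ' _ h1).le τ
    rw [dist_eq_norm] at h2
    simpa [D] using h2
  have := (convex_segment (𝕜 := ℝ) (γ τ) (γ τ + h τ)).norm_image_sub_le_of_norm_hasFDerivWithin_le'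
    (f := v) (f' := fderiv ℝ v) (φ := fderiv ℝ v (γ τ)) (C := c)
    (fun y _ => ((hv.differentiable (by simp)) y).hasFDerivAt.hasFDerivWithinAt) key
    (left_mem_segment ℝ _ _) (right_mem_segment ℝ _ _)
  have h3 : ‖h τ‖ ≤ ‖h‖ := h.norm_coe_le_norm τ
  calc _ = ‖v (γ τ + h τ) - v (γ τ) - fderiv ℝ v (γ τ) (γ τ + h τ - γ τ)‖ := by
        simp [D]
    _ ≤ c * ‖γ τ + h τ - γ τ‖ := this
    _ ≤ c * ‖h‖ := by rw [add_sub_cancel_left]; gcongr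

/-- The superposition operator `γ ↦ v ∘ γ` of a `C^n` map is `C^n`. -/
theorem contDiff_postcomp (n : ℕ) {E : Type u} [NormedAddCommGroup E] [NormedSpace ℝ E]
    {F : Type u} [NormedAddCommGroup F] [NormedSpace ℝ F] {v : E → F} (hv : ContDiff ℝ n v) :
    ContDiff ℝ n (fun γ : C(K, E) => (⟨v, hv.continuous⟩ : C(E, F)).comp γ) := by
  -- The derivative of the operator is the superposition operator of `fderiv ℝ v` followed by a
  -- bounded linear map, so the target changes from F to E →L[ℝ] F. A common universe for E and F
  -- makes this possible.
  induction n generalizing F with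
  | zero =>
    simp only [Nat.cast_zero, contDiff_zero]
    exact ContinuousMap.continuous_postcomp _
  | succ n ih =>
    have hv1 : ContDiff ℝ 1 v := hv.of_le (by exact_mod_cast Nat.le_add_left 1 n)
    have hn : ContDiff ℝ ((n : ℕ∞ω) + 1) v := by exact_mod_cast hv
    have hd : ContDiff ℝ n (fderiv ℝ v) := (contDiff_succ_iff_fderiv.1 hn).2.2
    have : ContDiff ℝ ((n : ℕ∞ω) + 1)
        (fun γ : C(K, E) => (⟨v, hv.continuous⟩ : C(E, F)).comp γ) := by
      rw [contDiff_succ_iff_fderiv]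
      refine ⟨fun γ => (hasFDerivAt_postcomp hv1 γ).differentiableAt, by simp, ?_⟩
      rw [show fderiv ℝ (fun γ : C(K, E) => (⟨v, hv.continuous⟩ : C(E, F)).comp γ) = _ from
        funext fun γ => (hasFDerivAt_postcomp hv1 γ).fderiv]
      exact (pointwiseApply K E F).contDiff.comp (ih hd)
    exact_mod_cast this

end Superposition

/-! ### Smooth dependence of local flows on initial data, by the implicit function theorem. -/

section LocalFlow

variable {E : Type u} [NormedAddCommGroup E] [NormedSpace ℝ E]

/-- The primitive vanishing at `0`, as an operator on continuous paths. -/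
noncomputable def primitive (E : Type u) [NormedAddCommGroup E] [NormedSpace ℝ E] :
    C(Icc (0 : ℝ) 1, E) →L[ℝ] C(Icc (0 : ℝ) 1, E) :=
  have hc : ∀ γ : C(Icc (0 : ℝ) 1, E), Continuous fun s : ℝ => γ (projIcc 0 1 zero_le_one s) :=
    fun γ => γ.continuous.comp continuous_projIcc
  LinearMap.mkContinuous
    { toFun := fun γ => ⟨fun τ => ∫ s in (0 : ℝ)..τ, γ (projIcc 0 1 zero_le_one s),
        (intervalIntegral.continuous_primitive
          (fun a b => (hc γ).intervalIntegrable a b) 0).comp continuous_subtype_val⟩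
      map_add' := fun γ γ' => by
        ext τ
        exact intervalIntegral.integral_add ((hc γ).intervalIntegrable _ _)
          ((hc γ').intervalIntegrable _ _)
      map_smul' := fun a γ => by
        ext τ
        exact intervalIntegral.integral_smul _ _ } 1
    (fun γ => by
      rw [one_mul]
      refine (ContinuousMap.norm_le _ (norm_nonneg _)).2 fun τ => ?_
      refine (intervalIntegral.norm_integral_le_of_norm_le_const
        (C := ‖γ‖) fun s _ => γ.norm_coe_le_norm _).trans ?_
      rw [sub_zero, abs_of_nonneg τ.2.1]
      exact mul_le_of_le_one_right (norm_nonneg _) τ.2.2)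

/-- A continuous local flow of a vector field that is `C^∞` at `x₀` is `C^∞` at `(0, x₀)`. -/
theorem contDiffAt_localFlow [FiniteDimensional ℝ E] {v : E → E} {x₀ : E}
    (hv : ContDiffAt ℝ ∞ v x₀) {φ : ℝ × E → E} {ε : ℝ} (hε : 0 < ε)
    (h0 : ∀ᶠ x in 𝓝 x₀, φ (0, x) = x) (hφ : ContinuousAt φ (0, x₀))
    (hd : ∀ᶠ x in 𝓝 x₀, ∀ t ∈ Metric.ball (0 : ℝ) ε,
      HasDerivAt (fun t => φ (t, x)) (v (φ (t, x))) t) :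
    ContDiffAt ℝ ∞ φ (0, x₀) := by
  rw [contDiffAt_infty]
  intro m
  -- extend `v` globally
  obtain ⟨w, hw, hwv⟩ : ∃ w : E → E, ContDiff ℝ (m + 1 : ℕ) w ∧ w =ᶠ[𝓝 x₀] v := by
    obtain ⟨u, hu, hvu⟩ := (contDiffAt_infty.1 hv (m + 1)).eventually (by simp) |>.exists_mem
    obtain ⟨δ, hδ, hδu⟩ := Metric.mem_nhds_iff.1 hu
    let b : ContDiffBump x₀ := ⟨δ / 3, δ / 2, by positivity, by linarith⟩
    refine ⟨fun x => b x • v x, ?_, ?_⟩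
    · rw [contDiff_iff_contDiffAt]
      intro x
      by_cases hx : x ∈ Metric.ball x₀ δ
      · exact b.contDiff.contDiffAt.smul (hvu x (hδu hx))
      · have hx' : x ∉ tsupport b := by
          rw [b.tsupport_eq]
          intro h
          exact hx (lt_of_le_of_lt h (by show δ / 2 < δ; linarith))
        have : (fun x => b x • v x) =ᶠ[𝓝 x] fun _ => 0 := by
          filter_upwards [notMem_tsupport_iff_eventuallyEq.1 hx'] with y hy
          simp [hy]
        exact contDiffAt_const.congr_of_eventuallyEq this
    · filter_upwards [b.eventuallyEq_one] with x hx
      simp [hx]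
  have hφ0 : φ (0, x₀) = x₀ := h0.self_of_nhds
  set K := Icc (0 : ℝ) 1
  let cst : E →L[ℝ] C(K, E) := ContinuousLinearMap.const ℝ K
  -- The trajectory of x run for time t, rescaled to [0,1], solves γ = x + t∫w(γ), that is
  -- G((t,x),γ) = 0. Working with order m + 1 keeps G at least C¹, even for m = 0.
  let G : (ℝ × E) × C(K, E) → C(K, E) := fun q =>
    q.2 - cst q.1.2 - q.1.1 • primitive E ((⟨w, hw.continuous⟩ : C(E, E)).comp q.2)
  have hG : ContDiff ℝ (m + 1 : ℕ) G := by
    have h1 := contDiff_postcomp (K := K) (m + 1) hw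
    have h2 : ContDiff ℝ (m + 1 : ℕ) fun q : (ℝ × E) × C(K, E) =>
        primitive E ((⟨w, hw.continuous⟩ : C(E, E)).comp q.2) :=
      (primitive E).contDiff.comp (h1.comp contDiff_snd)
    exact (contDiff_snd.sub (cst.contDiff.comp (contDiff_snd.comp contDiff_fst))).sub
      ((contDiff_fst.comp contDiff_fst).smul h2)
  let u : (ℝ × E) × C(K, E) := ((0, x₀), cst x₀)
  have hGu : G u = 0 := by simp [G, u]
  have hn : ((m + 1 : ℕ) : ℕ∞ω) ≠ 0 := by simp
  -- At t = 0 the integral term is absent for every γ, so the partial derivative in γ is the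
  -- identity.
  have hinv : fderiv ℝ G u ∘L .inr ℝ (ℝ × E) C(K, E) = ContinuousLinearMap.id ℝ _ := by
    have h1 : HasFDerivAt G (fderiv ℝ G u) u := (hG.differentiable hn u).hasFDerivAt
    have h2 : HasFDerivAt (fun γ : C(K, E) => (((0 : ℝ), x₀), γ))
      (.inr ℝ (ℝ × E) C(K, E)) (cst x₀) := hasFDerivAt_prodMk_right _ _
    have h3 := HasFDerivAt.comp (cst x₀) (f := fun γ : C(K, E) => (((0 : ℝ), x₀), γ)) h1 h2
    have h4 : G ∘ (fun γ : C(K, E) => (((0 : ℝ), x₀), γ)) = fun γ => γ - cst x₀ := by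
      ext γ; simp [G]
    rw [h4] at h3
    exact h3.unique ((hasFDerivAt_id _).sub_const _)
  have hinv' : (fderiv ℝ G u ∘L .inr ℝ (ℝ × E) C(K, E)).IsInvertible := by
    rw [hinv]; exact ⟨ContinuousLinearEquiv.refl ℝ _, rfl⟩
  have cdf := hG.contDiffAt (x := u)
  set ψ := cdf.implicitFunction hn hinv'
  have hψ : ContDiffAt ℝ (m + 1 : ℕ) ψ (0, x₀) := cdf.contDiffAt_implicitFunction hn hinv'
  have hiff := cdf.eventually_apply_eq_iff_implicitFunction hn hinv'
  classical
  -- the rescaled trajectories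
  let c : ℝ × E → C(K, E) := fun p =>
    if h : Continuous (fun τ : K => φ (p.1 * τ, p.2)) then ⟨_, h⟩ else 0
  have hball : ∀ᶠ p : ℝ × E in 𝓝 (0, x₀), p.1 ∈ Metric.ball (0 : ℝ) ε :=
    continuous_fst.continuousAt.preimage_mem_nhds (Metric.ball_mem_nhds _ hε)
  have hsnd : Filter.Tendsto (Prod.snd : ℝ × E → E) (𝓝 (0, x₀)) (𝓝 x₀) :=
    continuous_snd.continuousAt
  have hτ : ∀ (p : ℝ) (τ : K), |p * τ| ≤ |p| := fun p τ => by
    rw [abs_mul, abs_of_nonneg τ.2.1]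
    exact mul_le_of_le_one_right (abs_nonneg _) τ.2.2
  have hcc : ∀ᶠ p : ℝ × E in 𝓝 (0, x₀), ∀ τ : K, c p τ = φ (p.1 * τ, p.2) := by
    filter_upwards [hball, hsnd.eventually hd] with p hp hdp τ
    have : Continuous (fun τ : K => φ (p.1 * τ, p.2)) := by
      rw [continuous_iff_continuousAt]
      intro τ
      have h1 : p.1 * τ ∈ Metric.ball (0 : ℝ) ε := by
        rw [mem_ball_zero_iff, Real.norm_eq_abs] at hp ⊢
        exact (hτ _ _).trans_lt hp
      exact ContinuousAt.comp (f := fun τ : K => p.1 * (τ : ℝ)) (g := fun t => φ (t, p.2))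
        (hdp _ h1).continuousAt (by fun_prop)
    simp [c, this]
  have hsmall : ∀ W ∈ 𝓝 x₀, ∀ᶠ p : ℝ × E in 𝓝 (0, x₀), ∀ τ : K, φ (p.1 * τ, p.2) ∈ W := by
    intro W hW
    have h1 := hφ.eventually (hφ0.symm ▸ hW : ∀ᶠ y in 𝓝 (φ (0, x₀)), y ∈ W)
    obtain ⟨δ, hδ, hδW⟩ := Metric.eventually_nhds_iff_ball.1 h1
    filter_upwards [Metric.ball_mem_nhds _ hδ] with p hp τ
    refine hδW _ ?_
    rw [Metric.mem_ball, Prod.dist_eq, max_lt_iff] at hp ⊢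
    refine ⟨?_, hp.2⟩
    have := hp.1
    rw [Real.dist_eq, sub_zero] at this ⊢
    exact (hτ _ _).trans_lt this
  have hct : Filter.Tendsto (fun p => (p, c p)) (𝓝 (0, x₀)) (𝓝 u) := by
    refine Filter.Tendsto.prodMk_nhds Filter.tendsto_id ?_
    rw [Metric.tendsto_nhds]
    intro δ hδ
    filter_upwards [hcc, hsmall _ (Metric.ball_mem_nhds x₀ (half_pos hδ))] with p h1 h2
    refine lt_of_le_of_lt ((ContinuousMap.dist_le (half_pos hδ).le).2 fun τ => ?_)
      (half_lt_self hδ)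
    rw [h1 τ]
    exact (h2 τ).le
  -- Near (0, x₀) the rescaled trajectories are zeros of G close to the constant path, so local
  -- uniqueness identifies them with the implicit function, which is C^(m+1).
  have hev : ∀ᶠ p : ℝ × E in 𝓝 (0, x₀), ψ p = c p := by
    filter_upwards [hct.eventually hiff, hcc, hsmall _ hwv, hball, hsnd.eventually hd,
      hsnd.eventually h0] with p h1 h2 h3 h4 h5 h6
    refine h1.1 ?_
    rw [hGu]
    ext τ
    have hmem : ∀ s ∈ uIcc (0 : ℝ) τ, s ∈ Icc (0 : ℝ) 1 := by
      intro s hs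
      rw [uIcc_of_le τ.2.1] at hs
      exact ⟨hs.1, hs.2.trans τ.2.2⟩
    have hint : ∫ s in (0 : ℝ)..τ, p.1 • w (c p (projIcc 0 1 zero_le_one s))
        = φ (p.1 * τ, p.2) - φ (p.1 * 0, p.2) := by
      refine intervalIntegral.integral_eq_sub_of_hasDerivAt (f := fun s => φ (p.1 * s, p.2))
        (fun s hs => ?_) ?_
      · have hs' := hmem s hs
        rw [projIcc_of_mem _ hs', h2]
        have h7 := h3 ⟨s, hs'⟩
        rw [h7]
        have h8 : p.1 * s ∈ Metric.ball (0 : ℝ) ε := by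
          rw [mem_ball_zero_iff, Real.norm_eq_abs] at h4 ⊢
          exact (hτ _ ⟨s, hs'⟩).trans_lt h4
        have := HasDerivAt.scomp s (h5 _ h8) ((hasDerivAt_id s).const_mul p.1)
        simpa [Function.comp_def] using this
      · refine Continuous.intervalIntegrable ?_ _ _
        exact continuous_const.smul (hw.continuous.comp
          ((c p).continuous.comp continuous_projIcc))
    rw [intervalIntegral.integral_smul] at hint
    change c p τ - p.2 - p.1 • ∫ s in (0 : ℝ)..τ, w (c p (projIcc 0 1 zero_le_one s)) = 0
    rw [hint, h2, mul_zero, h6, sub_self]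
  have hfin : (fun p => ψ p ⟨1, by simp [K]⟩) =ᶠ[𝓝 (0, x₀)] φ := by
    filter_upwards [hev, hcc] with p h1 h2
    rw [h1, h2]; simp
  let ev : C(K, E) →L[ℝ] E := ContinuousMap.evalCLM ℝ (⟨1, by simp [K]⟩ : K)
  have hev1 : ContDiffAt ℝ (m + 1 : ℕ) (fun p => ψ p ⟨1, by simp [K]⟩) (0, x₀) :=
    ContDiffAt.comp (g := ev) (0, x₀) ev.contDiff.contDiffAt hψ
  have : ContDiffAt ℝ (m + 1 : ℕ) φ (0, x₀) := hev1.congr_of_eventuallyEq hfin.symm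
  exact this.of_le (by exact_mod_cast Nat.le_succ m)

end LocalFlow

/-! ### Flows of smooth vector fields on manifolds. -/

section ManifoldFlow

variable {E : Type u} [NormedAddCommGroup E] [NormedSpace ℝ E]
  {H : Type*} [TopologicalSpace H] {I : ModelWithCorners ℝ E H}
  {N : Type*} [TopologicalSpace N] [ChartedSpace H N] [IsManifold I ∞ N]
  {E' : Type*} [NormedAddCommGroup E'] [NormedSpace ℝ E']
  {H' : Type*} [TopologicalSpace H'] {J : ModelWithCorners ℝ E' H'}
  {N' : Type*} [TopologicalSpace N'] [ChartedSpace H' N']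

/-- A linear map on ℝ is determined by its value at 1; this puts a derivative in the form used for
integral curves. -/
theorem _root_.HasMFDerivAt.smulRight_one {γ : ℝ → N} {t : ℝ}
    {A : TangentSpace 𝓘(ℝ, ℝ) t →L[ℝ] TangentSpace I (γ t)} (h : HasMFDerivAt 𝓘(ℝ, ℝ) I γ t A)
    {v : TangentSpace I (γ t)} (hv : A (1 : ℝ) = v) :
    HasMFDerivAt 𝓘(ℝ, ℝ) I γ t ((1 : ℝ →L[ℝ] ℝ).smulRight v) := by
  have : A = ((1 : ℝ →L[ℝ] ℝ).smulRight v) := by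
    refine ContinuousLinearMap.ext fun (c : ℝ) => ?_
    have h1 : c = c • (1 : ℝ) := by simp
    calc A c = A (c • (1 : ℝ)) := congrArg A h1
      _ = c • A (1 : ℝ) := A.map_smul c (1 : ℝ)
      _ = _ := by rw [hv]; rfl
  exact this ▸ h

/-- The coordinates of the tangent vector `V` at `x` in the chart around `x₀`. -/
noncomputable def chartCoord (I : ModelWithCorners ℝ E H) {N : Type*} [TopologicalSpace N]
    [ChartedSpace H N] (x₀ x : N) : TangentSpace I x →L[ℝ] E :=
  mfderiv I 𝓘(ℝ, E) (extChartAt I x₀) x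

theorem trivializationAt_snd_eq_chartCoord {x₀ x : N} (hx : x ∈ (chartAt H x₀).source)
    (V : TangentSpace I x) :
    (trivializationAt E (TangentSpace I) x₀ ⟨x, V⟩).2 = chartCoord I x₀ x V := by
  refine Eq.trans (b := (trivializationAt E (TangentSpace I) x₀).continuousLinearMapAt ℝ x V) ?_
    (congrArg (fun L => L V)
      (TangentBundle.continuousLinearMapAt_trivializationAt (𝕜 := ℝ) (I := I) hx))
  rw [Bundle.Trivialization.continuousLinearMapAt_apply,
    Bundle.Trivialization.coe_linearMapAt_of_mem]
  simpa using hx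

/-- Reduces smoothness of vectors along a map to smoothness of a function with values in the model
space, where linear operations can be performed. -/
theorem contMDiffAt_tangentBundle_iff {n : ℕ∞ω} {b : N' → N} {V : ∀ p, TangentSpace I (b p)}
    {p₀ : N'} (hb : ContMDiffAt J I n b p₀) :
    ContMDiffAt J I.tangent n (fun p => (⟨b p, V p⟩ : TangentBundle I N)) p₀ ↔
      ContMDiffAt J 𝓘(ℝ, E) n (fun p => chartCoord I (b p₀) (b p) (V p)) p₀ := by
  rw [ModelWithCorners.tangent, Bundle.contMDiffAt_totalSpace]
  have h : (fun p => chartCoord I (b p₀) (b p) (V p)) =ᶠ[𝓝 p₀]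
      fun p => (trivializationAt E (TangentSpace I) (b p₀) ⟨b p, V p⟩).2 := by
    filter_upwards [hb.continuousAt.preimage_mem_nhds
      ((chartAt H (b p₀)).open_source.mem_nhds (mem_chart_source H _))] with p hp
    exact (trivializationAt_snd_eq_chartCoord hp _).symm
  constructor
  · rintro ⟨-, h2⟩
    exact h2.congr_of_eventuallyEq h
  · intro h2
    exact ⟨hb, h2.congr_of_eventuallyEq h.symm⟩

variable [I.Boundaryless]

theorem hasMFDerivAt_extChartAt_symm {x₀ : N} {y : E} (hy : y ∈ (extChartAt I x₀).target) :
    HasMFDerivAt 𝓘(ℝ, E) I (extChartAt I x₀).symm y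
      (mfderiv 𝓘(ℝ, E) I (extChartAt I x₀).symm y) := by
  have := mdifferentiableWithinAt_extChartAt_symm (I := I) hy
  rw [I.range_eq_univ, mdifferentiableWithinAt_univ] at this
  exact this.hasMFDerivAt

theorem mfderiv_extChartAt_symm_chartCoord {x₀ x : N} (hx : x ∈ (extChartAt I x₀).source)
    (V : TangentSpace I x) :
    mfderiv 𝓘(ℝ, E) I (extChartAt I x₀).symm (extChartAt I x₀ x) (chartCoord I x₀ x V) = V := by
  have h := mfderivWithin_extChartAt_symm_comp_mfderiv_extChartAt' (I := I) hx
  rw [I.range_eq_univ, mfderivWithin_univ] at h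
  exact congrArg (fun L => L V) h

theorem chartCoord_mfderiv_extChartAt_symm {x₀ : N} {y : E} (hy : y ∈ (extChartAt I x₀).target)
    (v : E) : chartCoord I x₀ ((extChartAt I x₀).symm y)
      (mfderiv 𝓘(ℝ, E) I (extChartAt I x₀).symm y v) = v := by
  have h := mfderiv_extChartAt_comp_mfderivWithin_extChartAt_symm (I := I) hy
  rw [I.range_eq_univ, mfderivWithin_univ] at h
  exact congrArg (fun L => L v) h

/-- The coordinate expression of a vector field in a chart. -/
theorem contDiffAt_chartCoord {X : ∀ x : N, TangentSpace I x} {x₀ : N}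
    (hX : ContMDiffAt I I.tangent ∞ (fun x => (⟨x, X x⟩ : TangentBundle I N)) x₀) :
    ContDiffAt ℝ ∞ (fun y => chartCoord I x₀ ((extChartAt I x₀).symm y)
      (X ((extChartAt I x₀).symm y))) (extChartAt I x₀ x₀) := by
  rw [← contMDiffAt_iff_contDiffAt]
  have h1 := (contMDiffAt_tangentBundle_iff (b := fun x : N => x) contMDiffAt_id).1 hX
  have h2 : ContMDiffAt 𝓘(ℝ, E) I ∞ (extChartAt I x₀).symm (extChartAt I x₀ x₀) :=
    (contMDiffOn_extChartAt_symm x₀).contMDiffAt (extChartAt_target_mem_nhds x₀)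
  have h3 : ContMDiffAt I 𝓘(ℝ, E) ∞ (fun x => chartCoord I x₀ x (X x))
      ((extChartAt I x₀).symm (extChartAt I x₀ x₀)) := by
    rw [extChartAt_to_inv]
    exact h1
  exact ContMDiffAt.comp (extChartAt I x₀ x₀) h3 h2

variable [FiniteDimensional ℝ E]

/-- Picard–Lindelöf in a chart gives a continuous local flow; `contDiffAt_localFlow` makes it
smooth, and the inverse chart carries it back. -/
theorem exists_localFlow {X : ∀ x : N, TangentSpace I x} {x₀ : N}
    (hX : ContMDiffAt I I.tangent ∞ (fun x => (⟨x, X x⟩ : TangentBundle I N)) x₀) :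
    ∃ ε > 0, ∃ U ∈ 𝓝 x₀, ∃ φ : ℝ × N → N,
      (∀ x ∈ U, φ (0, x) = x ∧ IsMIntegralCurveOn (fun t => φ (t, x)) X (Ioo (-ε) ε)) ∧
      ContMDiffAt (𝓘(ℝ, ℝ).prod I) I ∞ φ (0, x₀) := by
  have : CompleteSpace E := FiniteDimensional.complete ℝ E
  set e := extChartAt I x₀
  set y₀ := e x₀
  set v : E → E := fun y => chartCoord I x₀ (e.symm y) (X (e.symm y))
  have hv : ContDiffAt ℝ ∞ v y₀ := contDiffAt_chartCoord hX
  obtain ⟨ε, hε, a, r, L, K, hr, hpl⟩ := IsPicardLindelof.of_contDiffAt_one (hv.of_le (by simp))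
  obtain ⟨α, hα, hαc⟩ := (hpl 0).exists_forall_mem_closedBall_eq_hasDerivWithinAt_continuousOn
  simp only [zero_sub, zero_add] at hα hαc
  have hr' : (0 : ℝ) < r := hr
  have hball : Metric.ball y₀ r ∈ 𝓝 y₀ := Metric.ball_mem_nhds _ hr'
  have hd : ∀ y ∈ Metric.ball y₀ r, ∀ t ∈ Metric.ball (0 : ℝ) ε,
      HasDerivAt (fun t => α (y, t)) (v (α (y, t))) t := by
    intro y hy t ht
    rw [Real.ball_eq_Ioo, zero_sub, zero_add] at ht
    exact ((hα y (Metric.ball_subset_closedBall hy)).2 t (Ioo_subset_Icc_self ht)).hasDerivAt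
      (Icc_mem_nhds ht.1 ht.2)
  have h0 : α (y₀, 0) = y₀ := (hα y₀ (Metric.mem_closedBall_self hr'.le)).1
  have hc : ContinuousAt α (y₀, 0) := hαc.continuousAt
    (prod_mem_nhds (Metric.closedBall_mem_nhds _ hr') (Icc_mem_nhds (by linarith) hε))
  let φ₀ : ℝ × E → E := fun p => α (p.2, p.1)
  have hφc : ContinuousAt φ₀ (0, y₀) :=
    ContinuousAt.comp (f := fun p : ℝ × E => (p.2, p.1)) hc (by fun_prop)
  have hφs : ContDiffAt ℝ ∞ φ₀ (0, y₀) :=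
    contDiffAt_localFlow hv hε (Filter.eventually_of_mem hball fun y hy =>
      (hα y (Metric.ball_subset_closedBall hy)).1) hφc (Filter.eventually_of_mem hball hd)
  have htgt : e.target ∈ 𝓝 (φ₀ (0, y₀)) := by
    show e.target ∈ 𝓝 (α (y₀, 0))
    rw [h0]; exact extChartAt_target_mem_nhds x₀
  -- For times and points within δ the trajectory stays in the target of the chart, where the
  -- coordinate field corresponds to X.
  obtain ⟨δ, hδ, hδ'⟩ := Metric.mem_nhds_iff.1 (hφc htgt)
  have hy0 : (0 : ℝ) < min δ r := lt_min hδ hr'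
  refine ⟨min δ ε, lt_min hδ hε, e.source ∩ e ⁻¹' (Metric.ball y₀ (min δ r)),
    Filter.inter_mem (extChartAt_source_mem_nhds x₀)
      ((continuousAt_extChartAt x₀).preimage_mem_nhds (Metric.ball_mem_nhds _ hy0)),
    fun p => e.symm (φ₀ (p.1, e p.2)), ?_, ?_⟩
  · rintro x ⟨hx, hxb⟩
    have hxr : e x ∈ Metric.ball y₀ r := Metric.ball_subset_ball (min_le_right _ _) hxb
    refine ⟨?_, ?_⟩
    · show e.symm (α (e x, 0)) = x
      rw [(hα _ (Metric.ball_subset_closedBall hxr)).1, e.left_inv hx]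
    · intro t ht
      have ht1 : t ∈ Metric.ball (0 : ℝ) ε := by
        rw [Real.ball_eq_Ioo, zero_sub, zero_add]
        exact ⟨(neg_le_neg (min_le_right _ _)).trans_lt ht.1, ht.2.trans_le (min_le_right _ _)⟩
      have ht2 : φ₀ (t, e x) ∈ e.target := by
        apply hδ'
        rw [Metric.mem_ball, Prod.dist_eq, max_lt_iff]
        refine ⟨?_, Metric.ball_subset_ball (min_le_left _ _) hxb⟩
        rw [Real.dist_eq, sub_zero, abs_lt]
        exact ⟨(neg_le_neg (min_le_left _ _)).trans_lt ht.1, ht.2.trans_le (min_le_left _ _)⟩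
      have h1 : HasMFDerivAt 𝓘(ℝ, ℝ) 𝓘(ℝ, E) (fun t => φ₀ (t, e x)) t _ :=
        (hd _ hxr t ht1).hasFDerivAt.hasMFDerivAt
      have h2 := (hasMFDerivAt_extChartAt_symm (I := I) ht2).comp t h1
      have h3 : mfderiv 𝓘(ℝ, E) I e.symm (φ₀ (t, e x)) (v (φ₀ (t, e x))) =
          X (e.symm (φ₀ (t, e x))) := by
        have := mfderiv_extChartAt_symm_chartCoord (I := I) (e.map_target ht2)
          (X (e.symm (φ₀ (t, e x))))
        rw [e.right_inv ht2] at this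
        exact this
      refine HasMFDerivAt.hasMFDerivWithinAt ?_
      refine h2.smulRight_one (Eq.trans ?_ h3)
      exact congrArg (mfderiv 𝓘(ℝ, E) I e.symm (φ₀ (t, e x))) (one_smul ℝ _)
  · have h1 : ContMDiffAt (𝓘(ℝ, ℝ).prod I) (𝓘(ℝ, ℝ).prod 𝓘(ℝ, E)) ∞
        (fun p : ℝ × N => (p.1, e p.2)) (0, x₀) :=
      contMDiffAt_fst.prodMk (ContMDiffAt.comp (0, x₀) contMDiffAt_extChartAt contMDiffAt_snd)
    have h2 : ContMDiffAt (𝓘(ℝ, ℝ).prod 𝓘(ℝ, E)) 𝓘(ℝ, E) ∞ φ₀ (0, y₀) := by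
      rw [← modelWithCornersSelf_prod, chartedSpaceSelf_prod]
      exact hφs.contMDiffAt
    have h3 : ContMDiffAt 𝓘(ℝ, E) I ∞ e.symm (φ₀ (0, y₀)) :=
      (contMDiffOn_extChartAt_symm x₀).contMDiffAt htgt
    exact ContMDiffAt.comp (f := fun p : ℝ × N => φ₀ (p.1, e p.2)) (0, x₀) h3
      (ContMDiffAt.comp (f := fun p : ℝ × N => (p.1, e p.2)) (g := φ₀) (0, x₀) h2 h1)

variable [T2Space N] {X : ∀ x : N, TangentSpace I x}

theorem integralCurve_unique
    (hX : ContMDiff I I.tangent ∞ (fun x => (⟨x, X x⟩ : TangentBundle I N)))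
    {γ γ' : ℝ → N} (hγ : IsMIntegralCurve γ X) (hγ' : IsMIntegralCurve γ' X) {t₀ : ℝ}
    (h : γ t₀ = γ' t₀) : γ = γ' := by
  have : CompleteSpace E := FiniteDimensional.complete ℝ E
  exact isMIntegralCurve_Ioo_eq_of_contMDiff_boundaryless (hX.of_le (by simp)) hγ hγ' h

theorem flow_add (hX : ContMDiff I I.tangent ∞ (fun x => (⟨x, X x⟩ : TangentBundle I N)))
    {Φ : ℝ → N → N} (h0 : ∀ x, Φ 0 x = x) (hΦ : ∀ x, IsMIntegralCurve (fun t => Φ t x) X)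
    (s t : ℝ) (x : N) : Φ (s + t) x = Φ s (Φ t x) := by
  have h1 : IsMIntegralCurve ((fun s => Φ s x) ∘ (· + t)) X := (hΦ x).comp_add t
  have := integralCurve_unique hX h1 (hΦ (Φ t x)) (t₀ := 0) (by simp [h0])
  exact congrFun this s

/-- The flow of a complete smooth vector field is smooth. -/
theorem contMDiff_flow (hX : ContMDiff I I.tangent ∞ (fun x => (⟨x, X x⟩ : TangentBundle I N)))
    {Φ : ℝ → N → N} (h0 : ∀ x, Φ 0 x = x) (hΦ : ∀ x, IsMIntegralCurve (fun t => Φ t x) X) :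
    ContMDiff (𝓘(ℝ, ℝ).prod I) I ∞ (fun p : ℝ × N => Φ p.1 p.2) := by
  have : CompleteSpace E := FiniteDimensional.complete ℝ E
  -- Finite order is used because C^n at a point spreads to a neighbourhood for finite n.
  rw [contMDiff_infty]
  intro n
  have hman : IsManifold I (n : ℕ∞ω) N := inferInstance
  have hman' : IsManifold (𝓘(ℝ, ℝ).prod I) (n : ℕ∞ω) (ℝ × N) := inferInstance
  -- smoothness at time zero
  have hzero : ∀ x : N, ∀ᶠ p in 𝓝 ((0 : ℝ), x),
      ContMDiffAt (𝓘(ℝ, ℝ).prod I) I n (fun p : ℝ × N => Φ p.1 p.2) p := by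
    intro x
    obtain ⟨ε, hε, U, hU, φ, hφ, hφs⟩ := exists_localFlow (hX x)
    have heq : (fun p : ℝ × N => Φ p.1 p.2) =ᶠ[𝓝 ((0 : ℝ), x)] φ := by
      filter_upwards [prod_mem_nhds (Ioo_mem_nhds (neg_lt_zero.2 hε) hε) hU] with p hp
      have := isMIntegralCurveOn_Ioo_eqOn_of_contMDiff_boundaryless (I := I)
        (t₀ := (0 : ℝ)) (a := -ε) (b := ε) ⟨neg_lt_zero.2 hε, hε⟩ (hX.of_le (by simp))
        ((hΦ p.2).isMIntegralCurveOn _) (hφ p.2 hp.2).2 (by rw [h0, (hφ p.2 hp.2).1])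
      exact this hp.1
    have h1 : ContMDiffAt (𝓘(ℝ, ℝ).prod I) I n (fun p : ℝ × N => Φ p.1 p.2) (0, x) :=
      (hφs.congr_of_eventuallyEq heq).of_le (by exact_mod_cast le_top)
    exact (contMDiffAt_iff_contMDiffAt_nhds (by simp)).1 h1
  -- uniform smoothness for small times along an orbit segment
  rintro ⟨T, x⟩
  have horb : IsCompact ((fun t => Φ t x) '' Icc (-|T|) |T|) :=
    isCompact_Icc.image (hΦ x).continuous
  obtain ⟨δ, hδ, hδ'⟩ : ∃ δ > 0, ∀ t ∈ Icc (-|T|) |T|, ∀ s : ℝ, |s| < δ →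
      ContMDiffAt (𝓘(ℝ, ℝ).prod I) I n (fun p : ℝ × N => Φ p.1 p.2) (s, Φ t x) := by
    have := horb.eventually_forall_of_forall_eventually (x₀ := (0 : ℝ))
      (P := fun s y => ContMDiffAt (𝓘(ℝ, ℝ).prod I) I n (fun p : ℝ × N => Φ p.1 p.2) (s, y))
      (fun y _ => hzero y)
    obtain ⟨δ, hδ, h⟩ := Metric.eventually_nhds_iff.1 this
    exact ⟨δ, hδ, fun t ht s hs => h (by simpa using hs) _ ⟨t, ht, rfl⟩⟩
  -- The flow for time p.1 is the k-fold iterate of the flow for p.1/k. With |T|/k < δ every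
  -- intermediate step falls in the range of smoothness just found.
  obtain ⟨k, hk⟩ := exists_nat_gt (|T| / δ)
  have hk0 : (0 : ℝ) < k := lt_of_le_of_lt (by positivity) hk
  have hstep : |T / k| < δ := by
    rw [abs_div, abs_of_pos hk0, div_lt_comm₀ hk0 hδ]; exact hk
  have hiter : ∀ j : ℕ, j ≤ k → ContMDiffAt (𝓘(ℝ, ℝ).prod I) I n
      (fun p : ℝ × N => Φ (j * (p.1 / k)) p.2) (T, x) := by
    intro j
    induction j with
    | zero =>
      intro _
      simp only [Nat.cast_zero, zero_mul, h0]
      exact contMDiffAt_snd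
    | succ j ih =>
      intro hj
      have h1 := ih (by omega)
      have h2 : ContMDiffAt (𝓘(ℝ, ℝ).prod I) (𝓘(ℝ, ℝ).prod I) n
          (fun p : ℝ × N => (p.1 / k, Φ (j * (p.1 / k)) p.2)) (T, x) := by
        refine ContMDiffAt.prodMk ?_ h1
        have : ContDiff ℝ n (fun t : ℝ => t / k) := by fun_prop
        exact this.contMDiff.contMDiffAt.comp (T, x) contMDiffAt_fst
      have hmem : (j : ℝ) * (T / k) ∈ Icc (-|T|) |T| := by
        rw [mem_Icc, ← abs_le, abs_mul, abs_div, abs_of_pos hk0, Nat.abs_cast, mul_div_assoc',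
          div_le_iff₀ hk0, mul_comm]
        gcongr
        omega
      have h3 := ContMDiffAt.comp (f := fun p : ℝ × N => (p.1 / k, Φ (j * (p.1 / k)) p.2))
        (T, x) (hδ' _ hmem _ hstep) h2
      refine h3.congr_of_eventuallyEq (Filter.Eventually.of_forall fun p => ?_)
      show Φ ((j + 1 : ℕ) * (p.1 / k)) p.2 = Φ (p.1 / k) (Φ (j * (p.1 / k)) p.2)
      rw [← flow_add hX h0 hΦ]
      congr 1
      push_cast; ring
  refine (hiter k le_rfl).congr_of_eventuallyEq (Filter.Eventually.of_forall fun p => ?_)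
  show Φ p.1 p.2 = Φ (k * (p.1 / k)) p.2
  rw [mul_div_cancel₀ _ hk0.ne']

/-- Each point has a neighbourhood with a common existence time, and finitely many such
neighbourhoods cover C. -/
theorem exists_uniform_time
    (hX : ContMDiff I I.tangent ∞ (fun x => (⟨x, X x⟩ : TangentBundle I N))) {C : Set N}
    (hC : IsCompact C) : ∃ ε > 0, ∀ x ∈ C, ∃ γ : ℝ → N, γ 0 = x ∧
      IsMIntegralCurveOn γ X (Ioo (-ε) ε) := by
  have h : ∀ x ∈ C, ∀ᶠ p in 𝓝 (0 : ℝ) ×ˢ 𝓝 x, 0 < p.1 → ∃ γ : ℝ → N, γ 0 = p.2 ∧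
      IsMIntegralCurveOn γ X (Ioo (-p.1) p.1) := by
    intro x _
    obtain ⟨ε, hε, U, hU, φ, hφ, -⟩ := exists_localFlow (hX x)
    filter_upwards [Filter.prod_mem_prod (Iio_mem_nhds hε) hU] with p hp h0
    exact ⟨fun t => φ (t, p.2), (hφ _ hp.2).1, (hφ _ hp.2).2.mono
      (Ioo_subset_Ioo (neg_le_neg hp.1.le) hp.1.le)⟩
  have h' := hC.eventually_forall_of_forall_eventually (x₀ := (0 : ℝ))
    (P := fun ε x => 0 < ε → ∃ γ : ℝ → N, γ 0 = x ∧ IsMIntegralCurveOn γ X (Ioo (-ε) ε))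
    (fun x hx => by rw [nhds_prod_eq]; exact h x hx)
  obtain ⟨δ, hδ, hδ'⟩ := Metric.eventually_nhds_iff.1 h'
  exact ⟨δ / 2, half_pos hδ, fun x hx => hδ' (by
    rw [Real.dist_eq, sub_zero, abs_of_pos (half_pos hδ)]; linarith) x hx (half_pos hδ)⟩

/-- A common existence time allows every integral curve to be prolonged indefinitely. -/
theorem exists_flow
    (hX : ContMDiff I I.tangent ∞ (fun x => (⟨x, X x⟩ : TangentBundle I N)))
    {ε : ℝ} (hε : 0 < ε) (h : ∀ x, ∃ γ : ℝ → N, γ 0 = x ∧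
      IsMIntegralCurveOn γ X (Ioo (-ε) ε)) :
    ∃ Φ : ℝ → N → N, (∀ x, Φ 0 x = x) ∧ ∀ x, IsMIntegralCurve (fun t => Φ t x) X := by
  have : CompleteSpace E := FiniteDimensional.complete ℝ E
  choose Φ hΦ using exists_isMIntegralCurve_of_isMIntegralCurveOn (hX.of_le (by simp)) hε h
  exact ⟨fun t x => Φ x t, fun x => (hΦ x).1, fun x => (hΦ x).2⟩

end ManifoldFlow

/-! ### Smoothness of inverses. -/

section InverseFunction

variable {E : Type*} [NormedAddCommGroup E] [NormedSpace ℝ E] [FiniteDimensional ℝ E]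
  {H : Type*} [TopologicalSpace H] {I : ModelWithCorners ℝ E H} [I.Boundaryless]
  {N : Type*} [TopologicalSpace N] [ChartedSpace H N] [IsManifold I ∞ N]
  {E' : Type*} [NormedAddCommGroup E'] [NormedSpace ℝ E']
  {H' : Type*} [TopologicalSpace H'] {J : ModelWithCorners ℝ E' H'} [J.Boundaryless]
  {N' : Type*} [TopologicalSpace N'] [ChartedSpace H' N'] [IsManifold J ∞ N']

/-- A left inverse of a smooth map with bijective derivative is smooth. -/
theorem contMDiffAt_leftInverse {Θ : N → N'} {k : N' → N} {x : N}
    (hΘ : ContMDiffAt I J ∞ Θ x) (hb : Function.Bijective (mfderiv I J Θ x))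
    (hk : ∀ᶠ x' in 𝓝 x, k (Θ x') = x') : ContMDiffAt J I ∞ k (Θ x) := by
  have : CompleteSpace E := FiniteDimensional.complete ℝ E
  set e := extChartAt I x
  set e' := extChartAt J (Θ x)
  set G : E → E' := fun y => e' (Θ (e.symm y))
  have hG : ContDiffAt ℝ ∞ G (e x) := by
    have := (contMDiffAt_iff.1 hΘ).2
    rw [I.range_eq_univ, contDiffWithinAt_univ] at this
    exact this
  have hGd : ∃ A : E ≃L[ℝ] E', HasFDerivAt G (A : E →L[ℝ] E') (e x) := by
    obtain ⟨B, hB⟩ : ∃ B : E →L[ℝ] E', B = mfderiv I J Θ x := ⟨mfderiv I J Θ x, rfl⟩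
    have h1 : mfderiv I J Θ x = fderiv ℝ G (e x) := by
      have h : HasFDerivWithinAt G B (range I) (e x) := by
        subst hB
        exact (hΘ.mdifferentiableAt (by simp)).hasMFDerivAt.2
      rw [I.range_eq_univ, hasFDerivWithinAt_univ] at h
      exact hB.symm.trans h.fderiv.symm
    have h2 : Function.Bijective (fderiv ℝ G (e x)) := by rw [← h1]; exact hb
    let A₀ : E ≃ₗ[ℝ] E' := LinearEquiv.ofBijective (fderiv ℝ G (e x)).toLinearMap h2
    have : FiniteDimensional ℝ E' := A₀.finiteDimensional
    refine ⟨A₀.toContinuousLinearEquiv, ?_⟩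
    have h3 : (A₀.toContinuousLinearEquiv : E →L[ℝ] E') = fderiv ℝ G (e x) := by ext; rfl
    rw [h3]
    exact (hG.differentiableAt (by simp)).hasFDerivAt
  obtain ⟨A, hA⟩ := hGd
  have hn : (∞ : ℕ∞ω) ≠ 0 := by simp
  set ℓ := hG.localInverse hA hn
  have hGx : G (e x) = e' (Θ x) := by
    show e' (Θ (e.symm (e x))) = _
    rw [extChartAt_to_inv]
  have hℓs : ContDiffAt ℝ ∞ ℓ (e' (Θ x)) := hGx ▸ hG.to_localInverse hA hn
  have hℓx : ℓ (e' (Θ x)) = e x := by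
    have := hG.localInverse_apply_image hA hn
    rwa [hGx] at this
  have hri : ∀ᶠ z in 𝓝 (e' (Θ x)), G (ℓ z) = z := by
    have := (hG.hasStrictFDerivAt' hA hn).eventually_right_inverse
    rwa [hGx] at this
  have he' : ContMDiffAt J 𝓘(ℝ, E') ∞ e' (Θ x) := contMDiffAt_extChartAt
  have hes : ContMDiffAt 𝓘(ℝ, E) I ∞ e.symm (ℓ (e' (Θ x))) := by
    rw [hℓx]
    exact (contMDiffOn_extChartAt_symm x).contMDiffAt (extChartAt_target_mem_nhds x)
  have hK : ContMDiffAt J I ∞ (fun y => e.symm (ℓ (e' y))) (Θ x) :=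
    ContMDiffAt.comp (g := e.symm) (f := fun y => ℓ (e' y)) (Θ x) hes
      (ContMDiffAt.comp (g := ℓ) (f := e') (Θ x) hℓs.contMDiffAt he')
  have hKx : e.symm (ℓ (e' (Θ x))) = x := by rw [hℓx, extChartAt_to_inv]
  have hKt : Filter.Tendsto (fun y => e.symm (ℓ (e' y))) (𝓝 (Θ x)) (𝓝 x) := by
    have := hK.continuousAt.tendsto
    rwa [hKx] at this
  -- The map k is not assumed continuous. The local inverse produces, for each y near Θ x, a point
  -- near x with image y, and the left-inverse identity at that point computes k y.
  refine hK.congr_of_eventuallyEq ?_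
  filter_upwards [hKt.eventually hk, he'.continuousAt.eventually hri,
    (hΘ.continuousAt.tendsto.comp hKt).eventually (extChartAt_source_mem_nhds (I := J) (Θ x)),
    extChartAt_source_mem_nhds (I := J) (Θ x)] with y h1 h2 h3 h4
  have h5 : Θ (e.symm (ℓ (e' y))) = y := e'.injOn h3 h4 h2
  rw [h5] at h1
  exact h1

end InverseFunction

/-! ### Pull-back of 1-forms and naturality of the exterior derivative. -/

section Forms

variable {d : ℕ} {M : Type*} [TopologicalSpace M] [ChartedSpace (EuclideanSpace ℝ (Fin d)) M]
  [IsManifold (𝓡 d) ∞ M] {α : ∀ x : M, TangentSpace (𝓡 d) x →L[ℝ] ℝ}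
  {E' : Type*} [NormedAddCommGroup E'] [NormedSpace ℝ E']

/-- The pull-back of a 1-form under a map from a normed space. -/
noncomputable def pullForm (α : ∀ x : M, TangentSpace (𝓡 d) x →L[ℝ] ℝ) (u : E' → M) (q : E') :
    E' →L[ℝ] ℝ :=
  (α (u q)).comp (mfderiv 𝓘(ℝ, E') (𝓡 d) u q)

theorem pullForm_apply (u : E' → M) (q v : E') :
    pullForm α u q v = α (u q) (mfderiv 𝓘(ℝ, E') (𝓡 d) u q v) := rfl

theorem chartForm_eq_pullForm (x₀ : M) :
    chartForm α x₀ = pullForm α (extChartAt (𝓡 d) x₀).symm := rfl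

theorem pullForm_congr {u u' : E' → M} {q : E'} (h : u =ᶠ[𝓝 q] u') :
    pullForm α u q = pullForm α u' q := by
  ext v
  rw [pullForm_apply, pullForm_apply]
  have h1 := h.self_of_nhds
  have h2 := h.mfderiv_eq (I := 𝓘(ℝ, E')) (I' := 𝓡 d)
  have key : ∀ (y : M) (hy : u q = y) (A : TangentSpace 𝓘(ℝ, E') q →L[ℝ] TangentSpace (𝓡 d) y),
      (mfderiv 𝓘(ℝ, E') (𝓡 d) u q : E' →L[ℝ] EuclideanSpace ℝ (Fin d)) =
        (A : E' →L[ℝ] EuclideanSpace ℝ (Fin d)) →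
      α (u q) (mfderiv 𝓘(ℝ, E') (𝓡 d) u q v) = α y (A v) := by
    intro y hy A hA
    subst hy
    exact congrArg (α (u q)) (congrArg (fun L : E' →L[ℝ] EuclideanSpace ℝ (Fin d) => L v) hA)
  exact key _ h1 _ h2

theorem pullForm_comp {g : EuclideanSpace ℝ (Fin d) → M} {ψ : E' → EuclideanSpace ℝ (Fin d)}
    {q : E'} (hg : MDifferentiableAt 𝓘(ℝ, EuclideanSpace ℝ (Fin d)) (𝓡 d) g (ψ q))
    (hψ : DifferentiableAt ℝ ψ q) :
    pullForm α (fun q => g (ψ q)) q = (pullForm α g (ψ q)).comp (fderiv ℝ ψ q) := by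
  ext v
  rw [pullForm_apply]
  have h := mfderiv_comp (I := 𝓘(ℝ, E')) q hg hψ.mdifferentiableAt
  rw [mfderiv_eq_fderiv] at h
  exact congrArg (α (g (ψ q))) (congrArg (fun L : E' →L[ℝ] EuclideanSpace ℝ (Fin d) => L v) h)

theorem contDiffAt_extChartAt_comp {u : E' → M} {p : E'}
    (hu : ContMDiffAt 𝓘(ℝ, E') (𝓡 d) ∞ u p) :
    ContDiffAt ℝ ∞ (fun q => extChartAt (𝓡 d) (u p) (u q)) p := by
  rw [← contMDiffAt_iff_contDiffAt]
  exact ContMDiffAt.comp p (contMDiffAt_extChartAt (I := 𝓡 d) (n := ∞) (x := u p)) hu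

/-- The pull-back form of a map `u` into `M` read in the chart around a value of `u`. -/
theorem eventually_pullForm {u : E' → M} {p : E'}
    (hu : ContMDiffAt 𝓘(ℝ, E') (𝓡 d) ∞ u p) :
    pullForm α u =ᶠ[𝓝 p] fun q => (chartForm α (u p) (extChartAt (𝓡 d) (u p) (u q))).comp
      (fderiv ℝ (fun q => extChartAt (𝓡 d) (u p) (u q)) q) := by
  set e := extChartAt (𝓡 d) (u p)
  have hψ := contDiffAt_extChartAt_comp hu
  have h1 : ∀ᶠ q in 𝓝 p, u q ∈ e.source := hu.continuousAt (extChartAt_source_mem_nhds _)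
  have h2 : ∀ᶠ q in 𝓝 p, DifferentiableAt ℝ (fun q => e (u q)) q :=
    ((hψ.of_le (m := 1) (by simp)).eventually (by simp)).mono
      fun q hq => hq.differentiableAt (by simp)
  filter_upwards [h1.eventually_nhds, h2] with q hq1 hq2
  have h3 : u =ᶠ[𝓝 q] fun q => e.symm (e (u q)) := by
    filter_upwards [hq1] with r hr
    exact (e.left_inv hr).symm
  rw [pullForm_congr h3, chartForm_eq_pullForm]
  exact pullForm_comp (g := e.symm) (ψ := fun q => e (u q)) (hasMFDerivAt_extChartAt_symm
    (e.map_source hq1.self_of_nhds)).mdifferentiableAt hq2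

theorem contDiffAt_chartForm (hα : IsSmoothForm α) {x₀ : M} {y : EuclideanSpace ℝ (Fin d)}
    (hy : y ∈ (extChartAt (𝓡 d) x₀).target) : ContDiffAt ℝ ∞ (chartForm α x₀) y :=
  (hα x₀).contDiffAt ((isOpen_extChartAt_target x₀).mem_nhds hy)

theorem contDiffAt_pullForm (hα : IsSmoothForm α) {u : E' → M} {p : E'}
    (hu : ContMDiffAt 𝓘(ℝ, E') (𝓡 d) ∞ u p) : ContDiffAt ℝ ∞ (pullForm α u) p := by
  refine ContDiffAt.congr_of_eventuallyEq ?_ (eventually_pullForm hu)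
  have hψ := contDiffAt_extChartAt_comp hu
  exact ((contDiffAt_chartForm hα (mem_extChartAt_target (u p))).comp p hψ).clm_comp
    (hψ.fderiv_right (by simp))

/-- The tangent vector `du v`, seen in the model space through Mathlib's identification. -/
theorem mfderiv_eq_fderiv_extChartAt {u : E' → M} {p : E'}
    (hu : ContMDiffAt 𝓘(ℝ, E') (𝓡 d) ∞ u p) (v : E') :
    mfderiv 𝓘(ℝ, E') (𝓡 d) u p v = fderiv ℝ (fun q => extChartAt (𝓡 d) (u p) (u q)) p v := by
  have h := mfderiv_comp (I := 𝓘(ℝ, E')) (I'' := 𝓘(ℝ, EuclideanSpace ℝ (Fin d))) p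
    (mdifferentiableAt_extChartAt (I := 𝓡 d) (mem_chart_source _ (u p)))
    (hu.mdifferentiableAt (by simp))
  rw [mfderiv_extChartAt_self] at h
  have h2 := (mfderiv_eq_fderiv (f := fun q => extChartAt (𝓡 d) (u p) (u q)) (x := p)).symm.trans h
  exact (congrArg (fun L : E' →L[ℝ] EuclideanSpace ℝ (Fin d) => L v) h2).symm

/-- The exterior derivative commutes with pull-back. -/
theorem fderiv_pullForm (hα : IsSmoothForm α) {u : E' → M} {p : E'}
    (hu : ContMDiffAt 𝓘(ℝ, E') (𝓡 d) ∞ u p) (v w : E') :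
    fderiv ℝ (pullForm α u) p v w - fderiv ℝ (pullForm α u) p w v =
      dForm α (u p) (mfderiv 𝓘(ℝ, E') (𝓡 d) u p v) (mfderiv 𝓘(ℝ, E') (𝓡 d) u p w) := by
  set ψ := fun q => extChartAt (𝓡 d) (u p) (u q)
  set A := chartForm α (u p)
  have hψ : ContDiffAt ℝ ∞ ψ p := contDiffAt_extChartAt_comp hu
  have hA : ContDiffAt ℝ ∞ A (ψ p) := contDiffAt_chartForm hα (mem_extChartAt_target (u p))
  have h1 : HasFDerivAt (fun q => A (ψ q)) ((fderiv ℝ A (ψ p)).comp (fderiv ℝ ψ p)) p :=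
    (hA.differentiableAt (by simp)).hasFDerivAt.comp p (hψ.differentiableAt (by simp)).hasFDerivAt
  have h2 : HasFDerivAt (fderiv ℝ ψ) (fderiv ℝ (fderiv ℝ ψ) p) p :=
    ((hψ.fderiv_right (m := ∞) (by simp)).differentiableAt (by simp)).hasFDerivAt
  have h3 := h1.clm_comp h2
  have h4 := (eventually_pullForm (α := α) hu).fderiv_eq.trans h3.fderiv
  -- Differentiating the coordinate pull-back A(ψ) ∘ Dψ produces a term with D²ψ; its symmetry makes
  -- this term cancel in the antisymmetrization.
  have hsymm : fderiv ℝ (fderiv ℝ ψ) p v w = fderiv ℝ (fderiv ℝ ψ) p w v :=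
    (hψ.isSymmSndFDerivAt (by simpa using WithTop.coe_le_coe.2 (le_top : (2 : ℕ∞) ≤ ⊤))).eq v w
  rw [h4, mfderiv_eq_fderiv_extChartAt hu, mfderiv_eq_fderiv_extChartAt hu]
  show _ = fderiv ℝ A (ψ p) (fderiv ℝ ψ p v) (fderiv ℝ ψ p w) -
    fderiv ℝ A (ψ p) (fderiv ℝ ψ p w) (fderiv ℝ ψ p v)
  simp [hsymm]

variable {E'' : Type*} [NormedAddCommGroup E''] [NormedSpace ℝ E'']
  {H' : Type*} [TopologicalSpace H'] {J : ModelWithCorners ℝ E'' H'}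
  {N' : Type*} [TopologicalSpace N'] [ChartedSpace H' N']

/-- A smooth 1-form is smooth as a function on the tangent bundle. -/
theorem contMDiffAt_form_apply (hα : IsSmoothForm α) {b : N' → M}
    {V : ∀ p, TangentSpace (𝓡 d) (b p)} {p₀ : N'}
    (hV : ContMDiffAt J (𝓡 d).tangent ∞ (fun p => (⟨b p, V p⟩ : TangentBundle (𝓡 d) M)) p₀) :
    ContMDiffAt J 𝓘(ℝ, ℝ) ∞ (fun p => α (b p) (V p)) p₀ := by
  have hb : ContMDiffAt J (𝓡 d) ∞ b p₀ :=
    ContMDiffAt.comp (g := fun v : TangentBundle (𝓡 d) M => v.proj) p₀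
      (Bundle.contMDiff_proj (TangentSpace (𝓡 d))).contMDiffAt hV
  have h1 := (contMDiffAt_tangentBundle_iff hb).1 hV
  set e := extChartAt (𝓡 d) (b p₀)
  have h2 : ContMDiffAt J 𝓘(ℝ, EuclideanSpace ℝ (Fin d) →L[ℝ] ℝ) ∞
      (fun p => chartForm α (b p₀) (e (b p))) p₀ :=
    ContMDiffAt.comp (g := chartForm α (b p₀)) (f := fun p => e (b p)) p₀
      (contDiffAt_chartForm hα (mem_extChartAt_target (b p₀))).contMDiffAt
      (ContMDiffAt.comp p₀ contMDiffAt_extChartAt hb)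
  refine (h2.clm_apply h1).congr_of_eventuallyEq ?_
  filter_upwards [hb.continuousAt (extChartAt_source_mem_nhds (I := 𝓡 d) (b p₀))] with p hp
  show α (b p) (V p) = α (e.symm (e (b p))) (mfderiv 𝓘(ℝ, EuclideanSpace ℝ (Fin d)) (𝓡 d) e.symm
    (e (b p)) (chartCoord (𝓡 d) (b p₀) (b p) (V p)))
  rw [mfderiv_extChartAt_symm_chartCoord hp, e.left_inv hp]

end Forms

/-! ### Velocities, differentials and comparison of tangent vectors. -/

section Velocity

variable {d : ℕ} {M : Type*} [TopologicalSpace M] [ChartedSpace (EuclideanSpace ℝ (Fin d)) M]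

/-- The velocity of a curve in `M`. -/
noncomputable def velocity (γ : ℝ → M) (t : ℝ) : TangentSpace (𝓡 d) (γ t) :=
  mfderiv 𝓘(ℝ, ℝ) (𝓡 d) γ t (1 : ℝ)

variable {E' : Type*} [NormedAddCommGroup E'] [NormedSpace ℝ E']
  {H : Type*} [TopologicalSpace H] (J : ModelWithCorners ℝ E' H)
  {N : Type*} [TopologicalSpace N] [ChartedSpace H N]

/-- The differential of a function. -/
noncomputable def differential (h : N → ℝ) (z : N) : TangentSpace J z →L[ℝ] ℝ :=
  mfderiv J 𝓘(ℝ, ℝ) h z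

/-- Tangent spaces at propositionally equal points are different types, so vectors are compared in
the common model space. -/
theorem form_congr {α : ∀ x : M, TangentSpace (𝓡 d) x →L[ℝ] ℝ} {x y : M} (h : x = y)
    {v : TangentSpace (𝓡 d) x} {w : TangentSpace (𝓡 d) y}
    (hvw : (show EuclideanSpace ℝ (Fin d) from v) = w) : α x v = α y w := by
  subst h
  exact congrArg (α x) hvw

theorem dForm_congr {α : ∀ x : M, TangentSpace (𝓡 d) x →L[ℝ] ℝ} {x y : M} (h : x = y)
    {v v' : TangentSpace (𝓡 d) x} {w w' : TangentSpace (𝓡 d) y}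
    (hvw : (show EuclideanSpace ℝ (Fin d) from v) = w)
    (hvw' : (show EuclideanSpace ℝ (Fin d) from v') = w') : dForm α x v v' = dForm α y w w' := by
  subst h
  exact congrArg₂ (dForm α x) hvw hvw'

theorem _root_.ContMDiffAt.eventually_mdifferentiableAt
    {E'' : Type*} [NormedAddCommGroup E''] [NormedSpace ℝ E'']
    {H' : Type*} [TopologicalSpace H'] {I : ModelWithCorners ℝ E'' H'}
    {N' : Type*} [TopologicalSpace N'] [ChartedSpace H' N'] {J : ModelWithCorners ℝ E' H}
    [IsManifold J ∞ N] [IsManifold I ∞ N'] {g : N → N'} {x : N}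
    (h : ContMDiffAt J I ∞ g x) : ∀ᶠ y in 𝓝 x, MDifferentiableAt J I g y := by
  have h1 : IsManifold J 1 N := IsManifold.of_le (n := ∞) (by simp)
  have h2 : IsManifold I 1 N' := IsManifold.of_le (n := ∞) (by simp)
  exact ((contMDiffAt_iff_contMDiffAt_nhds (by simp)).1 (h.of_le (m := 1) (by simp))).mono
    fun y hy => hy.mdifferentiableAt (by simp)

theorem mfderiv_comp_fderiv {E'' : Type*} [NormedAddCommGroup E''] [NormedSpace ℝ E'']
    {u : E' → M} {ψ : E'' → E'} {ψ' : E'' →L[ℝ] E'} {q : E''}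
    (hu : MDifferentiableAt 𝓘(ℝ, E') (𝓡 d) u (ψ q)) (hψ : HasFDerivAt ψ ψ' q) (w : E'') :
    mfderiv 𝓘(ℝ, E'') (𝓡 d) (fun x => u (ψ x)) q w = mfderiv 𝓘(ℝ, E') (𝓡 d) u (ψ q) (ψ' w) := by
  have h := mfderiv_comp (I := 𝓘(ℝ, E'')) q hu hψ.differentiableAt.mdifferentiableAt
  rw [mfderiv_eq_fderiv, hψ.fderiv] at h
  exact congrArg (fun L : E'' →L[ℝ] EuclideanSpace ℝ (Fin d) => L w) h

end Velocity

/-! ### Cartan's formula. -/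

section Lie

variable {d : ℕ} {M : Type*} [TopologicalSpace M] [ChartedSpace (EuclideanSpace ℝ (Fin d)) M]
  [IsManifold (𝓡 d) ∞ M] {α : ∀ x : M, TangentSpace (𝓡 d) x →L[ℝ] ℝ}
  {E' : Type*} [NormedAddCommGroup E'] [NormedSpace ℝ E']
  {H : Type*} [TopologicalSpace H] {J : ModelWithCorners ℝ E' H} [J.Boundaryless]
  {N : Type*} [TopologicalSpace N] [ChartedSpace H N] [IsManifold J ∞ N]

/-- The derivative of `α(dΘ_t v)` in `t` (Cartan's formula for a smooth family of maps). -/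
theorem hasDerivAt_form_mfderiv (hα : IsSmoothForm α) {Θ : ℝ → N → M} {t₀ : ℝ} {z : N}
    (hΘ : ContMDiffAt (𝓘(ℝ, ℝ).prod J) (𝓡 d) ∞ (fun p : ℝ × N => Θ p.1 p.2) (t₀, z))
    (v : TangentSpace J z) :
    HasDerivAt (fun t => α (Θ t z) (mfderiv J (𝓡 d) (Θ t) z v))
      (differential J (fun y => α (Θ t₀ y) (velocity (fun t => Θ t y) t₀)) z v +
        dForm α (Θ t₀ z) (velocity (fun t => Θ t z) t₀) (mfderiv J (𝓡 d) (Θ t₀) z v)) t₀ := by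
  set e := extChartAt J z
  -- In a chart the family becomes one map u of time and space. Cartan's formula is then d(u^*α) =
  -- u^*dα evaluated on the time direction (1, 0) and the space direction (0, v').
  set u : ℝ × E' → M := fun q => Θ q.1 (e.symm q.2)
  set y₀ := e z
  have hy₀ : e.symm y₀ = z := extChartAt_to_inv z
  have hes : ContMDiffAt 𝓘(ℝ, E') J ∞ e.symm y₀ :=
    (contMDiffOn_extChartAt_symm z).contMDiffAt (extChartAt_target_mem_nhds z)
  have hu : ContMDiffAt 𝓘(ℝ, ℝ × E') (𝓡 d) ∞ u (t₀, y₀) := by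
    have h1 : ContMDiffAt 𝓘(ℝ, ℝ × E') (𝓘(ℝ, ℝ).prod J) ∞
        (fun q : ℝ × E' => (q.1, e.symm q.2)) (t₀, y₀) := by
      refine ContMDiffAt.prodMk ?_ ?_
      · exact contDiffAt_fst.contMDiffAt
      · exact ContMDiffAt.comp (g := e.symm) (f := fun q : ℝ × E' => q.2) (t₀, y₀) hes
          contDiffAt_snd.contMDiffAt
    refine ContMDiffAt.comp (g := fun p : ℝ × N => Θ p.1 p.2)
      (f := fun q : ℝ × E' => (q.1, e.symm q.2)) (t₀, y₀) ?_ h1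
    show ContMDiffAt _ _ _ _ (t₀, e.symm y₀)
    rw [hy₀]
    exact hΘ
  have hB := contDiffAt_pullForm hα hu
  have hBd : HasFDerivAt (pullForm α u) (fderiv ℝ (pullForm α u) (t₀, y₀)) (t₀, y₀) :=
    (hB.differentiableAt (by simp)).hasFDerivAt
  have hund := hu.eventually_mdifferentiableAt
  set v' : E' := mfderiv J 𝓘(ℝ, E') e z v
  have hprod : ContinuousAt (fun t : ℝ => ((t, y₀) : ℝ × E')) t₀ := by fun_prop
  have hspace : ∀ t, MDifferentiableAt 𝓘(ℝ, ℝ × E') (𝓡 d) u (t, y₀) →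
      (show EuclideanSpace ℝ (Fin d) from mfderiv J (𝓡 d) (Θ t) z v) =
        mfderiv 𝓘(ℝ, ℝ × E') (𝓡 d) u (t, y₀) (0, v') := by
    intro t ht
    have h1 : HasFDerivAt (fun y : E' => (t, y)) (ContinuousLinearMap.inr ℝ ℝ E') y₀ :=
      hasFDerivAt_prodMk_right t y₀
    have h2 := mfderiv_comp_fderiv (ψ := fun y : E' => (t, y)) ht h1 v'
    have h3 : MDifferentiableAt 𝓘(ℝ, E') (𝓡 d) (fun y : E' => u (t, y)) y₀ :=
      MDifferentiableAt.comp y₀ ht h1.differentiableAt.mdifferentiableAt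
    have h4 := mfderiv_comp (I := J) z h3
      (mdifferentiableAt_extChartAt (I := J) (mem_chart_source _ z))
    have h5 : Θ t =ᶠ[𝓝 z] (fun y : E' => u (t, y)) ∘ e := by
      filter_upwards [extChartAt_source_mem_nhds (I := J) z] with y hy
      show Θ t y = Θ t (e.symm (e y))
      rw [e.left_inv hy]
    have h6 := h5.mfderiv_eq (I := J) (I' := 𝓡 d)
    exact ((congrArg (fun L : E' →L[ℝ] EuclideanSpace ℝ (Fin d) => L v) h6).trans
      (congrArg (fun L : E' →L[ℝ] EuclideanSpace ℝ (Fin d) => L v) h4)).trans h2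
  have htime : ∀ y, MDifferentiableAt 𝓘(ℝ, ℝ × E') (𝓡 d) u (t₀, y) →
      α (u (t₀, y)) (velocity (fun t => Θ t (e.symm y)) t₀) = pullForm α u (t₀, y) (1, 0) := by
    intro y hy
    have h1 : HasFDerivAt (fun t : ℝ => (t, y)) (ContinuousLinearMap.inl ℝ ℝ E') t₀ :=
      hasFDerivAt_prodMk_left t₀ y
    have h2 := mfderiv_comp_fderiv (ψ := fun t : ℝ => (t, y)) hy h1 (1 : ℝ)
    exact congrArg (α (u (t₀, y))) h2
  have hd := fderiv_pullForm hα hu (1, 0) (0, v')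
  have h1 : HasDerivAt (fun t => pullForm α u (t, y₀) (0, v'))
      (fderiv ℝ (pullForm α u) (t₀, y₀) (1, 0) (0, v')) t₀ := by
    have h2 : HasDerivAt (fun t : ℝ => ((t, y₀) : ℝ × E')) (1, 0) t₀ :=
      (hasDerivAt_id t₀).prodMk (hasDerivAt_const t₀ y₀)
    have h3 := hBd.comp_hasDerivAt t₀ h2
    simpa using h3.clm_apply (hasDerivAt_const t₀ ((0 : ℝ), v'))
  have h2 : differential J (fun y => α (Θ t₀ y) (velocity (fun t => Θ t y) t₀)) z v =
      fderiv ℝ (pullForm α u) (t₀, y₀) (0, v') (1, 0) := by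
    have h3 : HasFDerivAt (fun y : E' => pullForm α u (t₀, y) (1, 0))
        (((fderiv ℝ (pullForm α u) (t₀, y₀)).comp (ContinuousLinearMap.inr ℝ ℝ E')).flip (1, 0))
        y₀ := by
      have h4 := (HasFDerivAt.comp y₀ (f := fun y : E' => (t₀, y)) hBd
        (hasFDerivAt_prodMk_right t₀ y₀)).clm_apply (hasFDerivAt_const ((1 : ℝ), (0 : E')) y₀)
      refine HasFDerivAt.congr_fderiv h4 ?_
      ext w
      simp
    have h5 : (fun y => α (Θ t₀ y) (velocity (fun t => Θ t y) t₀)) =ᶠ[𝓝 z]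
        (fun y : E' => pullForm α u (t₀, y) (1, 0)) ∘ e := by
      have h6 : Filter.Tendsto (fun y : N => ((t₀, e y) : ℝ × E')) (𝓝 z) (𝓝 (t₀, y₀)) :=
        (continuousAt_const.prodMk (continuousAt_extChartAt (I := J) z))
      filter_upwards [extChartAt_source_mem_nhds (I := J) z, h6.eventually hund] with y hy hy2
      have h7 := htime (e y) hy2
      refine Eq.trans ?_ h7
      show _ = α (Θ t₀ (e.symm (e y))) (velocity (fun t => Θ t (e.symm (e y))) t₀)
      rw [e.left_inv hy]
    have h8 := h5.mfderiv_eq (I := J) (I' := 𝓘(ℝ, ℝ))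
    have h9 := mfderiv_comp (I := J) z h3.differentiableAt.mdifferentiableAt
      (mdifferentiableAt_extChartAt (I := J) (mem_chart_source _ z))
    rw [mfderiv_eq_fderiv, h3.fderiv] at h9
    exact (congrArg (fun L : E' →L[ℝ] ℝ => L v) h8).trans
      (congrArg (fun L : E' →L[ℝ] ℝ => L v) h9)
  have hx : Θ t₀ z = u (t₀, y₀) := by
    show Θ t₀ z = Θ t₀ (e.symm y₀)
    rw [hy₀]
  have h3 : dForm α (Θ t₀ z) (velocity (fun t => Θ t z) t₀) (mfderiv J (𝓡 d) (Θ t₀) z v) =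
      dForm α (u (t₀, y₀)) (mfderiv 𝓘(ℝ, ℝ × E') (𝓡 d) u (t₀, y₀) (1, 0))
        (mfderiv 𝓘(ℝ, ℝ × E') (𝓡 d) u (t₀, y₀) (0, v')) := by
    refine dForm_congr hx ?_ (hspace t₀ hund.self_of_nhds)
    have h1 : HasFDerivAt (fun t : ℝ => (t, y₀)) (ContinuousLinearMap.inl ℝ ℝ E') t₀ :=
      hasFDerivAt_prodMk_left t₀ y₀
    have h2 := mfderiv_comp_fderiv (ψ := fun t : ℝ => (t, y₀)) hund.self_of_nhds h1 (1 : ℝ)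
    refine Eq.trans ?_ h2
    show mfderiv 𝓘(ℝ, ℝ) (𝓡 d) (fun t => Θ t z) t₀ (1 : ℝ) =
      mfderiv 𝓘(ℝ, ℝ) (𝓡 d) (fun t => Θ t (e.symm y₀)) t₀ (1 : ℝ)
    rw [hy₀]
  rw [h3, h2, ← hd]
  have h4 : (fun t => α (Θ t z) (mfderiv J (𝓡 d) (Θ t) z v)) =ᶠ[𝓝 t₀]
      fun t => pullForm α u (t, y₀) (0, v') := by
    filter_upwards [hprod.eventually hund] with t ht
    refine form_congr ?_ (hspace t ht)
    show Θ t z = Θ t (e.symm y₀)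
    rw [hy₀]
  refine (h1.congr_of_eventuallyEq h4).congr_deriv ?_
  ring

end Lie

theorem contDiff_flip {T : Type*} [NormedAddCommGroup T] [NormedSpace ℝ T] :
    ContDiff ℝ ∞ (fun B : T →L[ℝ] T →L[ℝ] ℝ => B.flip) := by
  have h : IsBoundedLinearMap ℝ (fun B : T →L[ℝ] T →L[ℝ] ℝ => B.flip) :=
    ⟨⟨fun _ _ => rfl, fun _ _ => rfl⟩, 1, one_pos, fun B => by
      rw [ContinuousLinearMap.opNorm_flip, one_mul]⟩
  exact h.contDiff

/-! ### Algebra of the form dα and its coordinate expression. -/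

section DForm

variable {d : ℕ} {M : Type*} [TopologicalSpace M] [ChartedSpace (EuclideanSpace ℝ (Fin d)) M]
  {α : ∀ x : M, TangentSpace (𝓡 d) x →L[ℝ] ℝ} {x : M}

theorem dForm_add_left (v v' w : TangentSpace (𝓡 d) x) :
    dForm α x (v + v') w = dForm α x v w + dForm α x v' w := by
  let D := fderiv ℝ (chartForm α x) (extChartAt (𝓡 d) x x)
  have h (a b c : EuclideanSpace ℝ (Fin d)) :
      D (a + b) c - D c (a + b) = (D a c - D c a) + (D b c - D c b) := by
    simp only [map_add, ContinuousLinearMap.add_apply]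
    ring
  exact h v v' w

theorem dForm_smul_left (c : ℝ) (v w : TangentSpace (𝓡 d) x) :
    dForm α x (c • v) w = c * dForm α x v w := by
  let D := fderiv ℝ (chartForm α x) (extChartAt (𝓡 d) x x)
  have h (a b : EuclideanSpace ℝ (Fin d)) :
      D (c • a) b - D b (c • a) = c * (D a b - D b a) := by
    simp only [map_smul, ContinuousLinearMap.smul_apply, smul_eq_mul]
    ring
  exact h v w

theorem dForm_swap (v w : TangentSpace (𝓡 d) x) : dForm α x v w = -dForm α x w v := by
  let D := fderiv ℝ (chartForm α x) (extChartAt (𝓡 d) x x)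
  have h (a b : EuclideanSpace ℝ (Fin d)) : D a b - D b a = -(D b a - D a b) := by ring
  exact h v w

theorem dForm_self (v : TangentSpace (𝓡 d) x) : dForm α x v v = 0 := by
  have := dForm_swap (α := α) v v
  linarith

theorem dForm_neg_left (v w : TangentSpace (𝓡 d) x) : dForm α x (-v) w = -dForm α x v w := by
  have h := dForm_smul_left (α := α) (-1) v w
  rw [neg_one_smul] at h
  linarith

theorem dForm_sub_left (v v' w : TangentSpace (𝓡 d) x) :
    dForm α x (v - v') w = dForm α x v w - dForm α x v' w := by
  rw [sub_eq_add_neg, dForm_add_left, dForm_neg_left, ← sub_eq_add_neg]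

theorem dForm_sub_right (v w w' : TangentSpace (𝓡 d) x) :
    dForm α x v (w - w') = dForm α x v w - dForm α x v w' := by
  rw [dForm_swap, dForm_sub_left, dForm_swap w, dForm_swap w']
  ring

/-- The coordinate expression of the exterior derivative. -/
noncomputable def chartDForm (α : ∀ x : M, TangentSpace (𝓡 d) x →L[ℝ] ℝ) (x₀ : M)
    (y : EuclideanSpace ℝ (Fin d)) :
    EuclideanSpace ℝ (Fin d) →L[ℝ] EuclideanSpace ℝ (Fin d) →L[ℝ] ℝ :=
  (fderiv ℝ (chartForm α x₀) y).flip - fderiv ℝ (chartForm α x₀) y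

theorem chartDForm_apply [IsManifold (𝓡 d) ∞ M] (hα : IsSmoothForm α) {x₀ : M}
    {y : EuclideanSpace ℝ (Fin d)} (hy : y ∈ (extChartAt (𝓡 d) x₀).target)
    (v w : EuclideanSpace ℝ (Fin d)) : chartDForm α x₀ y v w =
      dForm α ((extChartAt (𝓡 d) x₀).symm y)
        (mfderiv 𝓘(ℝ, EuclideanSpace ℝ (Fin d)) (𝓡 d) (extChartAt (𝓡 d) x₀).symm y w)
        (mfderiv 𝓘(ℝ, EuclideanSpace ℝ (Fin d)) (𝓡 d) (extChartAt (𝓡 d) x₀).symm y v) := by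
  have h : ContMDiffAt 𝓘(ℝ, EuclideanSpace ℝ (Fin d)) (𝓡 d) ∞ (extChartAt (𝓡 d) x₀).symm y :=
    (contMDiffOn_extChartAt_symm x₀).contMDiffAt ((isOpen_extChartAt_target x₀).mem_nhds hy)
  rw [← fderiv_pullForm hα h w v]
  rfl

end DForm

/-! ### Symplectic duality and smoothness of symplectic gradients. -/

namespace Liouville

variable {d : ℕ} {M : Type*} [TopologicalSpace M] [ChartedSpace (EuclideanSpace ℝ (Fin d)) M]
  [IsManifold (𝓡 d) ∞ M] (S : Liouville d M)

/-- Nondegeneracy makes V ↦ ω(·, V) an injective linear map to the dual space, which has the same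
finite dimension. -/
theorem exists_symp_eq {x : M} (ℓ : TangentSpace (𝓡 d) x →L[ℝ] ℝ) :
    ∃ V : TangentSpace (𝓡 d) x, ∀ w, S.symp x w V = ℓ w := by
  let E := EuclideanSpace ℝ (Fin d)
  let D : E →L[ℝ] E →L[ℝ] ℝ := fderiv ℝ (chartForm S.α x) (extChartAt (𝓡 d) x x)
  let B : E →ₗ[ℝ] (E →L[ℝ] ℝ) := ((D.flip - D : E →L[ℝ] E →L[ℝ] ℝ) : E →ₗ[ℝ] (E →L[ℝ] ℝ))
  let C : E →ₗ[ℝ] (E →ₗ[ℝ] ℝ) := (ContinuousLinearMap.coeLM ℝ).comp B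
  have hB (V w : TangentSpace (𝓡 d) x) : C V w = S.symp x w V := rfl
  have hinj : Function.Injective C := by
    rw [injective_iff_map_eq_zero]
    intro V hV
    refine S.nondegenerate x V fun w => (dForm_swap _ _).trans (neg_eq_zero.2 ?_)
    exact congrArg (fun L : E →ₗ[ℝ] ℝ => L w) hV
  have hsurj : Function.Surjective C := by
    refine (LinearMap.injective_iff_surjective_of_finrank_eq_finrank ?_).1 hinj
    exact (Subspace.dual_finrank_eq (K := ℝ) (V := E)).symm
  obtain ⟨V, hV⟩ := hsurj (show E →L[ℝ] ℝ from ℓ).toLinearMap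
  exact ⟨V, fun w => (hB V w).symm.trans (congrArg (fun L : E →ₗ[ℝ] ℝ => L w) hV)⟩

/-- The vector dual to a covector under the symplectic form. -/
noncomputable def sharp {x : M} (ℓ : TangentSpace (𝓡 d) x →L[ℝ] ℝ) : TangentSpace (𝓡 d) x :=
  (S.exists_symp_eq ℓ).choose

theorem symp_sharp {x : M} (ℓ : TangentSpace (𝓡 d) x →L[ℝ] ℝ) (w : TangentSpace (𝓡 d) x) :
    S.symp x w (S.sharp ℓ) = ℓ w :=
  (S.exists_symp_eq ℓ).choose_spec w

theorem eq_of_symp_eq {x : M} {V V' : TangentSpace (𝓡 d) x}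
    (h : ∀ w, S.symp x w V = S.symp x w V') : V = V' := by
  rw [← sub_eq_zero]
  refine S.nondegenerate x _ fun w => ?_
  rw [dForm_swap, dForm_sub_right]
  have := h w
  rw [symp, symp] at this
  rw [this, sub_self, neg_zero]

theorem α_L (x : M) : S.α x (S.L x) = 0 := by
  rw [← S.contraction, dForm_self]

/-- Since α = i_L ω, this gives α(sgrad h) = dh(L): a function of degree one is recovered from its
symplectic gradient. -/
theorem α_sharp {x : M} (ℓ : TangentSpace (𝓡 d) x →L[ℝ] ℝ) : S.α x (S.sharp ℓ) = ℓ (S.L x) := by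
  rw [← S.contraction, ← S.symp_sharp, symp]

/-- The coordinate expression of ω is invertible on the whole chart, so it can be inverted smoothly
there. -/
theorem bijective_chartDForm {x₀ : M} {y : EuclideanSpace ℝ (Fin d)}
    (hy : y ∈ (extChartAt (𝓡 d) x₀).target) :
    ∃ A : EuclideanSpace ℝ (Fin d) ≃L[ℝ] (EuclideanSpace ℝ (Fin d) →L[ℝ] ℝ),
      (A : EuclideanSpace ℝ (Fin d) →L[ℝ] (EuclideanSpace ℝ (Fin d) →L[ℝ] ℝ)) =
        chartDForm S.α x₀ y := by
  let E := EuclideanSpace ℝ (Fin d)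
  have hinj : Function.Injective (chartDForm S.α x₀ y) := by
    rw [injective_iff_map_eq_zero]
    intro V hV
    set e := extChartAt (𝓡 d) x₀
    set V' := mfderiv 𝓘(ℝ, E) (𝓡 d) e.symm y V
    have h : V' = 0 := by
      refine S.nondegenerate _ V' fun w => ?_
      have h1 := chartDForm_apply S.smooth_α hy V (chartCoord (𝓡 d) x₀ (e.symm y) w)
      have h2 := mfderiv_extChartAt_symm_chartCoord (e.map_target hy) w
      rw [e.right_inv hy] at h2
      rw [hV] at h1
      rw [dForm_swap, neg_eq_zero]
      refine Eq.trans ?_ h1.symm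
      exact congrArg (fun u : E => dForm S.α (e.symm y) u V') h2.symm
    have h1 := chartCoord_mfderiv_extChartAt_symm hy V
    refine h1.symm.trans ?_
    show chartCoord (𝓡 d) x₀ (e.symm y) V' = 0
    rw [h]
    exact map_zero _
  have hfin : Module.finrank ℝ E = Module.finrank ℝ (E →L[ℝ] ℝ) := by
    rw [← (LinearMap.toContinuousLinearMap (𝕜 := ℝ) (E := E) (F' := ℝ)).finrank_eq]
    exact (Subspace.dual_finrank_eq (K := ℝ) (V := E)).symm
  let A₀ := LinearEquiv.ofBijective (chartDForm S.α x₀ y).toLinearMap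
    ⟨hinj, (LinearMap.injective_iff_surjective_of_finrank_eq_finrank hfin).1 hinj⟩
  exact ⟨A₀.toContinuousLinearEquiv, by ext; rfl⟩

variable {E' : Type*} [NormedAddCommGroup E'] [NormedSpace ℝ E']
  {H : Type*} [TopologicalSpace H] {J : ModelWithCorners ℝ E' H}
  {N : Type*} [TopologicalSpace N] [ChartedSpace H N]

/-- A family of vectors is smooth if its symplectic duals are. -/
theorem contMDiffAt_of_symp_eq {b : N → M} {V : ∀ p, TangentSpace (𝓡 d) (b p)}
    {ℓ : N → EuclideanSpace ℝ (Fin d) →L[ℝ] ℝ} {p₀ : N} (hb : ContMDiffAt J (𝓡 d) ∞ b p₀)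
    (hℓ : ContMDiffAt J 𝓘(ℝ, EuclideanSpace ℝ (Fin d) →L[ℝ] ℝ) ∞ ℓ p₀)
    (h : ∀ᶠ p in 𝓝 p₀, ∀ w, S.symp (b p) w (V p) = ℓ p (chartCoord (𝓡 d) (b p₀) (b p) w)) :
    ContMDiffAt J (𝓡 d).tangent ∞ (fun p => (⟨b p, V p⟩ : TangentBundle (𝓡 d) M)) p₀ := by
  rw [contMDiffAt_tangentBundle_iff hb]
  set e := extChartAt (𝓡 d) (b p₀)
  -- In coordinates V solves a linear system with this matrix; inversion is smooth near an
  -- invertible map.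
  let G := fun y => (chartDForm S.α (b p₀) y).inverse
  have hG : ContDiffAt ℝ ∞ G (e (b p₀)) := by
    have h1 : ContDiffAt ℝ ∞ (chartDForm S.α (b p₀)) (e (b p₀)) := by
      have h2 : ContDiffAt ℝ ∞ (fderiv ℝ (chartForm S.α (b p₀))) (e (b p₀)) :=
        (contDiffAt_chartForm S.smooth_α (mem_extChartAt_target (b p₀))).fderiv_right (by simp)
      have h3 : ContDiffAt ℝ ∞ (fun y => (fderiv ℝ (chartForm S.α (b p₀)) y).flip) (e (b p₀)) :=
        (contDiff_flip (T := EuclideanSpace ℝ (Fin d))).contDiffAt.comp _ h2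
      exact h3.sub h2
    obtain ⟨A, hA⟩ := S.bijective_chartDForm (mem_extChartAt_target (I := 𝓡 d) (b p₀))
    have h3 := contDiffAt_map_inverse (n := ∞) A
    rw [hA] at h3
    exact h3.comp (e (b p₀)) h1
  have hG' : ContMDiffAt J 𝓘(ℝ, (EuclideanSpace ℝ (Fin d) →L[ℝ] ℝ) →L[ℝ] EuclideanSpace ℝ (Fin d))
      ∞ (fun p => G (e (b p))) p₀ :=
    ContMDiffAt.comp (g := G) (f := fun p => e (b p)) p₀ hG.contMDiffAt
      (ContMDiffAt.comp p₀ contMDiffAt_extChartAt hb)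
  refine (hG'.clm_apply hℓ).congr_of_eventuallyEq ?_
  filter_upwards [h, hb.continuousAt (extChartAt_source_mem_nhds (I := 𝓡 d) (b p₀))] with p hp hs
  have hy : e (b p) ∈ e.target := e.map_source hs
  obtain ⟨A, hA⟩ := S.bijective_chartDForm hy
  show chartCoord (𝓡 d) (b p₀) (b p) (V p) = (chartDForm S.α (b p₀) (e (b p))).inverse (ℓ p)
  rw [← hA, ContinuousLinearMap.inverse_equiv]
  rw [← ContinuousLinearEquiv.symm_apply_apply A (chartCoord (𝓡 d) (b p₀) (b p) (V p))]
  refine congrArg A.symm ?_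
  ext w
  have h1 : A (chartCoord (𝓡 d) (b p₀) (b p) (V p)) w =
      chartDForm S.α (b p₀) (e (b p)) (chartCoord (𝓡 d) (b p₀) (b p) (V p)) w := by
    rw [← hA]; rfl
  rw [h1, chartDForm_apply S.smooth_α hy]
  have h2 := chartCoord_mfderiv_extChartAt_symm hy w
  have h3 := hp (mfderiv 𝓘(ℝ, EuclideanSpace ℝ (Fin d)) (𝓡 d) e.symm (e (b p)) w)
  have h4 : chartCoord (𝓡 d) (b p₀) (b p)
      (mfderiv 𝓘(ℝ, EuclideanSpace ℝ (Fin d)) (𝓡 d) e.symm (e (b p)) w) = w := by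
    refine Eq.trans ?_ h2
    rw [e.left_inv hs]
  refine Eq.trans ?_ (h3.trans (congrArg (ℓ p) h4))
  exact dForm_congr (e.left_inv hs) rfl (mfderiv_extChartAt_symm_chartCoord hs (V p))

/-- The symplectic gradient of a smooth family of functions is smooth. -/
theorem contMDiffAt_sgrad {Q : Type*} [NormedAddCommGroup Q] [NormedSpace ℝ Q] {h : M → Q → ℝ}
    {z₀ : M} {q₀ : Q} (hh : ContMDiffAt ((𝓡 d).prod 𝓘(ℝ, Q)) 𝓘(ℝ, ℝ) ∞
      (fun p : M × Q => h p.1 p.2) (z₀, q₀)) :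
    ContMDiffAt ((𝓡 d).prod 𝓘(ℝ, Q)) (𝓡 d).tangent ∞
      (fun p : M × Q => (⟨p.1, S.sharp (differential (𝓡 d) (fun z => h z p.2) p.1)⟩ :
        TangentBundle (𝓡 d) M)) (z₀, q₀) := by
  let E := EuclideanSpace ℝ (Fin d)
  set e := extChartAt (𝓡 d) z₀
  let hc : E × Q → ℝ := fun r => h (e.symm r.1) r.2
  have hes : ContMDiffAt 𝓘(ℝ, E) (𝓡 d) ∞ e.symm (e z₀) :=
    (contMDiffOn_extChartAt_symm z₀).contMDiffAt (extChartAt_target_mem_nhds z₀)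
  have hez : e.symm (e z₀) = z₀ := extChartAt_to_inv z₀
  have hc_smooth : ContDiffAt ℝ ∞ hc (e z₀, q₀) := by
    rw [← contMDiffAt_iff_contDiffAt]
    have h1 : ContMDiffAt 𝓘(ℝ, E × Q) ((𝓡 d).prod 𝓘(ℝ, Q)) ∞
        (fun r : E × Q => (e.symm r.1, r.2)) (e z₀, q₀) := by
      refine ContMDiffAt.prodMk ?_ contDiffAt_snd.contMDiffAt
      exact ContMDiffAt.comp (g := e.symm) (f := fun q : E × Q => q.1) (e z₀, q₀) hes
          contDiffAt_fst.contMDiffAt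
    refine ContMDiffAt.comp (g := fun p : M × Q => h p.1 p.2)
      (f := fun r : E × Q => (e.symm r.1, r.2)) (e z₀, q₀) ?_ h1
    show ContMDiffAt _ _ _ _ (e.symm (e z₀), q₀)
    rw [hez]
    exact hh
  have hev : ∀ᶠ r in 𝓝 (e z₀, q₀), DifferentiableAt ℝ hc r :=
    ((hc_smooth.of_le (m := 1) (by simp)).eventually (by simp)).mono
      fun q hq => hq.differentiableAt (by simp)
  have hecont : Filter.Tendsto (fun p : M × Q => (e p.1, p.2)) (𝓝 (z₀, q₀)) (𝓝 (e z₀, q₀)) := by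
    refine ContinuousAt.prodMk (f := fun p : M × Q => e p.1) ?_ continuousAt_snd
    exact ContinuousAt.comp (g := e) (f := fun p : M × Q => p.1)
      (continuousAt_extChartAt (I := 𝓡 d) z₀) continuousAt_fst
  refine S.contMDiffAt_of_symp_eq
    (ℓ := fun p => (fderiv ℝ hc (e p.1, p.2)).comp (ContinuousLinearMap.inl ℝ E Q))
    contMDiffAt_fst ?_ ?_
  · have h1 : ContDiffAt ℝ ∞ (fun r => (fderiv ℝ hc r).comp (ContinuousLinearMap.inl ℝ E Q))
        (e z₀, q₀) := (hc_smooth.fderiv_right (by simp)).clm_comp contDiffAt_const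
    refine ContMDiffAt.comp (g := fun r => (fderiv ℝ hc r).comp (ContinuousLinearMap.inl ℝ E Q))
      (f := fun p : M × Q => (e p.1, p.2)) (I' := 𝓘(ℝ, E × Q)) (z₀, q₀) h1.contMDiffAt ?_
    rw [modelWithCornersSelf_prod, ← chartedSpaceSelf_prod]
    refine ContMDiffAt.prodMk ?_ contMDiffAt_snd
    exact ContMDiffAt.comp (g := e) (f := fun p : M × Q => p.1) (z₀, q₀)
      (contMDiffAt_extChartAt (I := 𝓡 d)) contMDiffAt_fst
  · have hs : ∀ᶠ p in 𝓝 (z₀, q₀), p.1 ∈ e.source :=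
      continuousAt_fst (extChartAt_source_mem_nhds (I := 𝓡 d) z₀)
    filter_upwards [hecont.eventually hev, hs] with p hp hps w
    rw [S.symp_sharp]
    have h1 : HasFDerivAt (fun y : E => hc (y, p.2))
        ((fderiv ℝ hc (e p.1, p.2)).comp (ContinuousLinearMap.inl ℝ E Q)) (e p.1) :=
      HasFDerivAt.comp (g := hc) (f := fun y : E => (y, p.2)) (e p.1) hp.hasFDerivAt
        (hasFDerivAt_prodMk_left (𝕜 := ℝ) (e p.1) p.2)
    have h2 : (fun z => h z p.2) =ᶠ[𝓝 p.1] (fun y : E => hc (y, p.2)) ∘ e := by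
      filter_upwards [(isOpen_extChartAt_source (I := 𝓡 d) z₀).mem_nhds hps] with z hz
      show h z p.2 = h (e.symm (e z)) p.2
      rw [e.left_inv hz]
    have h3 := h2.mfderiv_eq (I := 𝓡 d) (I' := 𝓘(ℝ, ℝ))
    have hps' : p.1 ∈ (chartAt E z₀).source := by rwa [extChartAt_source] at hps
    have h4 := mfderiv_comp (I := 𝓡 d) p.1 h1.differentiableAt.mdifferentiableAt
      (mdifferentiableAt_extChartAt (I := 𝓡 d) hps')
    rw [mfderiv_eq_fderiv, h1.fderiv] at h4
    exact (congrArg (fun L : E →L[ℝ] ℝ => L w) h3).trans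
      (congrArg (fun L : E →L[ℝ] ℝ => L w) h4)

end Liouville

section Curves

variable {E : Type*} [NormedAddCommGroup E] [NormedSpace ℝ E]
  {H : Type*} [TopologicalSpace H] {J : ModelWithCorners ℝ E H}
  {N : Type*} [TopologicalSpace N] [ChartedSpace H N]

theorem hasDerivAt_comp_curve {γ : ℝ → N} {t : ℝ} {v : TangentSpace J (γ t)} {g : N → ℝ}
    (hγ : HasMFDerivAt 𝓘(ℝ, ℝ) J γ t ((1 : ℝ →L[ℝ] ℝ).smulRight v))
    (hg : MDifferentiableAt J 𝓘(ℝ, ℝ) g (γ t)) :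
    HasDerivAt (fun τ => g (γ τ)) (differential J g (γ t) v) t := by
  have h1 : HasMFDerivAt 𝓘(ℝ, ℝ) 𝓘(ℝ, ℝ) (g ∘ γ) t
      ((mfderiv J 𝓘(ℝ, ℝ) g (γ t)).comp ((1 : ℝ →L[ℝ] ℝ).smulRight v)) :=
    HasMFDerivAt.comp t hg.hasMFDerivAt hγ
  let A : ℝ →L[ℝ] ℝ := (differential J g (γ t)).comp ((1 : ℝ →L[ℝ] ℝ).smulRight v)
  have h2 : HasFDerivAt (fun τ => g (γ τ)) A t := hasMFDerivAt_iff_hasFDerivAt.1 h1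
  refine h2.hasDerivAt.congr_deriv ?_
  exact congrArg (differential J g (γ t)) (one_smul ℝ v)

end Curves

/-! ### The flow of L, starshaped domains and the core. -/

namespace Liouville

variable {d : ℕ} {M : Type*} [TopologicalSpace M] [T2Space M]
  [ChartedSpace (EuclideanSpace ℝ (Fin d)) M]
  [IsManifold (𝓡 d) ∞ M] (S : Liouville d M)

theorem contMDiff_flow : ContMDiff (𝓘(ℝ, ℝ).prod (𝓡 d)) (𝓡 d) ∞
    (fun p : ℝ × M => S.flow p.1 p.2) :=
  ContactSqueezing.contMDiff_flow S.smooth_L S.flow_zero S.flow_integral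

theorem flow_add (s t : ℝ) (x : M) : S.flow (s + t) x = S.flow s (S.flow t x) :=
  ContactSqueezing.flow_add S.smooth_L S.flow_zero S.flow_integral s t x

theorem flow_neg_flow (t : ℝ) (x : M) : S.flow (-t) (S.flow t x) = x := by
  rw [← S.flow_add, neg_add_cancel, S.flow_zero]

theorem flow_flow_neg (t : ℝ) (x : M) : S.flow t (S.flow (-t) x) = x := by
  rw [← S.flow_add, add_neg_cancel, S.flow_zero]

theorem continuous_flow : Continuous (fun p : ℝ × M => S.flow p.1 p.2) :=
  S.contMDiff_flow.continuous

theorem continuous_flow_right (t : ℝ) : Continuous (S.flow t) :=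
  S.continuous_flow.comp (by fun_prop : Continuous fun x : M => (t, x))

theorem continuous_flow_left (x : M) : Continuous (fun t => S.flow t x) :=
  S.continuous_flow.comp (by fun_prop : Continuous fun t : ℝ => (t, x))

section Starshaped

variable {S} {U : Set M} (hU : IsStarshaped S.L S.flow U)
include hU

theorem flow_frontier_notMem {x : M} (hx : x ∈ frontier U) {t : ℝ} (ht : 0 ≤ t) :
    S.flow t x ∉ U := fun h =>
  hU.disjoint.ne_of_mem h (mem_iUnion₂.2 ⟨t, ht, x, hx, rfl⟩) rfl

/-- By transversality a defining function has nonzero derivative along the orbit. A negative one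
would bring the orbit into U in forward time, which disjointness forbids; so it is positive and the
orbit comes from U. -/
theorem exists_flow_mem_before {x : M} (hx : x ∈ frontier U) :
    ∀ᶠ t in 𝓝[<] (0 : ℝ), S.flow t x ∈ U := by
  obtain ⟨g, ⟨⟨O, hO, hxO, hg, hDO⟩, -⟩, hgL⟩ := hU.transversal x hx
  have hgx : g x = 0 := by
    refine le_antisymm ?_ ?_
    · by_contra! h
      have hc : ContinuousAt g x := (hg.contMDiffAt (hO.mem_nhds hxO)).continuousAt
      have h1 : ∀ᶠ y in 𝓝 x, y ∉ U := by
        filter_upwards [hc.eventually (lt_mem_nhds h), hO.mem_nhds hxO] with y hy hyO hyU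
        have : y ∈ {y ∈ O | g y < 0} := hDO ▸ ⟨hyU, hyO⟩
        exact lt_asymm hy this.2
      obtain ⟨y, hy, hyU⟩ := mem_closure_iff_nhds.1 hx.1 _ h1
      exact hy hyU
    · by_contra! h
      have : x ∈ U ∩ O := hDO ▸ ⟨hxO, h⟩
      exact hx.2 (by rw [hU.isOpen.interior_eq]; exact this.1)
  have hmem : ∀ᶠ t in 𝓝 (0 : ℝ), g (S.flow t x) < 0 → S.flow t x ∈ U := by
    have hc : Filter.Tendsto (fun t => S.flow t x) (𝓝 0) (𝓝 x) := by
      have := (S.continuous_flow_left x).tendsto 0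
      rwa [S.flow_zero] at this
    filter_upwards [hc (hO.mem_nhds hxO)] with t ht hlt
    have : S.flow t x ∈ U ∩ O := hDO ▸ ⟨ht, hlt⟩
    exact this.1
  have hgd : MDifferentiableAt (𝓡 d) 𝓘(ℝ, ℝ) g (S.flow 0 x) := by
    rw [S.flow_zero]
    exact (hg.contMDiffAt (hO.mem_nhds hxO)).mdifferentiableAt (by simp)
  have hder := hasDerivAt_comp_curve (S.flow_integral x 0) hgd
  have hval : differential (𝓡 d) g (S.flow 0 x) (S.L (S.flow 0 x)) ≠ 0 := by
    rw [S.flow_zero]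
    exact hgL
  set c := differential (𝓡 d) g (S.flow 0 x) (S.L (S.flow 0 x))
  have hg0 : g (S.flow 0 x) = 0 := by rw [S.flow_zero, hgx]
  have hslope := hasDerivAt_iff_tendsto_slope.1 hder
  rcases lt_or_gt_of_ne hval with hc | hc
  · exfalso
    have h1 : ∀ᶠ t in 𝓝[>] (0 : ℝ), slope (fun τ => g (S.flow τ x)) 0 t < 0 :=
      (hslope.mono_left (nhdsWithin_mono _ fun t (ht : 0 < t) => ht.ne')).eventually
        (gt_mem_nhds hc)
    have h2 : ∀ᶠ t in 𝓝[>] (0 : ℝ), 0 < t := self_mem_nhdsWithin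
    obtain ⟨t, ht, ht0', htm⟩ := (h1.and (h2.and
      (hmem.filter_mono nhdsWithin_le_nhds))).exists
    refine flow_frontier_notMem hU hx ht0'.le (htm ?_)
    rw [slope_def_field, hg0, sub_zero, sub_zero] at ht
    by_contra! h
    exact absurd ht (not_lt.2 (div_nonneg h ht0'.le))
  · have h1 : ∀ᶠ t in 𝓝[<] (0 : ℝ), 0 < slope (fun τ => g (S.flow τ x)) 0 t :=
      (hslope.mono_left (nhdsWithin_mono _ fun t (ht : t < 0) => ht.ne)).eventually
        (lt_mem_nhds hc)
    filter_upwards [h1, self_mem_nhdsWithin, hmem.filter_mono nhdsWithin_le_nhds]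
      with t ht (ht0 : t < 0) htm
    refine htm ?_
    rw [slope_def_field, hg0, sub_zero, sub_zero] at ht
    by_contra! h
    exact absurd ht (not_lt.2 (div_nonpos_of_nonneg_of_nonpos h ht0.le))

/-- A later point in the closure would lie on the frontier, and the orbit would be in U just before
it, although it had already left U. -/
theorem flow_frontier_notMem_closure {x : M} (hx : x ∈ frontier U) {t : ℝ} (ht : 0 < t) :
    S.flow t x ∉ closure U := by
  intro h
  have hf : S.flow t x ∈ frontier U :=
    ⟨h, by rw [hU.isOpen.interior_eq]; exact flow_frontier_notMem hU hx ht.le⟩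
  have h1 : ∀ᶠ r in 𝓝[<] (0 : ℝ), -t < r :=
    nhdsWithin_le_nhds (lt_mem_nhds (by linarith))
  obtain ⟨r, hr, hr'⟩ := ((exists_flow_mem_before hU hf).and h1).exists
  rw [← S.flow_add] at hr
  exact flow_frontier_notMem hU hx (by linarith) hr

theorem exists_of_notMem {x : M} (hx : x ∉ U) : ∃ t, 0 ≤ t ∧ S.flow (-t) x ∈ frontier U := by
  have h : x ∈ U ∪ (⋃ t ∈ Ici (0 : ℝ), S.flow t '' frontier U) := hU.cover ▸ mem_univ x
  obtain h | h := h
  · exact absurd h hx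
  · obtain ⟨t, ht, p, hp, rfl⟩ := mem_iUnion₂.1 h
    exact ⟨t, ht, by rwa [S.flow_neg_flow]⟩

/-- A point outside U lies on or after a frontier point of its orbit; the frontier point at time T
would then come strictly after another one. -/
theorem flow_mem_of_lt {x : M} {T : ℝ} (hT : S.flow T x ∈ frontier U) {r : ℝ} (hr : r < T) :
    S.flow r x ∈ U := by
  by_contra h
  obtain ⟨τ, hτ, hp⟩ := exists_of_notMem hU h
  refine flow_frontier_notMem_closure hU hp (t := T - r + τ) (by linarith) ?_
  rw [← S.flow_add, ← S.flow_add, show T - r + τ + -τ + r = T by ring]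
  exact hT.1

theorem forall_flow_mem_or (x : M) : (∀ t, S.flow t x ∈ U) ∨ ∃ T, S.flow T x ∈ frontier U := by
  by_contra! h
  obtain ⟨⟨t, ht⟩, h⟩ := h
  obtain ⟨τ, -, hp⟩ := exists_of_notMem hU ht
  rw [← S.flow_add] at hp
  exact h _ hp

theorem exists_flow_neg_mem (y : M) : ∃ n : ℕ, S.flow (-n) y ∈ U := by
  obtain h | ⟨T, hT⟩ := forall_flow_mem_or hU y
  · exact ⟨0, h _⟩
  · obtain ⟨n, hn⟩ := exists_nat_gt (-T)
    exact ⟨n, flow_mem_of_lt hU hT (by linarith)⟩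

/-- This is the independence of the core from the domain used to define it: an orbit that stays in
one starshaped domain U' for all positive times stays in any other one for all times. -/
theorem mem_core_iff {x : M} : x ∈ S.core ↔ ∀ t, S.flow t x ∈ U := by
  refine ⟨?_, fun h => ⟨U, hU, fun t _ => h t⟩⟩
  rintro ⟨U', hU', h⟩
  obtain h1 | ⟨T, hT⟩ := forall_flow_mem_or hU x
  · exact h1
  exfalso
  -- The open sets L^n(U) increase with n and cover M, so one of them contains the compact closure
  -- of U'.
  obtain ⟨n, hn⟩ : ∃ n : ℕ, closure U' ⊆ {y | S.flow (-n) y ∈ U} := by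
    refine hU'.isCompact_closure.elim_directed_cover _
      (fun n => hU.isOpen.preimage (S.continuous_flow_right _))
      (fun y _ => mem_iUnion.2 (exists_flow_neg_mem hU y)) ?_
    refine directed_of_isDirected_le fun m n hmn y (hy : S.flow (-m) y ∈ U) => ?_
    have hmn' : (m : ℝ) ≤ n := by exact_mod_cast hmn
    show S.flow (-n) y ∈ U
    obtain h1 | ⟨T, hT⟩ := forall_flow_mem_or hU y
    · exact h1 _
    · refine flow_mem_of_lt hU hT ?_
      by_contra! h2
      refine flow_frontier_notMem hU hT (t := -m - T) (by linarith) ?_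
      rwa [← S.flow_add, sub_add_cancel]
  -- This time is positive, and it still exceeds T after flowing back by n. The orbit would thus be
  -- in U after having crossed the frontier at time T.
  have h2 : S.flow (max T 0 + n + 1) x ∈ closure U' :=
    subset_closure (h _ (by positivity))
  have h3 := hn h2
  rw [mem_setOf_eq, ← S.flow_add] at h3
  refine flow_frontier_notMem hU hT (t := -n + (max T 0 + n + 1) - T)
    (by linarith [le_max_left T 0]) ?_
  rwa [← S.flow_add, sub_add_cancel]

theorem mem_star_iff {x : M} : x ∈ S.star ↔ ∃ T, S.flow T x ∈ frontier U := by
  rw [star, mem_compl_iff, mem_core_iff hU]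
  constructor
  · intro h
    exact (forall_flow_mem_or hU x).resolve_left h
  · rintro ⟨T, hT⟩ h
    have := flow_frontier_notMem hU hT le_rfl
    rw [S.flow_zero] at this
    exact this (h T)

end Starshaped

theorem flow_mem_star {z : M} (hz : z ∈ S.star) (t : ℝ) : S.flow t z ∈ S.star := by
  obtain ⟨U, hU⟩ := S.exists_starshaped
  rw [mem_star_iff hU] at hz ⊢
  obtain ⟨T, hT⟩ := hz
  exact ⟨T - t, by rwa [← S.flow_add, sub_add_cancel]⟩

/-- A point lies off the core exactly when its orbit meets the open complement of the closure of U.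
-/
theorem isOpen_star : IsOpen S.star := by
  obtain ⟨U, hU⟩ := S.exists_starshaped
  have : S.star = ⋃ t, {x | S.flow t x ∈ (closure U)ᶜ} := by
    ext x
    rw [mem_iUnion]
    constructor
    · rw [mem_star_iff hU]
      rintro ⟨T, hT⟩
      refine ⟨1 + T, ?_⟩
      rw [mem_setOf_eq, S.flow_add]
      exact flow_frontier_notMem_closure hU hT one_pos
    · rintro ⟨t, ht⟩ hx
      exact ht (subset_closure ((mem_core_iff hU).1 hx t))
  rw [this]
  exact isOpen_iUnion fun t => isClosed_closure.isOpen_compl.preimage (S.continuous_flow_right t)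

theorem frontier_subset_star {U : Set M} (hU : IsStarshaped S.L S.flow U) :
    frontier U ⊆ S.star := fun x hx =>
  (mem_star_iff hU).2 ⟨0, by rwa [S.flow_zero]⟩

/-- Homogeneity (of degree one) of a function on `M_*`, extended by zero. -/
structure IsHomogeneous (h : M → ℝ) : Prop where
  flow : ∀ z ∈ S.star, ∀ t, h (S.flow t z) = Real.exp t * h z
  core : ∀ z ∈ S.core, h z = 0

theorem IsContactHamiltonian.isHomogeneous {S : Liouville d M} {h : M → ℝ}
    (hh : S.IsContactHamiltonian h) : S.IsHomogeneous h :=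
  ⟨fun z hz t => by simpa using hh.equivariant z hz (Real.exp t) (Real.exp_pos t), hh.core⟩

/-- Only the core needs an argument. A nearby point of M_* reaches the frontier of U only after a
long time T, so its value is e^{-T} times a value on the compact frontier, and the latter is bounded
uniformly for parameters near q₀. -/
theorem continuous_of_isHomogeneous {Q : Type*} [TopologicalSpace Q] {h : M → Q → ℝ}
    (hc : ContinuousOn (fun p : M × Q => h p.1 p.2) (S.star ×ˢ univ))
    (hh : ∀ q, S.IsHomogeneous (fun z => h z q)) : Continuous (fun p : M × Q => h p.1 p.2) := by
  obtain ⟨U, hU⟩ := S.exists_starshaped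
  have hopen : IsOpen (S.star ×ˢ (univ : Set Q)) := S.isOpen_star.prod isOpen_univ
  rw [continuous_iff_continuousAt]
  rintro ⟨x, q₀⟩
  by_cases hx : x ∈ S.star
  · exact hc.continuousAt (hopen.mem_nhds ⟨hx, mem_univ _⟩)
  have hxc : x ∈ S.core := not_not.1 hx
  have hP : IsCompact (frontier U) :=
    hU.isCompact_closure.of_isClosed_subset isClosed_frontier frontier_subset_closure
  have hca : ∀ p ∈ frontier U, ∀ q, ContinuousAt (fun p : M × Q => h p.1 p.2) (p, q) :=
    fun p hp q => hc.continuousAt (hopen.mem_nhds ⟨S.frontier_subset_star hU hp, mem_univ _⟩)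
  obtain ⟨C, hC⟩ : ∃ C, ∀ p ∈ frontier U, |h p q₀| ≤ C := by
    have h1 : ContinuousOn (fun p => h p q₀) (frontier U) := fun p hp =>
      ((hca p hp q₀).comp (f := fun p => (p, q₀)) (by fun_prop)).continuousWithinAt
    obtain ⟨C, hC⟩ := hP.exists_bound_of_continuousOn h1
    exact ⟨C, hC⟩
  have hb : ∀ᶠ q in 𝓝 q₀, ∀ p ∈ frontier U, |h p q| < |C| + 1 := by
    refine hP.eventually_forall_of_forall_eventually fun p hp => ?_
    have h1 : Filter.Tendsto (fun r : M × Q => |h r.1 r.2|) (𝓝 (p, q₀)) (𝓝 |h p q₀|) :=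
      (hca p hp q₀).abs
    have h2 : |h p q₀| < |C| + 1 := by linarith [hC p hp, le_abs_self C]
    have h3 := h1.eventually (gt_mem_nhds h2)
    have h4 : Filter.Tendsto (fun z : Q × M => (z.2, z.1)) (𝓝 (q₀, p)) (𝓝 (p, q₀)) :=
      continuous_swap.tendsto _
    exact h4.eventually h3
  rw [ContinuousAt, Metric.tendsto_nhds]
  intro ε hε
  -- Points near x are still in U at time n, hence cross the frontier later; e^{-n} then beats the
  -- bound |C| + 1.
  obtain ⟨n, hn⟩ : ∃ n : ℕ, (|C| + 1) / ε < Real.exp n := by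
    obtain ⟨n, hn⟩ := exists_nat_gt ((|C| + 1) / ε)
    exact ⟨n, by linarith [Real.add_one_le_exp (n : ℝ)]⟩
  have hn' : (|C| + 1) < ε * Real.exp n := by
    rwa [div_lt_iff₀ hε, mul_comm] at hn
  have hyU : ∀ᶠ y in 𝓝 x, S.flow n y ∈ U :=
    (hU.isOpen.preimage (S.continuous_flow_right n)).mem_nhds ((mem_core_iff hU).1 hxc n)
  rw [nhds_prod_eq]
  filter_upwards [hyU.prod_mk hb] with r hr
  obtain ⟨hr1, hr2⟩ := hr
  rw [Real.dist_eq, (hh q₀).core x hxc, sub_zero]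
  by_cases hrs : r.1 ∈ S.star
  · obtain ⟨T, hT⟩ := (mem_star_iff hU).1 hrs
    have hTn : n < T := by
      by_contra! h1
      refine flow_frontier_notMem hU hT (t := n - T) (by linarith) ?_
      rwa [← S.flow_add, sub_add_cancel]
    have h1 := hr2 _ hT
    rw [(hh r.2).flow r.1 hrs T, abs_mul, abs_of_pos (Real.exp_pos T)] at h1
    have h2 : Real.exp n < Real.exp T := Real.exp_lt_exp.2 hTn
    have h3 : Real.exp n * |h r.1 r.2| < ε * Real.exp n := by
      nlinarith [abs_nonneg (h r.1 r.2)]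
    nlinarith [Real.exp_pos (n : ℝ)]
  · rw [(hh r.2).core r.1 (not_not.1 hrs), abs_zero]
    exact hε

theorem IsContactHamiltonian.continuous {S : Liouville d M} {h : M → ℝ}
    (hh : S.IsContactHamiltonian h) : Continuous h := by
  have h1 := S.continuous_of_isHomogeneous (Q := Unit) (h := fun z _ => h z)
    (hh.smooth.continuousOn.comp continuousOn_fst fun p hp => hp.1) (fun _ => hh.isHomogeneous)
  exact h1.comp (by fun_prop : Continuous fun z : M => (z, ()))

/-! ### Sublevel sets of positive homogeneous functions. -/

section Positive

variable {S} {E : M → ℝ} (hE : S.IsHomogeneous E) (hE_cont : Continuous E)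
  (hE_pos : ∀ z ∈ S.star, 0 < E z)
include hE hE_pos

theorem mem_star_iff_pos {z : M} : z ∈ S.star ↔ 0 < E z :=
  ⟨hE_pos z, fun h hz => h.ne' (hE.core z hz)⟩

theorem apply_flow_neg_log {z : M} (hz : z ∈ S.star) : E (S.flow (-Real.log (E z)) z) = 1 := by
  rw [hE.flow z hz, Real.exp_neg, Real.exp_log (hE_pos z hz)]
  exact inv_mul_cancel₀ (hE_pos z hz).ne'

include hE_cont

/-- Since E has a positive minimum m on the compact frontier of U and grows like e^t along orbits,
the sublevel set lies in the image of the closure of U under L^{T₀} for a suitable T₀. -/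
theorem isCompact_sublevel (C : ℝ) : IsCompact {z | E z ≤ C} := by
  obtain ⟨U, hU⟩ := S.exists_starshaped
  have hP : IsCompact (frontier U) :=
    hU.isCompact_closure.of_isClosed_subset isClosed_frontier frontier_subset_closure
  obtain ⟨p₀, hp₀, hmin⟩ := hP.exists_isMinOn hU.isConnected_frontier.nonempty
    hE_cont.continuousOn
  set m := E p₀
  have hm : 0 < m := hE_pos _ (S.frontier_subset_star hU hp₀)
  -- The maximum with m keeps the argument of the logarithm positive for every C.
  set T₀ := Real.log (max C m / m)
  have hexp : Real.exp T₀ = max C m / m :=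
    Real.exp_log (div_pos (lt_max_of_lt_right hm) hm)
  refine (hU.isCompact_closure.image (S.continuous_flow_right T₀)).of_isClosed_subset
    (isClosed_le hE_cont continuous_const) fun z (hz : E z ≤ C) => ?_
  refine ⟨S.flow (-T₀) z, ?_, S.flow_flow_neg _ _⟩
  by_cases hzs : z ∈ S.star
  · obtain ⟨T, hT⟩ := (mem_star_iff hU).1 hzs
    have h1 : m ≤ Real.exp T * E z := by
      rw [← hE.flow z hzs T]
      exact hmin hT
    have h2 : -T₀ ≤ T := by
      rw [← Real.exp_le_exp, Real.exp_neg, hexp, inv_div,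
        div_le_iff₀ (lt_max_of_lt_right hm)]
      exact h1.trans (mul_le_mul_of_nonneg_left (hz.trans (le_max_left C m)) (Real.exp_pos T).le)
    rcases h2.lt_or_eq with h2 | h2
    · exact subset_closure (flow_mem_of_lt hU hT h2)
    · rw [h2]
      exact frontier_subset_closure hT
  · exact subset_closure ((mem_core_iff hU).1 (not_not.1 hzs) _)

/-- Along an orbit in M_* the function E is a multiple of e^t. Hence dE(L) = 1 on {E = 1}, which
gives regularity and transversality, and each such orbit meets this level exactly once. -/
theorem isStarshaped_sublevel (hE_smooth : ContMDiffOn (𝓡 d) 𝓘(ℝ, ℝ) ∞ E S.star) :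
    IsStarshaped S.L S.flow {z | E z < 1} := by
  obtain ⟨U, hU⟩ := S.exists_starshaped
  have hopen : IsOpen {z | E z < 1} := isOpen_lt hE_cont continuous_const
  have hfr : frontier {z | E z < 1} = {z | E z = 1} := by
    refine Subset.antisymm (frontier_lt_subset_eq hE_cont continuous_const) fun z hz => ?_
    have hz1 : E z = 1 := hz
    have hzs : z ∈ S.star := (mem_star_iff_pos hE hE_pos).2 (by rw [hz1]; exact one_pos)
    refine ⟨?_, by rw [hopen.interior_eq]; exact fun h => (ne_of_lt h) hz1⟩
    have h1 : Filter.Tendsto (fun t => S.flow t z) (𝓝[<] 0) (𝓝 z) := by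
      have := ((S.continuous_flow_left z).tendsto 0).mono_left
        (nhdsWithin_le_nhds (s := Iio (0 : ℝ)))
      rwa [S.flow_zero] at this
    refine mem_closure_of_tendsto h1 ?_
    filter_upwards [self_mem_nhdsWithin] with t (ht : t < 0)
    show E (S.flow t z) < 1
    rw [hE.flow z hzs, hz1, mul_one]
    exact Real.exp_zero ▸ Real.exp_lt_exp.2 ht
  refine ⟨hopen, ?_, ?_, ?_, ?_, ?_⟩
  · exact (isCompact_sublevel hE hE_cont hE_pos 1).of_isClosed_subset isClosed_closure
      (closure_lt_subset_le hE_cont continuous_const)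
  · rw [hfr]
    -- Projection along the orbits maps the connected frontier of U onto the level; this gives its
    -- connectedness.
    have h1 : {z | E z = 1} = (fun p => S.flow (-Real.log (E p)) p) '' frontier U := by
      ext z
      constructor
      · intro (hz : E z = 1)
        have hzs : z ∈ S.star := (mem_star_iff_pos hE hE_pos).2 (by rw [hz]; exact one_pos)
        obtain ⟨T, hT⟩ := (mem_star_iff hU).1 hzs
        refine ⟨_, hT, ?_⟩
        show S.flow (-Real.log (E (S.flow T z))) (S.flow T z) = z
        rw [hE.flow z hzs, hz, mul_one, Real.log_exp, S.flow_neg_flow]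
      · rintro ⟨p, hp, rfl⟩
        exact apply_flow_neg_log hE hE_pos (S.frontier_subset_star hU hp)
    rw [h1]
    refine hU.isConnected_frontier.image _ fun p hp => ?_
    have hp' := (hE_pos p (S.frontier_subset_star hU hp)).ne'
    have h2 : ContinuousAt (fun p => (-Real.log (E p), p)) p :=
      ((hE_cont.continuousAt.log hp').neg).prodMk continuousAt_id
    exact (ContinuousAt.comp (f := fun p => (-Real.log (E p), p)) S.continuous_flow.continuousAt
      h2).continuousWithinAt
  · intro x hx
    rw [hfr] at hx
    have hx1 : E x = 1 := hx
    have hxs : x ∈ S.star := (mem_star_iff_pos hE hE_pos).2 (by rw [hx1]; exact one_pos)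
    have hsm : ContMDiffOn (𝓡 d) 𝓘(ℝ, ℝ) ∞ (fun z => E z - 1) S.star :=
      hE_smooth.sub contMDiffOn_const
    have hder : mfderiv (𝓡 d) 𝓘(ℝ, ℝ) (fun z => E z - 1) x (S.L x) = (1 : ℝ) := by
      have hgd : MDifferentiableAt (𝓡 d) 𝓘(ℝ, ℝ) (fun z => E z - 1) (S.flow 0 x) := by
        rw [S.flow_zero]
        exact (hsm.contMDiffAt (S.isOpen_star.mem_nhds hxs)).mdifferentiableAt (by simp)
      have h1 := hasDerivAt_comp_curve (S.flow_integral x 0) hgd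
      have h2 : HasDerivAt (fun τ => E (S.flow τ x) - 1) 1 0 := by
        have h3 : (fun τ => E (S.flow τ x) - 1) = fun τ => Real.exp τ - 1 := by
          ext τ
          rw [hE.flow x hxs, hx1, mul_one]
        rw [h3]
        simpa using (Real.hasDerivAt_exp 0).sub_const 1
      have h4 : differential (𝓡 d) (fun z => E z - 1) (S.flow 0 x) (S.L (S.flow 0 x)) = 1 :=
        h1.unique h2
      rw [S.flow_zero] at h4
      exact h4
    refine ⟨fun z => E z - 1, ⟨⟨S.star, S.isOpen_star, hxs, hsm, ?_⟩, fun h => ?_⟩, ?_⟩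
    · ext z
      simp [and_comm]
    · have h1 := congrArg (fun A : EuclideanSpace ℝ (Fin d) →L[ℝ] ℝ => A (S.L x)) h
      exact (one_ne_zero : (1 : ℝ) ≠ 0) (hder.symm.trans h1)
    · rw [hder]
      exact (one_ne_zero : (1 : ℝ) ≠ 0)
  · rw [hfr, disjoint_left]
    intro z (hz : E z < 1) hz'
    obtain ⟨t, ht, p, hp, rfl⟩ := mem_iUnion₂.1 hz'
    have hp1 : E p = 1 := hp
    have hps : p ∈ S.star := (mem_star_iff_pos hE hE_pos).2 (by rw [hp1]; exact one_pos)
    rw [hE.flow p hps, hp1, mul_one] at hz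
    exact absurd hz (not_lt.2 (Real.one_le_exp ht))
  · rw [hfr, eq_univ_iff_forall]
    intro z
    by_cases hz : E z < 1
    · exact Or.inl hz
    · push Not at hz
      have hzs : z ∈ S.star := (mem_star_iff_pos hE hE_pos).2 (by linarith)
      exact Or.inr (mem_iUnion₂.2 ⟨Real.log (E z), Real.log_nonneg hz, _,
        apply_flow_neg_log hE hE_pos hzs, S.flow_flow_neg _ _⟩)

end Positive

end Liouville

theorem bijective_of_injective {E : Type*} [NormedAddCommGroup E] [NormedSpace ℝ E]
    [FiniteDimensional ℝ E] (A : E →L[ℝ] E) (hA : Function.Injective A) : Function.Bijective A :=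
  ⟨hA, LinearMap.surjective_of_injective (f := A.toLinearMap) hA⟩

theorem hasDerivAt_line {Q : Type*} [NormedAddCommGroup Q] [NormedSpace ℝ Q] (q ε : Q) (t : ℝ) :
    HasDerivAt (fun τ : ℝ => q + τ • ε) ε t := by
  simpa using ((hasDerivAt_id t).smul_const ε).const_add q

theorem hasDerivAt_apply_line {Q : Type*} [NormedAddCommGroup Q] [NormedSpace ℝ Q]
    {B : Q → Q →L[ℝ] ℝ} {q ε' : Q} {t : ℝ} (hB : DifferentiableAt ℝ B (q + t • ε')) (ε : Q) :
    HasDerivAt (fun τ : ℝ => B (q + τ • ε') ε) (fderiv ℝ B (q + t • ε') ε' ε) t := by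
  have h1 := hB.hasFDerivAt.comp_hasDerivAt t (hasDerivAt_line q ε' t)
  have h2 := h1.clm_apply (hasDerivAt_const t ε)
  simpa using h2

/-! ### Partial derivatives of families depending on parameters. -/

section PartialDerivative

variable {d : ℕ} {M : Type*} [TopologicalSpace M] [ChartedSpace (EuclideanSpace ℝ (Fin d)) M]
  [IsManifold (𝓡 d) ∞ M]
  {Q : Type*} [NormedAddCommGroup Q] [NormedSpace ℝ Q]
  {V : Type*} [NormedAddCommGroup V] [NormedSpace ℝ V]

/-- The partial derivative of a smooth function in the parameter is smooth. -/
theorem contMDiffAt_fderiv_snd {g : M → Q → V} {z₀ : M} {q₀ : Q}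
    (hg : ContMDiffAt ((𝓡 d).prod 𝓘(ℝ, Q)) 𝓘(ℝ, V) ∞ (fun p : M × Q => g p.1 p.2) (z₀, q₀)) :
    ContMDiffAt ((𝓡 d).prod 𝓘(ℝ, Q)) 𝓘(ℝ, Q →L[ℝ] V) ∞
      (fun p : M × Q => fderiv ℝ (g p.1) p.2) (z₀, q₀) := by
  let E := EuclideanSpace ℝ (Fin d)
  set e := extChartAt (𝓡 d) z₀
  let gc : E × Q → V := fun r => g (e.symm r.1) r.2
  have hes : ContMDiffAt 𝓘(ℝ, E) (𝓡 d) ∞ e.symm (e z₀) :=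
    (contMDiffOn_extChartAt_symm z₀).contMDiffAt (extChartAt_target_mem_nhds z₀)
  have hez : e.symm (e z₀) = z₀ := extChartAt_to_inv z₀
  have hgc : ContDiffAt ℝ ∞ gc (e z₀, q₀) := by
    rw [← contMDiffAt_iff_contDiffAt]
    have h1 : ContMDiffAt 𝓘(ℝ, E × Q) ((𝓡 d).prod 𝓘(ℝ, Q)) ∞
        (fun r : E × Q => (e.symm r.1, r.2)) (e z₀, q₀) := by
      refine ContMDiffAt.prodMk ?_ contDiffAt_snd.contMDiffAt
      exact ContMDiffAt.comp (g := e.symm) (f := fun q : E × Q => q.1) (e z₀, q₀) hes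
          contDiffAt_fst.contMDiffAt
    refine ContMDiffAt.comp (g := fun p : M × Q => g p.1 p.2)
      (f := fun r : E × Q => (e.symm r.1, r.2)) (e z₀, q₀) ?_ h1
    show ContMDiffAt _ _ _ _ (e.symm (e z₀), q₀)
    rw [hez]
    exact hg
  have hev : ∀ᶠ r in 𝓝 (e z₀, q₀), DifferentiableAt ℝ gc r :=
    ((hgc.of_le (m := 1) (by simp)).eventually (by simp)).mono
      fun q hq => hq.differentiableAt (by simp)
  have hecont : Filter.Tendsto (fun p : M × Q => (e p.1, p.2)) (𝓝 (z₀, q₀)) (𝓝 (e z₀, q₀)) := by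
    refine ContinuousAt.prodMk (f := fun p : M × Q => e p.1) ?_ continuousAt_snd
    exact ContinuousAt.comp (g := e) (f := fun p : M × Q => p.1)
      (continuousAt_extChartAt (I := 𝓡 d) z₀) continuousAt_fst
  have h1 : ContDiffAt ℝ ∞ (fun r => (fderiv ℝ gc r).comp (ContinuousLinearMap.inr ℝ E Q))
      (e z₀, q₀) := (hgc.fderiv_right (by simp)).clm_comp contDiffAt_const
  have h2 : ContMDiffAt ((𝓡 d).prod 𝓘(ℝ, Q)) 𝓘(ℝ, Q →L[ℝ] V) ∞
      (fun p : M × Q => (fderiv ℝ gc (e p.1, p.2)).comp (ContinuousLinearMap.inr ℝ E Q))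
      (z₀, q₀) := by
    refine ContMDiffAt.comp (g := fun r => (fderiv ℝ gc r).comp (ContinuousLinearMap.inr ℝ E Q))
      (f := fun p : M × Q => (e p.1, p.2)) (I' := 𝓘(ℝ, E × Q)) (z₀, q₀) h1.contMDiffAt ?_
    rw [modelWithCornersSelf_prod, ← chartedSpaceSelf_prod]
    refine ContMDiffAt.prodMk ?_ contMDiffAt_snd
    exact ContMDiffAt.comp (g := e) (f := fun p : M × Q => p.1) (z₀, q₀)
      (contMDiffAt_extChartAt (I := 𝓡 d)) contMDiffAt_fst
  refine h2.congr_of_eventuallyEq ?_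
  have hs : ∀ᶠ p in 𝓝 (z₀, q₀), p.1 ∈ e.source :=
    continuousAt_fst (extChartAt_source_mem_nhds (I := 𝓡 d) z₀)
  filter_upwards [hecont.eventually hev, hs] with p hp hps
  have h3 : HasFDerivAt (fun q : Q => gc (e p.1, q))
      ((fderiv ℝ gc (e p.1, p.2)).comp (ContinuousLinearMap.inr ℝ E Q)) p.2 :=
    HasFDerivAt.comp (g := gc) (f := fun q : Q => (e p.1, q)) p.2 hp.hasFDerivAt
      (hasFDerivAt_prodMk_right (𝕜 := ℝ) (e p.1) p.2)
  have h4 : (fun q : Q => gc (e p.1, q)) = g p.1 := by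
    ext q
    show g (e.symm (e p.1)) q = g p.1 q
    rw [e.left_inv hps]
  rw [h4] at h3
  exact h3.fderiv

theorem hasDerivAt_comp_prod {g : M → Q → ℝ} {γ : ℝ → M} {δ : ℝ → Q} {t : ℝ}
    {v : TangentSpace (𝓡 d) (γ t)} {δ' : Q}
    (hg : MDifferentiableAt ((𝓡 d).prod 𝓘(ℝ, Q)) 𝓘(ℝ, ℝ) (fun p : M × Q => g p.1 p.2) (γ t, δ t))
    (hγ : HasMFDerivAt 𝓘(ℝ, ℝ) (𝓡 d) γ t ((1 : ℝ →L[ℝ] ℝ).smulRight v))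
    (hδ : HasDerivAt δ δ' t) :
    HasDerivAt (fun τ => g (γ τ) (δ τ))
      (differential (𝓡 d) (fun z => g z (δ t)) (γ t) v + fderiv ℝ (g (γ t)) (δ t) δ') t := by
  have h1 : HasMFDerivAt 𝓘(ℝ, ℝ) 𝓘(ℝ, Q) δ t ((1 : ℝ →L[ℝ] ℝ).smulRight δ') :=
    hδ.hasFDerivAt.hasMFDerivAt
  have h2 : HasMFDerivAt 𝓘(ℝ, ℝ) ((𝓡 d).prod 𝓘(ℝ, Q)) (fun τ => (γ τ, δ τ)) t
      ((1 : ℝ →L[ℝ] ℝ).smulRight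
        ((v, δ') : TangentSpace ((𝓡 d).prod 𝓘(ℝ, Q)) (γ t, δ t))) :=
    (hγ.prodMk h1).smulRight_one (by
      show (((1 : ℝ) • v, (1 : ℝ) • δ') : EuclideanSpace ℝ (Fin d) × Q) = (v, δ')
      exact Prod.ext (one_smul ℝ (show EuclideanSpace ℝ (Fin d) from v)) (one_smul ℝ δ'))
  refine (hasDerivAt_comp_curve h2 hg).congr_deriv ?_
  have h3 := mfderiv_prod_eq_add_apply
    (v := ((v, δ') : TangentSpace ((𝓡 d).prod 𝓘(ℝ, Q)) (γ t, δ t))) hg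
  refine Eq.trans h3 ?_
  have h4 : mfderiv 𝓘(ℝ, Q) 𝓘(ℝ, ℝ) (fun q => g (γ t) q) (δ t) = fderiv ℝ (g (γ t)) (δ t) :=
    mfderiv_eq_fderiv
  exact congrArg (fun A : Q →L[ℝ] ℝ => differential (𝓡 d) (fun z => g z (δ t)) (γ t) v + A δ') h4

theorem contMDiffAt_prodMk_left {q₀ : Q} {z₀ : M} :
    ContMDiffAt (𝓡 d) ((𝓡 d).prod 𝓘(ℝ, Q)) ∞ (fun z : M => (z, q₀)) z₀ :=
  contMDiffAt_id.prodMk contMDiffAt_const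

theorem contMDiffAt_prodMk_right {q₀ : Q} {z₀ : M} :
    ContMDiffAt 𝓘(ℝ, Q) ((𝓡 d).prod 𝓘(ℝ, Q)) ∞ (fun q : Q => (z₀, q)) q₀ :=
  contMDiffAt_const.prodMk contMDiffAt_id

/-- The partial velocity of a smooth family of maps depends smoothly on all variables. -/
theorem contMDiffAt_mfderiv_snd {Θ : M → Q → M} {z₀ : M} {q₀ : Q}
    (hΘ : ContMDiffAt ((𝓡 d).prod 𝓘(ℝ, Q)) (𝓡 d) ∞ (fun p : M × Q => Θ p.1 p.2) (z₀, q₀))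
    (ε : Q) : ContMDiffAt ((𝓡 d).prod 𝓘(ℝ, Q)) (𝓡 d).tangent ∞
      (fun p : M × Q => (⟨Θ p.1 p.2, mfderiv 𝓘(ℝ, Q) (𝓡 d) (Θ p.1) p.2 ε⟩ :
        TangentBundle (𝓡 d) M)) (z₀, q₀) := by
  rw [contMDiffAt_tangentBundle_iff hΘ]
  set x₀ := Θ z₀ q₀
  set e := extChartAt (𝓡 d) x₀
  have h1 : ContMDiffAt ((𝓡 d).prod 𝓘(ℝ, Q)) 𝓘(ℝ, EuclideanSpace ℝ (Fin d)) ∞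
      (fun p : M × Q => e (Θ p.1 p.2)) (z₀, q₀) :=
    ContMDiffAt.comp (g := e) (f := fun p : M × Q => Θ p.1 p.2) (z₀, q₀)
      (contMDiffAt_extChartAt (I := 𝓡 d)) hΘ
  have h2 := contMDiffAt_fderiv_snd (g := fun z q => e (Θ z q)) h1
  refine (h2.clm_apply (contMDiffAt_const (c := ε))).congr_of_eventuallyEq ?_
  filter_upwards [hΘ.continuousAt (extChartAt_source_mem_nhds (I := 𝓡 d) x₀),
    hΘ.eventually_mdifferentiableAt] with p hp hpd
  have hps : Θ p.1 p.2 ∈ (chartAt (EuclideanSpace ℝ (Fin d)) x₀).source := by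
    have : Θ p.1 p.2 ∈ e.source := hp
    rwa [extChartAt_source] at this
  have h3 : MDifferentiableAt 𝓘(ℝ, Q) (𝓡 d) (Θ p.1) p.2 :=
    MDifferentiableAt.comp (g := fun p : M × Q => Θ p.1 p.2) (f := fun q => (p.1, q)) p.2 hpd
      (contMDiffAt_prodMk_right.mdifferentiableAt (by simp))
  have h4 := mfderiv_comp (I := 𝓘(ℝ, Q)) p.2 (mdifferentiableAt_extChartAt (I := 𝓡 d) hps) h3
  have h5 := (mfderiv_eq_fderiv (f := fun q => e (Θ p.1 q)) (x := p.2)).symm.trans h4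
  exact (congrArg (fun A : Q →L[ℝ] EuclideanSpace ℝ (Fin d) => A ε) h5).symm

end PartialDerivative

/-! ### Families of α-preserving maps, their generators and zero curvature. -/

namespace Liouville

variable {d : ℕ} {M : Type*} [TopologicalSpace M] [T2Space M]
  [ChartedSpace (EuclideanSpace ℝ (Fin d)) M]
  [IsManifold (𝓡 d) ∞ M] (S : Liouville d M)

/-- A function on `M_*` that is infinitesimally homogeneous is homogeneous. -/
theorem apply_flow_of_differential {h : M → ℝ}
    (hh : ∀ z ∈ S.star, MDifferentiableAt (𝓡 d) 𝓘(ℝ, ℝ) h z)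
    (hL : ∀ z ∈ S.star, differential (𝓡 d) h z (S.L z) = h z) {z : M} (hz : z ∈ S.star) (t : ℝ) :
    h (S.flow t z) = Real.exp t * h z := by
  have hder : ∀ τ, HasDerivAt (fun τ => Real.exp (-τ) * h (S.flow τ z)) 0 τ := by
    intro τ
    have hs := S.flow_mem_star hz τ
    have h1 := hasDerivAt_comp_curve (S.flow_integral z τ) (hh _ hs)
    have h2 : HasDerivAt (fun τ : ℝ => Real.exp (-τ)) (-Real.exp (-τ)) τ := by
      simpa using (hasDerivAt_id τ).neg.exp
    refine (h2.mul h1).congr_deriv ?_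
    have h3 : differential (𝓡 d) h (S.flow τ z) (S.L (S.flow τ z)) = h (S.flow τ z) := hL _ hs
    show -Real.exp (-τ) * h (S.flow τ z) +
      Real.exp (-τ) * differential (𝓡 d) h (S.flow τ z) (S.L (S.flow τ z)) = 0
    rw [h3]
    ring
  have hc := is_const_of_deriv_eq_zero (fun τ => (hder τ).differentiableAt)
    (fun τ => (hder τ).deriv) t 0
  simp only [neg_zero, Real.exp_zero, one_mul, S.flow_zero] at hc
  rw [← hc, ← mul_assoc, ← Real.exp_add, add_neg_cancel, Real.exp_zero, one_mul]

/-- Euler's identity, obtained by differentiating e^τ h(z) at τ = 0. -/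
theorem IsHomogeneous.differential_L {S : Liouville d M} {h : M → ℝ} (hh : S.IsHomogeneous h)
    {z : M} (hz : z ∈ S.star) (hd : MDifferentiableAt (𝓡 d) 𝓘(ℝ, ℝ) h z) :
    differential (𝓡 d) h z (S.L z) = h z := by
  have hd0 : MDifferentiableAt (𝓡 d) 𝓘(ℝ, ℝ) h (S.flow 0 z) := by rwa [S.flow_zero]
  have h1 := hasDerivAt_comp_curve (S.flow_integral z 0) hd0
  have h2 : HasDerivAt (fun τ => h (S.flow τ z)) (h z) 0 := by
    have h3 : (fun τ => h (S.flow τ z)) = fun τ => Real.exp τ * h z := by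
      ext τ
      rw [hh.flow z hz]
    rw [h3]
    simpa using (Real.hasDerivAt_exp 0).mul_const (h z)
  have h4 : differential (𝓡 d) h (S.flow 0 z) (S.L (S.flow 0 z)) = h z := h1.unique h2
  rwa [S.flow_zero] at h4

variable {Q : Type*} [NormedAddCommGroup Q] [NormedSpace ℝ Q]

/-- A smooth family of diffeomorphisms of `M_*` that preserve the form `α`. -/
structure IsContactFamily (Θ : M → Q → M) : Prop where
  smooth : ∀ z ∈ S.star, ∀ q, ContMDiffAt ((𝓡 d).prod 𝓘(ℝ, Q)) (𝓡 d) ∞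
    (fun p : M × Q => Θ p.1 p.2) (z, q)
  bijOn : ∀ q, BijOn (fun z => Θ z q) S.star S.star
  bijective : ∀ z ∈ S.star, ∀ q, Function.Bijective (mfderiv (𝓡 d) (𝓡 d) (fun z => Θ z q) z)
  form : ∀ z ∈ S.star, ∀ q, ∀ v : TangentSpace (𝓡 d) z,
    S.α (Θ z q) (mfderiv (𝓡 d) (𝓡 d) (fun z => Θ z q) z v) = S.α z v

/-- The inverse of a family of diffeomorphisms of `M_*`. -/
noncomputable def familyInv (Θ : M → Q → M) (w : M) (q : Q) : M :=
  open Classical in if h : ∃ z, z ∈ S.star ∧ Θ z q = w then h.choose else w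

/-- The Hamiltonian that generates the family `Θ` in the direction `ε`. -/
noncomputable def generator (Θ : M → Q → M) (ε : Q) (w : M) (q : Q) : ℝ :=
  S.α (Θ (S.familyInv Θ w q) q) (mfderiv 𝓘(ℝ, Q) (𝓡 d) (Θ (S.familyInv Θ w q)) q ε)

namespace IsContactFamily

variable {S} {Θ : M → Q → M} (hΘ : S.IsContactFamily Θ)
include hΘ

theorem mem_star {z : M} (hz : z ∈ S.star) (q : Q) : Θ z q ∈ S.star := (hΘ.bijOn q).mapsTo hz

theorem familyInv_spec {w : M} (hw : w ∈ S.star) (q : Q) :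
    S.familyInv Θ w q ∈ S.star ∧ Θ (S.familyInv Θ w q) q = w := by
  have h : ∃ z, z ∈ S.star ∧ Θ z q = w := (hΘ.bijOn q).surjOn hw
  rw [familyInv, dif_pos h]
  exact h.choose_spec

theorem familyInv_apply {z : M} (hz : z ∈ S.star) (q : Q) : S.familyInv Θ (Θ z q) q = z :=
  have h := hΘ.familyInv_spec (hΘ.mem_star hz q) q
  (hΘ.bijOn q).injOn h.1 hz h.2

theorem mdifferentiableAt_left {z : M} (hz : z ∈ S.star) (q : Q) :
    MDifferentiableAt (𝓡 d) (𝓡 d) (fun z => Θ z q) z :=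
  (ContMDiffAt.comp (g := fun p : M × Q => Θ p.1 p.2) (f := fun z => (z, q)) z (hΘ.smooth z hz q)
      contMDiffAt_prodMk_left).mdifferentiableAt (by simp)

theorem contMDiffAt_right {z : M} (hz : z ∈ S.star) (q : Q) :
    ContMDiffAt 𝓘(ℝ, Q) (𝓡 d) ∞ (Θ z) q :=
  ContMDiffAt.comp (g := fun p : M × Q => Θ p.1 p.2) (f := fun q => (z, q)) q (hΘ.smooth z hz q)
      contMDiffAt_prodMk_right

theorem generator_apply {z : M} (hz : z ∈ S.star) (q ε : Q) :
    S.generator Θ ε (Θ z q) q = S.α (Θ z q) (mfderiv 𝓘(ℝ, Q) (𝓡 d) (Θ z) q ε) := by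
  rw [generator, hΘ.familyInv_apply hz]

/-- The map (z, q) ↦ (Θ z q, q) has a block triangular derivative with invertible diagonal blocks,
so its inverse is smooth in all variables jointly. -/
theorem contMDiffAt_familyInv [FiniteDimensional ℝ Q] {w : M} (hw : w ∈ S.star) (q : Q) :
    ContMDiffAt ((𝓡 d).prod 𝓘(ℝ, Q)) (𝓡 d) ∞ (fun p : M × Q => S.familyInv Θ p.1 p.2)
      (w, q) := by
  obtain ⟨hz, hzw⟩ := hΘ.familyInv_spec hw q
  set z := S.familyInv Θ w q
  let Ξ : M × Q → M × Q := fun p => (Θ p.1 p.2, p.2)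
  have hΞ : ContMDiffAt ((𝓡 d).prod 𝓘(ℝ, Q)) ((𝓡 d).prod 𝓘(ℝ, Q)) ∞ Ξ (z, q) :=
    (hΘ.smooth z hz q).prodMk contMDiffAt_snd
  have hd := (hΘ.smooth z hz q).mdifferentiableAt (by simp)
  have hinj : Function.Injective
      (mfderiv ((𝓡 d).prod 𝓘(ℝ, Q)) ((𝓡 d).prod 𝓘(ℝ, Q)) Ξ (z, q)) := by
    rw [injective_iff_map_eq_zero]
    intro v hv
    have h1 := MDifferentiableAt.mfderiv_prod hd
      (mdifferentiableAt_snd (I := 𝓡 d) (I' := 𝓘(ℝ, Q)) (x := ((z, q) : M × Q)))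
    have h2 : (mfderiv ((𝓡 d).prod 𝓘(ℝ, Q)) (𝓡 d) (fun p : M × Q => Θ p.1 p.2) (z, q) v,
        mfderiv ((𝓡 d).prod 𝓘(ℝ, Q)) 𝓘(ℝ, Q) (Prod.snd : M × Q → Q) (z, q) v) =
        ((0, 0) : EuclideanSpace ℝ (Fin d) × Q) :=
      (congrArg (fun A : EuclideanSpace ℝ (Fin d) × Q →L[ℝ] EuclideanSpace ℝ (Fin d) × Q => A v)
        h1).symm.trans hv
    have h3 : v.2 = (0 : Q) := by
      have := congrArg Prod.snd h2
      rw [mfderiv_snd] at this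
      exact this
    have h4 := congrArg Prod.fst h2
    have h5 := mfderiv_prod_eq_add_apply (v := v) hd
    have h6 : mfderiv (𝓡 d) (𝓡 d) (fun z => Θ z q) z v.1 = 0 := by
      have h7 : mfderiv 𝓘(ℝ, Q) (𝓡 d) (fun r => Θ z r) q v.2 = 0 := by
        rw [h3]
        exact map_zero _
      have h8 := h5.symm.trans h4
      have key (a b : EuclideanSpace ℝ (Fin d)) (hab : a + b = 0) (hb : b = 0) : a = 0 := by
        rwa [hb, add_zero] at hab
      exact key _ _ h8 h7
    have h7 : v.1 = 0 := (hΘ.bijective z hz q).1 (h6.trans (map_zero _).symm)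
    exact Prod.ext h7 h3
  have hbij : Function.Bijective
      (mfderiv ((𝓡 d).prod 𝓘(ℝ, Q)) ((𝓡 d).prod 𝓘(ℝ, Q)) Ξ (z, q)) := by
    exact bijective_of_injective (E := EuclideanSpace ℝ (Fin d) × Q) _ hinj
  have hk : ∀ᶠ p in 𝓝 (z, q), (fun p : M × Q => (S.familyInv Θ p.1 p.2, p.2)) (Ξ p) = p := by
    have h1 : ∀ᶠ p in 𝓝 (z, q), p.1 ∈ S.star :=
      continuousAt_fst (S.isOpen_star.mem_nhds hz)
    filter_upwards [h1] with p hp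
    exact Prod.ext (hΘ.familyInv_apply hp p.2) rfl
  have h1 := contMDiffAt_leftInverse
    (k := fun p : M × Q => (S.familyInv Θ p.1 p.2, p.2)) hΞ hbij hk
  have h2 : Ξ (z, q) = (w, q) := Prod.ext hzw rfl
  rw [h2] at h1
  exact ContMDiffAt.comp (g := Prod.fst) (w, q) contMDiffAt_fst h1

theorem contMDiffAt_generator [FiniteDimensional ℝ Q] (ε : Q) {w : M} (hw : w ∈ S.star) (q : Q) :
    ContMDiffAt ((𝓡 d).prod 𝓘(ℝ, Q)) 𝓘(ℝ, ℝ) ∞ (fun p : M × Q => S.generator Θ ε p.1 p.2)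
      (w, q) := by
  have h1 := hΘ.contMDiffAt_familyInv hw q
  have hz := (hΘ.familyInv_spec hw q).1
  have h2 := contMDiffAt_form_apply S.smooth_α
    (contMDiffAt_mfderiv_snd (hΘ.smooth (S.familyInv Θ w q) hz q) ε)
  exact ContMDiffAt.comp (g := fun p : M × Q => S.α (Θ p.1 p.2)
    (mfderiv 𝓘(ℝ, Q) (𝓡 d) (Θ p.1) p.2 ε)) (f := fun p : M × Q => (S.familyInv Θ p.1 p.2, p.2))
    (w, q) h2 (h1.prodMk contMDiffAt_snd)

theorem mdifferentiableAt_generator [FiniteDimensional ℝ Q] (ε : Q) {w : M} (hw : w ∈ S.star)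
    (q : Q) : MDifferentiableAt (𝓡 d) 𝓘(ℝ, ℝ) (fun w => S.generator Θ ε w q) w :=
  (ContMDiffAt.comp (g := fun p : M × Q => S.generator Θ ε p.1 p.2) (f := fun z => (z, q)) w
    (hΘ.contMDiffAt_generator ε hw q) contMDiffAt_prodMk_left).mdifferentiableAt (by simp)

/-- The family moves by the symplectic gradient of its generator. The pulled-back form Θ_q^*α does
not depend on q, so its derivative in the direction ε vanishes; Cartan's formula splits it into the
differential of α(velocity) and i_velocity ω. -/
theorem differential_generator [FiniteDimensional ℝ Q] {z : M} (hz : z ∈ S.star) (q ε : Q)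
    (u : TangentSpace (𝓡 d) (Θ z q)) :
    differential (𝓡 d) (fun w => S.generator Θ ε w q) (Θ z q) u =
      S.symp (Θ z q) u (mfderiv 𝓘(ℝ, Q) (𝓡 d) (Θ z) q ε) := by
  -- Writing q as a point of the line q₁ + τ • ε at τ = 0 makes the one-parameter formulas apply at
  -- q itself.
  obtain ⟨q₁, rfl⟩ : ∃ q₁, q = q₁ + (0 : ℝ) • ε := ⟨q, by simp⟩
  obtain ⟨v, rfl⟩ := (hΘ.bijective z hz (q₁ + (0 : ℝ) • ε)).2 u
  let Θ' : ℝ → M → M := fun τ y => Θ y (q₁ + τ • ε)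
  have hΘ' : ContMDiffAt (𝓘(ℝ, ℝ).prod (𝓡 d)) (𝓡 d) ∞ (fun p : ℝ × M => Θ' p.1 p.2) (0, z) := by
    refine ContMDiffAt.comp (g := fun p : M × Q => Θ p.1 p.2)
      (f := fun p : ℝ × M => (p.2, q₁ + p.1 • ε)) ((0, z) : ℝ × M)
      (hΘ.smooth z hz (q₁ + (0 : ℝ) • ε)) ?_
    refine contMDiffAt_snd.prodMk ?_
    exact ContMDiffAt.comp (g := fun τ : ℝ => q₁ + τ • ε) (f := fun p : ℝ × M => p.1)
      ((0, z) : ℝ × M) (by fun_prop : ContDiff ℝ ∞ fun τ : ℝ => q₁ + τ • ε).contDiffAt.contMDiffAt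
      contMDiffAt_fst
  have h1 := hasDerivAt_form_mfderiv S.smooth_α hΘ' v
  have h2 : (fun t => S.α (Θ' t z) (mfderiv (𝓡 d) (𝓡 d) (Θ' t) z v)) = fun _ => S.α z v := by
    ext t
    exact hΘ.form z hz (q₁ + t • ε) v
  rw [h2] at h1
  have h3 := h1.unique (hasDerivAt_const (0 : ℝ) (S.α z v))
  have hvel : ∀ y ∈ S.star, velocity (fun t => Θ' t y) 0 =
      mfderiv 𝓘(ℝ, Q) (𝓡 d) (Θ y) (q₁ + (0 : ℝ) • ε) ε := by
    intro y hy
    have h4 : HasFDerivAt (fun τ : ℝ => q₁ + τ • ε) (ContinuousLinearMap.toSpanSingleton ℝ ε) 0 :=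
      (hasDerivAt_line q₁ ε 0).hasFDerivAt
    have h5 := mfderiv_comp_fderiv (u := Θ y) (ψ := fun τ : ℝ => q₁ + τ • ε)
      ((hΘ.contMDiffAt_right hy _).mdifferentiableAt (by simp)) h4 (1 : ℝ)
    refine h5.trans ?_
    exact congrArg (mfderiv 𝓘(ℝ, Q) (𝓡 d) (Θ y) (q₁ + (0 : ℝ) • ε)) (one_smul ℝ ε)
  have h4 : (fun y => S.α (Θ' 0 y) (velocity (fun t => Θ' t y) 0)) =ᶠ[𝓝 z]
      (fun w => S.generator Θ ε w (q₁ + (0 : ℝ) • ε)) ∘ fun y => Θ y (q₁ + (0 : ℝ) • ε) := by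
    filter_upwards [S.isOpen_star.mem_nhds hz] with y hy
    rw [hvel y hy]
    exact (hΘ.generator_apply hy _ ε).symm
  have h5 := h4.mfderiv_eq (I := 𝓡 d) (I' := 𝓘(ℝ, ℝ))
  have h6 := mfderiv_comp (I := 𝓡 d) z
    (hΘ.mdifferentiableAt_generator ε (hΘ.mem_star hz (q₁ + (0 : ℝ) • ε)) (q₁ + (0 : ℝ) • ε))
    (hΘ.mdifferentiableAt_left hz (q₁ + (0 : ℝ) • ε))
  have h7 : differential (𝓡 d) (fun y => S.α (Θ' 0 y) (velocity (fun t => Θ' t y) 0)) z v =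
      differential (𝓡 d) (fun w => S.generator Θ ε w (q₁ + (0 : ℝ) • ε))
        (Θ z (q₁ + (0 : ℝ) • ε))
        (mfderiv (𝓡 d) (𝓡 d) (fun z => Θ z (q₁ + (0 : ℝ) • ε)) z v) :=
    congrArg (fun A : EuclideanSpace ℝ (Fin d) →L[ℝ] ℝ => A v) (h5.trans h6)
  rw [h7, hvel z hz, dForm_swap] at h3
  exact eq_of_sub_eq_zero h3

theorem sharp_differential_generator [FiniteDimensional ℝ Q] {z : M} (hz : z ∈ S.star) (q ε : Q) :
    S.sharp (differential (𝓡 d) (fun w => S.generator Θ ε w q) (Θ z q)) =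
      mfderiv 𝓘(ℝ, Q) (𝓡 d) (Θ z) q ε :=
  S.eq_of_symp_eq fun u => by rw [S.symp_sharp, hΘ.differential_generator hz]

/-- Generators are automatically of degree one infinitesimally: ω(L, velocity) = α(velocity). -/
theorem differential_generator_L [FiniteDimensional ℝ Q] {w : M} (hw : w ∈ S.star) (q ε : Q) :
    differential (𝓡 d) (fun w => S.generator Θ ε w q) w (S.L w) = S.generator Θ ε w q := by
  obtain ⟨z, hz, rfl⟩ := (hΘ.bijOn q).surjOn hw
  show differential (𝓡 d) (fun w => S.generator Θ ε w q) (Θ z q) (S.L (Θ z q)) =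
    S.generator Θ ε (Θ z q) q
  rw [hΘ.differential_generator hz, symp, S.contraction, hΘ.generator_apply hz]

/-- Along q ↦ (Θ z q, q) the generator in the direction ε equals the ε-component of the pull-back of
α under q ↦ Θ z q. Its total derivative has a part from the moving point and a part from the
parameter. -/
theorem hasDerivAt_generator [FiniteDimensional ℝ Q] {z : M} (hz : z ∈ S.star) (q ε ε' : Q) :
    fderiv ℝ (pullForm S.α (Θ z)) q ε' ε =
      differential (𝓡 d) (fun w => S.generator Θ ε w q) (Θ z q)
        (mfderiv 𝓘(ℝ, Q) (𝓡 d) (Θ z) q ε') + fderiv ℝ (S.generator Θ ε (Θ z q)) q ε' := by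
  obtain ⟨q₁, rfl⟩ : ∃ q₁, q = q₁ + (0 : ℝ) • ε' := ⟨q, by simp⟩
  have hδ : HasDerivAt (fun τ : ℝ => q₁ + τ • ε') ε' 0 := hasDerivAt_line q₁ ε' 0
  have hm : MDifferentiableAt 𝓘(ℝ, Q) (𝓡 d) (Θ z) (q₁ + (0 : ℝ) • ε') :=
    (hΘ.contMDiffAt_right hz _).mdifferentiableAt (by simp)
  have hγ : HasMFDerivAt 𝓘(ℝ, ℝ) (𝓡 d) (fun τ : ℝ => Θ z (q₁ + τ • ε')) 0
      ((1 : ℝ →L[ℝ] ℝ).smulRight (mfderiv 𝓘(ℝ, Q) (𝓡 d) (Θ z) (q₁ + (0 : ℝ) • ε') ε')) := by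
    have h1 : HasMFDerivAt 𝓘(ℝ, ℝ) 𝓘(ℝ, Q) (fun τ : ℝ => q₁ + τ • ε') 0
      ((1 : ℝ →L[ℝ] ℝ).smulRight ε') := hδ.hasFDerivAt.hasMFDerivAt
    refine (HasMFDerivAt.comp (0 : ℝ) (g := Θ z) (f := fun τ : ℝ => q₁ + τ • ε')
      hm.hasMFDerivAt h1).smulRight_one ?_
    exact congrArg (mfderiv 𝓘(ℝ, Q) (𝓡 d) (Θ z) (q₁ + (0 : ℝ) • ε')) (one_smul ℝ ε')
  have h1 := hasDerivAt_comp_prod (g := S.generator Θ ε)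
    ((hΘ.contMDiffAt_generator ε (hΘ.mem_star hz (q₁ + (0 : ℝ) • ε'))
      (q₁ + (0 : ℝ) • ε')).mdifferentiableAt (by simp)) hγ hδ
  have h2 : HasDerivAt (fun τ : ℝ => pullForm S.α (Θ z) (q₁ + τ • ε') ε)
      (fderiv ℝ (pullForm S.α (Θ z)) (q₁ + (0 : ℝ) • ε') ε' ε) 0 :=
    hasDerivAt_apply_line ((contDiffAt_pullForm S.smooth_α (hΘ.contMDiffAt_right hz
      (q₁ + (0 : ℝ) • ε'))).differentiableAt (by simp)) ε
  refine h2.unique (h1.congr_of_eventuallyEq (Filter.Eventually.of_forall fun τ => ?_))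
  exact (hΘ.generator_apply hz _ ε).symm

/-- The zero-curvature equation for the generators of a family. -/
theorem zero_curvature [FiniteDimensional ℝ Q] {w : M} (hw : w ∈ S.star) (q ε ε' : Q) :
    fderiv ℝ (S.generator Θ ε w) q ε' - fderiv ℝ (S.generator Θ ε' w) q ε +
      differential (𝓡 d) (fun w => S.generator Θ ε w q) w
        (S.sharp (differential (𝓡 d) (fun w => S.generator Θ ε' w q) w)) = 0 := by
  obtain ⟨z, hz, rfl⟩ := (hΘ.bijOn q).surjOn hw
  show fderiv ℝ (S.generator Θ ε (Θ z q)) q ε' - fderiv ℝ (S.generator Θ ε' (Θ z q)) q ε +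
      differential (𝓡 d) (fun w => S.generator Θ ε w q) (Θ z q)
        (S.sharp (differential (𝓡 d) (fun w => S.generator Θ ε' w q) (Θ z q))) = 0
  have h1 := hΘ.hasDerivAt_generator hz q ε ε'
  have h2 := hΘ.hasDerivAt_generator hz q ε' ε
  -- Antisymmetrizing h1 and h2 gives d of this pull-back, which is also ω of the two velocities.
  -- The moving-point terms contribute twice this value of ω, so one copy remains.
  have h3 := fderiv_pullForm S.smooth_α (hΘ.contMDiffAt_right hz q) ε' ε
  rw [hΘ.differential_generator hz] at h1 h2
  rw [hΘ.sharp_differential_generator hz, hΘ.differential_generator hz]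
  rw [symp] at h1 h2 ⊢
  rw [dForm_swap] at h2
  linarith

end IsContactFamily

end Liouville

/-! ### Operations on smooth vector fields, and completeness under compact support. -/

section Tangent

variable {E : Type u} [NormedAddCommGroup E] [NormedSpace ℝ E]
  {H : Type*} [TopologicalSpace H] {I : ModelWithCorners ℝ E H} [I.Boundaryless]
  {N : Type*} [TopologicalSpace N] [ChartedSpace H N] [IsManifold I ∞ N]
  {E' : Type*} [NormedAddCommGroup E'] [NormedSpace ℝ E']
  {H' : Type*} [TopologicalSpace H'] {J : ModelWithCorners ℝ E' H'}
  {N' : Type*} [TopologicalSpace N'] [ChartedSpace H' N']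
  {b : N' → N} {V W : ∀ p, TangentSpace I (b p)} {p₀ : N'}

theorem contMDiffAt_base (hV : ContMDiffAt J I.tangent ∞
    (fun p => (⟨b p, V p⟩ : TangentBundle I N)) p₀) : ContMDiffAt J I ∞ b p₀ :=
  ContMDiffAt.comp (g := fun v : TangentBundle I N => v.proj) p₀
    (Bundle.contMDiff_proj (TangentSpace I)).contMDiffAt hV

theorem contMDiffAt_tangent_smul {c : N' → ℝ} (hc : ContMDiffAt J 𝓘(ℝ, ℝ) ∞ c p₀)
    (hV : ContMDiffAt J I.tangent ∞ (fun p => (⟨b p, V p⟩ : TangentBundle I N)) p₀) :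
    ContMDiffAt J I.tangent ∞ (fun p => (⟨b p, c p • V p⟩ : TangentBundle I N)) p₀ := by
  have hb := contMDiffAt_base hV
  rw [contMDiffAt_tangentBundle_iff hb] at hV ⊢
  have h : (fun p => chartCoord I (b p₀) (b p) (c p • V p)) =
      fun p => c p • chartCoord I (b p₀) (b p) (V p) := by
    ext p
    exact map_smul _ _ _
  rw [h]
  exact hc.smul hV

theorem contMDiffAt_tangent_sub
    (hV : ContMDiffAt J I.tangent ∞ (fun p => (⟨b p, V p⟩ : TangentBundle I N)) p₀)
    (hW : ContMDiffAt J I.tangent ∞ (fun p => (⟨b p, W p⟩ : TangentBundle I N)) p₀) :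
    ContMDiffAt J I.tangent ∞ (fun p => (⟨b p, V p - W p⟩ : TangentBundle I N)) p₀ := by
  have hb := contMDiffAt_base hV
  rw [contMDiffAt_tangentBundle_iff hb] at hV hW ⊢
  have h : (fun p => chartCoord I (b p₀) (b p) (V p - W p)) =
      fun p => chartCoord I (b p₀) (b p) (V p) - chartCoord I (b p₀) (b p) (W p) := by
    ext p
    exact map_sub _ _ _
  rw [h]
  exact hV.sub hW

theorem contMDiffAt_tangent_zero (hb : ContMDiffAt J I ∞ b p₀) :
    ContMDiffAt J I.tangent ∞ (fun p => (⟨b p, 0⟩ : TangentBundle I N)) p₀ := by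
  rw [contMDiffAt_tangentBundle_iff hb]
  have h : (fun p => chartCoord I (b p₀) (b p) (0 : TangentSpace I (b p))) = fun _ => 0 := by
    ext p
    exact map_zero _
  rw [h]
  exact contMDiffAt_const

/-- A vector field with compact support has a global flow. -/
theorem exists_flow_of_compact [FiniteDimensional ℝ E] [T2Space N] {X : ∀ x : N, TangentSpace I x}
    (hX : ContMDiff I I.tangent ∞ (fun x => (⟨x, X x⟩ : TangentBundle I N))) {C : Set N}
    (hC : IsCompact C) (h0 : ∀ x ∉ C, X x = 0) :
    ∃ Φ : ℝ → N → N, (∀ x, Φ 0 x = x) ∧ ∀ x, IsMIntegralCurve (fun t => Φ t x) X := by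
  obtain ⟨ε, hε, h⟩ := exists_uniform_time hX hC
  refine exists_flow hX hε fun x => ?_
  by_cases hx : x ∈ C
  · exact h x hx
  · exact ⟨fun _ => x, rfl, (isMIntegralCurve_const (h0 x hx)).isMIntegralCurveOn _⟩

end Tangent

/-- Applied to E, such a profile is supported away from the core and in a compact set. The radii are
chosen so that the support of the bump begins at a/2 and ends at b + a/2. -/
theorem exists_bump {a b : ℝ} (ha : 0 < a) (hab : a ≤ b) : ∃ φ : ℝ → ℝ, ContDiff ℝ ∞ φ ∧
    (∀ x ∈ Icc a b, φ x = 1) ∧ (∀ x ≤ a / 2, φ x = 0) ∧ ∀ x ≥ b + a, φ x = 0 := by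
  let φ : ContDiffBump ((a + b) / 2) :=
    ⟨(b - a) / 2 + a / 4, (b - a) / 2 + a / 2, by linarith, by linarith⟩
  refine ⟨φ, φ.contDiff, fun x hx => ?_, fun x hx => ?_, fun x hx => ?_⟩
  · refine φ.one_of_mem_closedBall ?_
    rw [Metric.mem_closedBall, Real.dist_eq, abs_le]
    show -((b - a) / 2 + a / 4) ≤ _ ∧ _ ≤ (b - a) / 2 + a / 4
    constructor <;> linarith [hx.1, hx.2]
  · refine φ.zero_of_le_dist ?_
    rw [Real.dist_eq, le_abs]
    show (b - a) / 2 + a / 2 ≤ _ ∨ (b - a) / 2 + a / 2 ≤ _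
    right
    linarith
  · refine φ.zero_of_le_dist ?_
    rw [Real.dist_eq, le_abs]
    show (b - a) / 2 + a / 2 ≤ _ ∨ (b - a) / 2 + a / 2 ≤ _
    left
    linarith

/-! ### Maps that rescale α. -/

section PullBack

variable {d : ℕ} {M : Type*} [TopologicalSpace M] [ChartedSpace (EuclideanSpace ℝ (Fin d)) M]
  [IsManifold (𝓡 d) ∞ M] {α : ∀ x : M, TangentSpace (𝓡 d) x →L[ℝ] ℝ}

theorem bijective_mfderiv_of_leftInverse {φ ψ : M → M} {z : M}
    (hφ : MDifferentiableAt (𝓡 d) (𝓡 d) φ z) (hψ : MDifferentiableAt (𝓡 d) (𝓡 d) ψ (φ z))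
    (h : ∀ᶠ y in 𝓝 z, ψ (φ y) = y) : Function.Bijective (mfderiv (𝓡 d) (𝓡 d) φ z) := by
  refine bijective_of_injective (E := EuclideanSpace ℝ (Fin d)) (mfderiv (𝓡 d) (𝓡 d) φ z) ?_
  have h1 := mfderiv_comp z hψ hφ
  have h2 : ψ ∘ φ =ᶠ[𝓝 z] id := h
  have h3 := h2.mfderiv_eq (I := 𝓡 d) (I' := 𝓡 d)
  have key : ∀ v : EuclideanSpace ℝ (Fin d),
      mfderiv (𝓡 d) (𝓡 d) ψ (φ z) (mfderiv (𝓡 d) (𝓡 d) φ z v) = v := by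
    intro v
    let E := EuclideanSpace ℝ (Fin d)
    have h4 : mfderiv (𝓡 d) (𝓡 d) (id : M → M) z v = v :=
      congrArg (fun A : E →L[ℝ] E => A v) (mfderiv_id (I := 𝓡 d) (x := z))
    exact (congrArg (fun A : E →L[ℝ] E => A v) h1).symm.trans
      ((congrArg (fun A : E →L[ℝ] E => A v) h3).trans h4)
  intro v w hvw
  rw [← key v, ← key w]
  exact congrArg (mfderiv (𝓡 d) (𝓡 d) ψ (φ z)) hvw

/-- A map that multiplies `α` by a constant multiplies `dα` by this constant. -/
theorem dForm_mfderiv (hα : IsSmoothForm α) {φ : M → M} {z : M} {c : ℝ}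
    (hφ : ContMDiffAt (𝓡 d) (𝓡 d) ∞ φ z)
    (h : ∀ᶠ y in 𝓝 z, ∀ v, α (φ y) (mfderiv (𝓡 d) (𝓡 d) φ y v) = c * α y v)
    (v w : TangentSpace (𝓡 d) z) :
    dForm α (φ z) (mfderiv (𝓡 d) (𝓡 d) φ z v) (mfderiv (𝓡 d) (𝓡 d) φ z w) =
      c * dForm α z v w := by
  let E := EuclideanSpace ℝ (Fin d)
  set e := extChartAt (𝓡 d) z
  have hez : e.symm (e z) = z := extChartAt_to_inv z
  have hes : ContMDiffAt 𝓘(ℝ, E) (𝓡 d) ∞ e.symm (e z) :=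
    (contMDiffOn_extChartAt_symm z).contMDiffAt (extChartAt_target_mem_nhds z)
  have hst : Filter.Tendsto e.symm (𝓝 (e z)) (𝓝 z) := by
    have := hes.continuousAt.tendsto
    rwa [hez] at this
  have hφe : ContMDiffAt 𝓘(ℝ, E) (𝓡 d) ∞ (fun y => φ (e.symm y)) (e z) := by
    refine ContMDiffAt.comp (g := φ) (f := e.symm) (e z) ?_ hes
    rw [hez]
    exact hφ
  have key : ∀ g : M → M, ContMDiffAt 𝓘(ℝ, E) (𝓡 d) ∞ (fun y => g (e.symm y)) (e z) →
      ∀ v : TangentSpace (𝓡 d) z, (show E from mfderiv (𝓡 d) (𝓡 d) g z v) =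
        mfderiv 𝓘(ℝ, E) (𝓡 d) (fun y => g (e.symm y)) (e z) (mfderiv (𝓡 d) 𝓘(ℝ, E) e z v) := by
    intro g hg v
    have h4 := mfderiv_comp (I := 𝓡 d) z (hg.mdifferentiableAt (by simp))
      (mdifferentiableAt_extChartAt (I := 𝓡 d) (mem_chart_source _ z))
    have h5 : g =ᶠ[𝓝 z] (fun y => g (e.symm y)) ∘ e := by
      filter_upwards [extChartAt_source_mem_nhds (I := 𝓡 d) z] with y hy
      show g y = g (e.symm (e y))
      rw [e.left_inv hy]
    exact (congrArg (fun A : E →L[ℝ] E => A v) (h5.mfderiv_eq (I := 𝓡 d) (I' := 𝓡 d))).trans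
      (congrArg (fun A : E →L[ℝ] E => A v) h4)
  have hid : ∀ v : TangentSpace (𝓡 d) z, (show E from v) =
      mfderiv 𝓘(ℝ, E) (𝓡 d) e.symm (e z) (mfderiv (𝓡 d) 𝓘(ℝ, E) e z v) := by
    intro v
    refine Eq.trans ?_ (key id hes v)
    exact (congrArg (fun A : E →L[ℝ] E => A v) (mfderiv_id (I := 𝓡 d) (x := z))).symm
  -- In the chart the hypothesis is an identity of pulled-back 1-forms near a point, which can be
  -- differentiated.
  have h1 : pullForm α (fun y => φ (e.symm y)) =ᶠ[𝓝 (e z)] fun y => c • pullForm α e.symm y := by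
    have hev := hφ.eventually_mdifferentiableAt
    filter_upwards [hst.eventually h, hst.eventually hev, hes.eventually_mdifferentiableAt]
      with y hy hyd hyd'
    ext u
    have h2 := mfderiv_comp (I := 𝓘(ℝ, E)) y hyd hyd'
    have h3 := hy (mfderiv 𝓘(ℝ, E) (𝓡 d) e.symm y u)
    exact (congrArg (fun A : E →L[ℝ] E => α (φ (e.symm y)) (A u)) h2).trans h3
  have h2 : fderiv ℝ (pullForm α (fun y => φ (e.symm y))) (e z) =
      c • fderiv ℝ (pullForm α e.symm) (e z) := by
    rw [h1.fderiv_eq]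
    exact fderiv_fun_const_smul ((contDiffAt_pullForm hα hes).differentiableAt (by simp)) c
  set v' : E := mfderiv (𝓡 d) 𝓘(ℝ, E) e z v
  set w' : E := mfderiv (𝓡 d) 𝓘(ℝ, E) e z w
  have h3 := fderiv_pullForm hα hφe v' w'
  have h4 := fderiv_pullForm hα hes v' w'
  have h5 := dForm_congr (α := α) (congrArg φ hez.symm) (key φ hφe v) (key φ hφe w)
  have h6 := dForm_congr (α := α) hez.symm (hid v) (hid w)
  rw [h2] at h3
  refine h5.trans (h3.symm.trans ?_)
  rw [h6, ← h4]
  simp only [ContinuousLinearMap.smul_apply, smul_eq_mul]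
  ring

end PullBack

/-! ### The flow of L scales α and ω. -/

namespace Liouville

variable {d : ℕ} {M : Type*} [TopologicalSpace M] [T2Space M]
  [ChartedSpace (EuclideanSpace ℝ (Fin d)) M]
  [IsManifold (𝓡 d) ∞ M] (S : Liouville d M)

theorem contMDiff_flow_right (t : ℝ) : ContMDiff (𝓡 d) (𝓡 d) ∞ (S.flow t) := by
  have h : ContMDiff (𝓡 d) (𝓘(ℝ, ℝ).prod (𝓡 d)) ∞ (fun z : M => (t, z)) :=
    contMDiff_const.prodMk contMDiff_id
  exact S.contMDiff_flow.comp h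

theorem bijective_mfderiv_flow (t : ℝ) (z : M) :
    Function.Bijective (mfderiv (𝓡 d) (𝓡 d) (S.flow t) z) :=
  bijective_mfderiv_of_leftInverse (ψ := S.flow (-t))
    ((S.contMDiff_flow_right t).mdifferentiable (by simp) z)
    ((S.contMDiff_flow_right (-t)).mdifferentiable (by simp) _)
    (Filter.Eventually.of_forall fun y => S.flow_neg_flow t y)

theorem velocity_flow (t : ℝ) (z : M) : velocity (fun t => S.flow t z) t = S.L (S.flow t z) := by
  have h := (S.flow_integral z t).mfderiv
  refine (congrArg (fun A : ℝ →L[ℝ] EuclideanSpace ℝ (Fin d) => A (1 : ℝ)) h).trans ?_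
  exact one_smul ℝ (show EuclideanSpace ℝ (Fin d) from S.L (S.flow t z))

/-- Since α(L) = 0 and i_L dα = α, Cartan's formula says that the pulled-back form is its own
derivative in t. -/
theorem form_mfderiv_flow (t : ℝ) (z : M) (v : TangentSpace (𝓡 d) z) :
    S.α (S.flow t z) (mfderiv (𝓡 d) (𝓡 d) (S.flow t) z v) = Real.exp t * S.α z v := by
  have hder : ∀ τ, HasDerivAt (fun t => S.α (S.flow t z) (mfderiv (𝓡 d) (𝓡 d) (S.flow t) z v))
      (S.α (S.flow τ z) (mfderiv (𝓡 d) (𝓡 d) (S.flow τ) z v)) τ := by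
    intro τ
    refine (hasDerivAt_form_mfderiv S.smooth_α (Θ := S.flow)
      S.contMDiff_flow.contMDiffAt v).congr_deriv ?_
    have h1 : (fun y => S.α (S.flow τ y) (velocity (fun t => S.flow t y) τ)) = fun _ => 0 := by
      ext y
      rw [S.velocity_flow]
      exact S.α_L _
    have h2 : differential (𝓡 d) (fun _ : M => (0 : ℝ)) z v = 0 :=
      congrArg (fun A : EuclideanSpace ℝ (Fin d) →L[ℝ] ℝ => A v) (mfderiv_const (I := 𝓡 d))
    rw [h1, h2, zero_add, S.velocity_flow]
    exact S.contraction _ _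
  have hder2 : ∀ τ, HasDerivAt (fun τ => Real.exp (-τ) *
      S.α (S.flow τ z) (mfderiv (𝓡 d) (𝓡 d) (S.flow τ) z v)) 0 τ := by
    intro τ
    have h2 : HasDerivAt (fun τ : ℝ => Real.exp (-τ)) (-Real.exp (-τ)) τ := by
      simpa using (hasDerivAt_id τ).neg.exp
    refine (h2.mul (hder τ)).congr_deriv ?_
    ring
  have hc := is_const_of_deriv_eq_zero (fun τ => (hder2 τ).differentiableAt)
    (fun τ => (hder2 τ).deriv) t 0
  have h0 : S.α (S.flow 0 z) (mfderiv (𝓡 d) (𝓡 d) (S.flow 0) z v) = S.α z v := by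
    refine form_congr (S.flow_zero z) ?_
    have h1 : S.flow 0 = id := funext S.flow_zero
    rw [h1]
    exact congrArg (fun A : EuclideanSpace ℝ (Fin d) →L[ℝ] EuclideanSpace ℝ (Fin d) => A v)
      (mfderiv_id (I := 𝓡 d) (x := z))
  simp only [neg_zero, Real.exp_zero, one_mul] at hc
  rw [h0] at hc
  rw [← hc, ← mul_assoc, ← Real.exp_add, add_neg_cancel, Real.exp_zero, one_mul]

theorem symp_mfderiv_flow (t : ℝ) (z : M) (v w : TangentSpace (𝓡 d) z) :
    S.symp (S.flow t z) (mfderiv (𝓡 d) (𝓡 d) (S.flow t) z v) (mfderiv (𝓡 d) (𝓡 d) (S.flow t) z w) =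
      Real.exp t * S.symp z v w :=
  dForm_mfderiv S.smooth_α (S.contMDiff_flow_right t z)
    (Filter.Eventually.of_forall fun y v => S.form_mfderiv_flow t y v) v w

/-- The symplectic gradient of a homogeneous function is invariant under the flow of `L`. -/
theorem IsHomogeneous.mfderiv_flow_sharp {S : Liouville d M} {h : M → ℝ} (hh : S.IsHomogeneous h)
    {z : M} (hz : z ∈ S.star) (t : ℝ)
    (hd : ∀ y ∈ S.star, MDifferentiableAt (𝓡 d) 𝓘(ℝ, ℝ) h y) :
    mfderiv (𝓡 d) (𝓡 d) (S.flow t) z (S.sharp (differential (𝓡 d) h z)) =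
      S.sharp (differential (𝓡 d) h (S.flow t z)) := by
  refine S.eq_of_symp_eq fun w => ?_
  obtain ⟨u, rfl⟩ := (S.bijective_mfderiv_flow t z).2 w
  rw [S.symp_mfderiv_flow, S.symp_sharp, S.symp_sharp]
  have h1 := mfderiv_comp (I := 𝓡 d) z (hd _ (S.flow_mem_star hz t))
    ((S.contMDiff_flow_right t).mdifferentiable (by simp) z)
  have h2 : h ∘ S.flow t =ᶠ[𝓝 z] fun y => Real.exp t • h y := by
    filter_upwards [S.isOpen_star.mem_nhds hz] with y hy
    exact hh.flow y hy t
  have h3 := h2.mfderiv_eq (I := 𝓡 d) (I' := 𝓘(ℝ, ℝ))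
  have h4 := (hd z hz).hasMFDerivAt.const_smul (Real.exp t)
  have h5 := (congrArg (fun A : EuclideanSpace ℝ (Fin d) →L[ℝ] ℝ => A u) (h3.trans h4.mfderiv))
  exact h5.symm.trans (congrArg (fun A : EuclideanSpace ℝ (Fin d) →L[ℝ] ℝ => A u) h1)

end Liouville

/-! ### The Hamiltonian flow of a positive contact Hamiltonian. -/

namespace Liouville

variable {d : ℕ} {M : Type*} [TopologicalSpace M] [T2Space M]
  [ChartedSpace (EuclideanSpace ℝ (Fin d)) M]
  [IsManifold (𝓡 d) ∞ M] {S : Liouville d M} {E : M → ℝ}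

theorem IsContactHamiltonian.contMDiffAt (hE : S.IsContactHamiltonian E) {z : M}
    (hz : z ∈ S.star) : ContMDiffAt (𝓡 d) 𝓘(ℝ, ℝ) ∞ E z :=
  hE.smooth.contMDiffAt (S.isOpen_star.mem_nhds hz)

theorem IsContactHamiltonian.mdifferentiableAt (hE : S.IsContactHamiltonian E) {z : M}
    (hz : z ∈ S.star) : MDifferentiableAt (𝓡 d) 𝓘(ℝ, ℝ) E z :=
  (hE.contMDiffAt hz).mdifferentiableAt (by simp)

theorem contMDiffAt_sharp_differential {h : M → ℝ} {z : M}
    (hh : ContMDiffAt (𝓡 d) 𝓘(ℝ, ℝ) ∞ h z) :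
    ContMDiffAt (𝓡 d) (𝓡 d).tangent ∞
      (fun z => (⟨z, S.sharp (differential (𝓡 d) h z)⟩ : TangentBundle (𝓡 d) M)) z := by
  have h1 := S.contMDiffAt_sgrad (Q := ℝ) (h := fun z _ => h z) (z₀ := z) (q₀ := 0)
    (ContMDiffAt.comp (g := h) (f := Prod.fst) ((z, 0) : M × ℝ) hh contMDiffAt_fst)
  exact ContMDiffAt.comp (g := fun p : M × ℝ => (⟨p.1, S.sharp (differential (𝓡 d) h p.1)⟩ :
    TangentBundle (𝓡 d) M)) (f := fun z => (z, (0 : ℝ))) z h1 contMDiffAt_prodMk_left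

/-- The symplectic gradient of a positive contact Hamiltonian, cut off away from `{E = 1}`, has a
global flow that preserves `E`. -/
theorem exists_cutoff_flow (hE : S.IsContactHamiltonian E) (hE_pos : ∀ z ∈ S.star, 0 < E z) :
    ∃ Φ : ℝ → M → M, (∀ x, Φ 0 x = x) ∧ (∀ s t x, Φ (s + t) x = Φ s (Φ t x)) ∧
      ContMDiff (𝓘(ℝ, ℝ).prod (𝓡 d)) (𝓡 d) ∞ (fun p : ℝ × M => Φ p.1 p.2) ∧
      ∀ z, E z = 1 → ∀ t, E (Φ t z) = 1 ∧ HasMFDerivAt 𝓘(ℝ, ℝ) (𝓡 d) (fun t => Φ t z) t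
        ((1 : ℝ →L[ℝ] ℝ).smulRight (S.sharp (differential (𝓡 d) E (Φ t z)))) := by
  obtain ⟨φ, hφ, hφ1, hφ0, hφ2⟩ := exists_bump (one_pos : (0 : ℝ) < 1) le_rfl
  let X : ∀ x : M, TangentSpace (𝓡 d) x := fun x => φ (E x) • S.sharp (differential (𝓡 d) E x)
  have hX : ContMDiff (𝓡 d) (𝓡 d).tangent ∞ (fun x => (⟨x, X x⟩ : TangentBundle (𝓡 d) M)) := by
    intro x
    by_cases hx : x ∈ S.star
    · refine contMDiffAt_tangent_smul ?_ (contMDiffAt_sharp_differential (hE.contMDiffAt hx))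
      exact ContMDiffAt.comp (g := φ) x hφ.contDiffAt.contMDiffAt (hE.contMDiffAt hx)
    · refine (contMDiffAt_tangent_zero contMDiffAt_id).congr_of_eventuallyEq ?_
      have h0 : E x = 0 := hE.core x (not_not.1 hx)
      have h1 : ∀ᶠ y in 𝓝 x, E y < 1 / 2 :=
        hE.continuous.continuousAt.eventually (gt_mem_nhds (by rw [h0]; norm_num))
      filter_upwards [h1] with y hy
      have : X y = 0 := by
        show φ (E y) • S.sharp (differential (𝓡 d) E y) = 0
        rw [hφ0 _ hy.le, zero_smul]
      rw [this]
      rfl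
  have hX0 : ∀ x ∉ {x | E x ≤ 2}, X x = 0 := by
    intro x hx
    show φ (E x) • S.sharp (differential (𝓡 d) E x) = 0
    have hx' : 2 < E x := not_le.1 hx
    rw [hφ2 _ (by linarith), zero_smul]
  obtain ⟨Φ, h0, hΦ⟩ := exists_flow_of_compact hX
    (isCompact_sublevel hE.isHomogeneous hE.continuous hE_pos 2) hX0
  refine ⟨Φ, h0, ContactSqueezing.flow_add hX h0 hΦ, ContactSqueezing.contMDiff_flow hX h0 hΦ, ?_⟩
  intro z hz
  -- The cut-off field vanishes on the core, so points there are stationary; by uniqueness an orbit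
  -- from {E = 1} never reaches it.
  have hstar : ∀ t, Φ t z ∈ S.star := by
    intro t
    by_contra ht
    have hE0 : E (Φ t z) = 0 := hE.core _ (not_not.1 ht)
    have hX1 : X (Φ t z) = 0 := by
      show φ (E (Φ t z)) • S.sharp (differential (𝓡 d) E (Φ t z)) = 0
      rw [hφ0 _ (by rw [hE0]; norm_num), zero_smul]
    have h1 := integralCurve_unique hX (hΦ z) (isMIntegralCurve_const hX1) (t₀ := t) rfl
    have h2 := congrFun h1 0
    rw [h0] at h2
    rw [← h2, hz] at hE0
    exact one_ne_zero hE0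
  -- Conservation of E is ω(sgrad E, sgrad E) = 0; the cut-off factor does not affect this.
  have hE1 : ∀ t, E (Φ t z) = 1 := by
    have hder : ∀ t, HasDerivAt (fun t => E (Φ t z)) 0 t := by
      intro t
      refine (hasDerivAt_comp_curve (hΦ z t) (hE.mdifferentiableAt (hstar t))).congr_deriv ?_
      show differential (𝓡 d) E (Φ t z)
        (φ (E (Φ t z)) • S.sharp (differential (𝓡 d) E (Φ t z))) = 0
      rw [map_smul, ← S.symp_sharp, symp, dForm_self, smul_zero]
    intro t
    have := is_const_of_deriv_eq_zero (fun t => (hder t).differentiableAt)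
      (fun t => (hder t).deriv) t 0
    rw [this, h0, hz]
  intro t
  refine ⟨hE1 t, ?_⟩
  refine HasMFDerivAt.smulRight_one (hΦ z t) ?_
  show (1 : ℝ) • (φ (E (Φ t z)) • S.sharp (differential (𝓡 d) E (Φ t z))) = _
  rw [one_smul, hE1, hφ1 1 ⟨le_rfl, le_rfl⟩, one_smul]

/-- The flow on `M_*` of a positive contact Hamiltonian. -/
theorem exists_hamiltonianFlow (hE : S.IsContactHamiltonian E) (hE_pos : ∀ z ∈ S.star, 0 < E z) :
    ∃ e : M → ℝ → M, S.IsContactFamily e ∧ (∀ z ∈ S.star, e z 0 = z) ∧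
      (∀ z ∈ S.star, ∀ s t, e (e z s) t = e z (t + s)) ∧ (∀ z ∈ S.star, ∀ t, E (e z t) = E z) ∧
      ∀ w ∈ S.star, ∀ t, S.generator e 1 w t = E w := by
  obtain ⟨Φ, hΦ0, hΦadd, hΦs, hΦ⟩ := exists_cutoff_flow hE hE_pos
  have hh := hE.isHomogeneous
  -- Because sgrad E is invariant under the flow of L, its flow on M_* is determined on {E = 1}:
  -- carry z to this level along L, flow there, and carry the result back by the same time.
  let e : M → ℝ → M := fun z t => S.flow (Real.log (E z)) (Φ t (S.flow (-Real.log (E z)) z))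
  have hlevel : ∀ z ∈ S.star, E (S.flow (-Real.log (E z)) z) = 1 := fun z hz =>
    apply_flow_neg_log hh hE_pos hz
  have hmem1 : ∀ z, E z = 1 → z ∈ S.star := fun z hz =>
    (mem_star_iff_pos hh hE_pos).2 (by rw [hz]; exact one_pos)
  have hΦmem : ∀ z ∈ S.star, ∀ t, Φ t (S.flow (-Real.log (E z)) z) ∈ S.star := fun z hz t =>
    hmem1 _ (hΦ _ (hlevel z hz) t).1
  have hmem : ∀ z ∈ S.star, ∀ t, e z t ∈ S.star := fun z hz t =>
    S.flow_mem_star (hΦmem z hz t) _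
  have hEe : ∀ z ∈ S.star, ∀ t, E (e z t) = E z := by
    intro z hz t
    show E (S.flow (Real.log (E z)) _) = E z
    rw [hh.flow _ (hΦmem z hz t), (hΦ _ (hlevel z hz) t).1, mul_one, Real.exp_log (hE_pos z hz)]
  have he0 : ∀ z ∈ S.star, e z 0 = z := by
    intro z hz
    show S.flow _ (Φ 0 _) = z
    rw [hΦ0, S.flow_flow_neg]
  have headd : ∀ z ∈ S.star, ∀ s t, e (e z s) t = e z (t + s) := by
    intro z hz s t
    show S.flow (Real.log (E (e z s))) (Φ t (S.flow (-Real.log (E (e z s))) (e z s))) = _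
    rw [hEe z hz]
    show S.flow (Real.log (E z)) (Φ t (S.flow (-Real.log (E z))
      (S.flow (Real.log (E z)) (Φ s (S.flow (-Real.log (E z)) z))))) = _
    rw [S.flow_neg_flow, ← hΦadd]
  have hsm : ∀ z ∈ S.star, ∀ t, ContMDiffAt ((𝓡 d).prod 𝓘(ℝ, ℝ)) (𝓡 d) ∞
      (fun p : M × ℝ => e p.1 p.2) (z, t) := by
    intro z hz t
    have h1 : ContMDiffAt ((𝓡 d).prod 𝓘(ℝ, ℝ)) 𝓘(ℝ, ℝ) ∞
        (fun p : M × ℝ => Real.log (E p.1)) (z, t) :=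
      ContMDiffAt.comp (g := Real.log) (f := fun p : M × ℝ => E p.1) (z, t)
        ((Real.contDiffAt_log.2 (hE_pos z hz).ne').contMDiffAt)
        (ContMDiffAt.comp (g := E) (f := Prod.fst) (z, t) (hE.contMDiffAt hz) contMDiffAt_fst)
    have h2 : ContMDiffAt ((𝓡 d).prod 𝓘(ℝ, ℝ)) (𝓡 d) ∞
        (fun p : M × ℝ => S.flow (-Real.log (E p.1)) p.1) (z, t) :=
      ContMDiffAt.comp (g := fun p : ℝ × M => S.flow p.1 p.2)
        (f := fun p : M × ℝ => (-Real.log (E p.1), p.1)) (z, t) S.contMDiff_flow.contMDiffAt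
        (h1.neg.prodMk contMDiffAt_fst)
    have h3 : ContMDiffAt ((𝓡 d).prod 𝓘(ℝ, ℝ)) (𝓡 d) ∞
        (fun p : M × ℝ => Φ p.2 (S.flow (-Real.log (E p.1)) p.1)) (z, t) :=
      ContMDiffAt.comp (g := fun p : ℝ × M => Φ p.1 p.2)
        (f := fun p : M × ℝ => (p.2, S.flow (-Real.log (E p.1)) p.1)) (z, t) hΦs.contMDiffAt
        (contMDiffAt_snd.prodMk h2)
    exact ContMDiffAt.comp (g := fun p : ℝ × M => S.flow p.1 p.2)
        (f := fun p : M × ℝ => (Real.log (E p.1), Φ p.2 (S.flow (-Real.log (E p.1)) p.1))) (z, t)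
        S.contMDiff_flow.contMDiffAt (h1.prodMk h3)
  have hsml : ∀ z ∈ S.star, ∀ t, MDifferentiableAt (𝓡 d) (𝓡 d) (fun z => e z t) z := fun z hz t =>
    (ContMDiffAt.comp (g := fun p : M × ℝ => e p.1 p.2) (f := fun z => (z, t)) z (hsm z hz t)
      contMDiffAt_prodMk_left).mdifferentiableAt (by simp)
  have hvel : ∀ z ∈ S.star, ∀ t, mfderiv 𝓘(ℝ, ℝ) (𝓡 d) (e z) t (1 : ℝ) =
      S.sharp (differential (𝓡 d) E (e z t)) := by
    intro z hz t
    have h1 := (hΦ _ (hlevel z hz) t).2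
    have h2 := ((S.contMDiff_flow_right (Real.log (E z))).mdifferentiable (by simp)
      (Φ t (S.flow (-Real.log (E z)) z))).hasMFDerivAt
    have h3 : HasMFDerivAt 𝓘(ℝ, ℝ) (𝓡 d) (e z) t _ := HasMFDerivAt.comp t h2 h1
    have h4 := congrArg (fun A : ℝ →L[ℝ] EuclideanSpace ℝ (Fin d) => A (1 : ℝ)) h3.mfderiv
    refine h4.trans (Eq.trans ?_ (hh.mfderiv_flow_sharp (hΦmem z hz t) (Real.log (E z))
      fun y hy => hE.mdifferentiableAt hy))
    exact congrArg (mfderiv (𝓡 d) (𝓡 d) (S.flow (Real.log (E z)))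
      (Φ t (S.flow (-Real.log (E z)) z))) (one_smul ℝ _)
  have hαvel : ∀ z ∈ S.star, ∀ t, S.α (e z t) (mfderiv 𝓘(ℝ, ℝ) (𝓡 d) (e z) t (1 : ℝ)) = E z := by
    intro z hz t
    rw [hvel z hz, S.α_sharp, hh.differential_L (hmem z hz t) (hE.mdifferentiableAt (hmem z hz t)),
      hEe z hz]
  have hfam : S.IsContactFamily e := by
    refine ⟨hsm, fun t => ⟨fun z hz => hmem z hz t, ?_, ?_⟩, ?_, ?_⟩
    · intro z hz w hw hzw
      have hzw' : e z t = e w t := hzw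
      have h1 := headd z hz t (-t)
      rw [hzw', headd w hw, neg_add_cancel, he0 w hw, he0 z hz] at h1
      exact h1.symm
    · intro w hw
      refine ⟨e w (-t), hmem w hw _, ?_⟩
      show e (e w (-t)) t = w
      rw [headd w hw, add_neg_cancel, he0 w hw]
    · intro z hz t
      refine bijective_mfderiv_of_leftInverse (ψ := fun z => e z (-t)) (hsml z hz t)
        (hsml _ (hmem z hz t) (-t)) ?_
      filter_upwards [S.isOpen_star.mem_nhds hz] with y hy
      show e (e y t) (-t) = y
      rw [headd y hy, neg_add_cancel, he0 y hy]
    · intro z hz t v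
      let Θ : ℝ → M → M := fun t z => e z t
      -- In Cartan's formula the differential of α(velocity), which is dE, cancels i_velocity ω =
      -- -dE; hence α is preserved.
      have hder : ∀ τ, HasDerivAt (fun t => S.α (Θ t z) (mfderiv (𝓡 d) (𝓡 d) (Θ t) z v)) 0 τ := by
        intro τ
        have hΘ : ContMDiffAt (𝓘(ℝ, ℝ).prod (𝓡 d)) (𝓡 d) ∞ (fun p : ℝ × M => Θ p.1 p.2) (τ, z) :=
          ContMDiffAt.comp (g := fun p : M × ℝ => e p.1 p.2) (f := fun p : ℝ × M => (p.2, p.1))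
            ((τ, z) : ℝ × M) (hsm z hz τ) (contMDiffAt_snd.prodMk contMDiffAt_fst)
        refine (hasDerivAt_form_mfderiv S.smooth_α hΘ v).congr_deriv ?_
        have h1 : (fun y => S.α (Θ τ y) (velocity (fun t => Θ t y) τ)) =ᶠ[𝓝 z] E ∘ Θ τ := by
          filter_upwards [S.isOpen_star.mem_nhds hz] with y hy
          exact (hαvel y hy τ).trans (hEe y hy τ).symm
        have h2 := h1.mfderiv_eq (I := 𝓡 d) (I' := 𝓘(ℝ, ℝ))
        have h3 := mfderiv_comp (I := 𝓡 d) z (hE.mdifferentiableAt (hmem z hz τ)) (hsml z hz τ)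
        have h4 : differential (𝓡 d) (fun y => S.α (Θ τ y) (velocity (fun t => Θ t y) τ)) z v =
            differential (𝓡 d) E (Θ τ z) (mfderiv (𝓡 d) (𝓡 d) (Θ τ) z v) :=
          congrArg (fun A : EuclideanSpace ℝ (Fin d) →L[ℝ] ℝ => A v) (h2.trans h3)
        have h5 : velocity (fun t => Θ t z) τ = S.sharp (differential (𝓡 d) E (Θ τ z)) :=
          hvel z hz τ
        rw [h4, h5, dForm_swap]
        have h6 := S.symp_sharp (differential (𝓡 d) E (Θ τ z)) (mfderiv (𝓡 d) (𝓡 d) (Θ τ) z v)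
        rw [symp] at h6
        rw [h6, add_neg_cancel]
      have hc := is_const_of_deriv_eq_zero (fun τ => (hder τ).differentiableAt)
        (fun τ => (hder τ).deriv) t 0
      refine hc.trans (form_congr (he0 z hz) ?_)
      have h1 : Θ 0 =ᶠ[𝓝 z] id := by
        filter_upwards [S.isOpen_star.mem_nhds hz] with y hy
        exact he0 y hy
      exact congrArg (fun A : EuclideanSpace ℝ (Fin d) →L[ℝ] EuclideanSpace ℝ (Fin d) => A v)
        ((h1.mfderiv_eq (I := 𝓡 d) (I' := 𝓡 d)).trans (mfderiv_id (I := 𝓡 d) (x := z)))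
  refine ⟨e, hfam, he0, headd, hEe, fun w hw t => ?_⟩
  obtain ⟨z, hz, rfl⟩ := (hfam.bijOn t).surjOn hw
  show S.generator e 1 (e z t) t = E (e z t)
  rw [hfam.generator_apply hz, hαvel z hz, hEe z hz]

end Liouville

/-! ### Reparametrization and composition of contact families. -/

namespace Liouville

variable {d : ℕ} {M : Type*} [TopologicalSpace M] [T2Space M]
  [ChartedSpace (EuclideanSpace ℝ (Fin d)) M]
  [IsManifold (𝓡 d) ∞ M] {S : Liouville d M} {E : M → ℝ}

namespace IsContactFamily

variable {Q : Type*} [NormedAddCommGroup Q] [NormedSpace ℝ Q]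
  {Q' : Type*} [NormedAddCommGroup Q'] [NormedSpace ℝ Q']

theorem comp_param {Θ : M → Q → M} (hΘ : S.IsContactFamily Θ) {r : Q' → Q}
    (hr : ContDiff ℝ ∞ r) : S.IsContactFamily (fun z q => Θ z (r q)) := by
  refine ⟨fun z hz q => ?_, fun q => hΘ.bijOn (r q), fun z hz q => hΘ.bijective z hz (r q),
    fun z hz q v => hΘ.form z hz (r q) v⟩
  refine ContMDiffAt.comp (g := fun p : M × Q => Θ p.1 p.2) (f := fun p : M × Q' => (p.1, r p.2))
    (z, q) (hΘ.smooth z hz (r q)) (contMDiffAt_fst.prodMk ?_)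
  exact ContMDiffAt.comp (g := r) (f := Prod.snd) (z, q) hr.contDiffAt.contMDiffAt contMDiffAt_snd

theorem generator_comp_param {Θ : M → Q → M} (hΘ : S.IsContactFamily Θ) {r : Q' → Q}
    (hr : ContDiff ℝ ∞ r) {w : M} (hw : w ∈ S.star) (q ε : Q') :
    S.generator (fun z q => Θ z (r q)) ε w q = S.generator Θ (fderiv ℝ r q ε) w (r q) := by
  have hz := (hΘ.familyInv_spec hw (r q)).1
  exact congrArg (S.α _) (mfderiv_comp_fderiv (ψ := r)
    ((hΘ.contMDiffAt_right hz (r q)).mdifferentiableAt (by simp))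
    (hr.differentiable (by simp) q).hasFDerivAt ε)

theorem generator_smul {Θ : M → Q → M} (c : ℝ) (w : M) (q ε : Q) :
    S.generator Θ (c • ε) w q = c * S.generator Θ ε w q := by
  have h := map_smul (mfderiv 𝓘(ℝ, Q) (𝓡 d) (Θ (S.familyInv Θ w q)) q) c ε
  refine (congrArg (S.α _) h).trans ?_
  exact map_smul (S.α _) c _

theorem comp {Θ Θ' : M → Q → M} (hΘ : S.IsContactFamily Θ) (hΘ' : S.IsContactFamily Θ') :
    S.IsContactFamily (fun z q => Θ' (Θ z q) q) := by
  have hd : ∀ z ∈ S.star, ∀ q, mfderiv (𝓡 d) (𝓡 d) (fun z => Θ' (Θ z q) q) z =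
      (mfderiv (𝓡 d) (𝓡 d) (fun z => Θ' z q) (Θ z q)).comp
        (mfderiv (𝓡 d) (𝓡 d) (fun z => Θ z q) z) := fun z hz q =>
    mfderiv_comp (I := 𝓡 d) z (hΘ'.mdifferentiableAt_left (hΘ.mem_star hz q) q)
      (hΘ.mdifferentiableAt_left hz q)
  refine ⟨fun z hz q => ?_, fun q => (hΘ'.bijOn q).comp (hΘ.bijOn q), fun z hz q => ?_,
    fun z hz q v => ?_⟩
  · exact ContMDiffAt.comp (g := fun p : M × Q => Θ' p.1 p.2)
      (f := fun p : M × Q => (Θ p.1 p.2, p.2)) (z, q)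
      (hΘ'.smooth (Θ z q) (hΘ.mem_star hz q) q) ((hΘ.smooth z hz q).prodMk contMDiffAt_snd)
  · rw [hd z hz]
    exact (hΘ'.bijective _ (hΘ.mem_star hz q) q).comp (hΘ.bijective z hz q)
  · rw [hd z hz]
    exact (hΘ'.form _ (hΘ.mem_star hz q) q _).trans (hΘ.form z hz q v)

/-- The velocity of the composition is the velocity of the outer map plus the push-forward of the
velocity of the inner one. The outer map preserves α, so the second generator enters without a
conformal factor. -/
theorem generator_comp {Θ Θ' : M → Q → M} (hΘ : S.IsContactFamily Θ)
    (hΘ' : S.IsContactFamily Θ') {z : M} (hz : z ∈ S.star) (q ε : Q) :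
    S.generator (fun z q => Θ' (Θ z q) q) ε (Θ' (Θ z q) q) q =
      S.generator Θ' ε (Θ' (Θ z q) q) q + S.generator Θ ε (Θ z q) q := by
  have hz' := hΘ.mem_star hz q
  have h1 : S.generator (fun z q => Θ' (Θ z q) q) ε (Θ' (Θ z q) q) q =
    S.α (Θ' (Θ z q) q) (mfderiv 𝓘(ℝ, Q) (𝓡 d) (fun q => Θ' (Θ z q) q) q ε) :=
      (hΘ.comp hΘ').generator_apply hz q ε
  rw [h1, hΘ'.generator_apply hz', hΘ.generator_apply hz, ← hΘ'.form _ hz', ← map_add]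
  have hm := (hΘ.contMDiffAt_right hz q).mdifferentiableAt (n := ∞) (by simp)
  have h2 : HasMFDerivAt 𝓘(ℝ, Q) ((𝓡 d).prod 𝓘(ℝ, Q)) (fun q => (Θ z q, q)) q
      ((mfderiv 𝓘(ℝ, Q) (𝓡 d) (Θ z) q).prod (ContinuousLinearMap.id ℝ Q)) :=
    hm.hasMFDerivAt.prodMk (hasMFDerivAt_id q)
  have hs := (hΘ'.smooth _ hz' q).mdifferentiableAt (n := ∞) (by simp)
  have h3 := (HasMFDerivAt.comp q (g := fun p : M × Q => Θ' p.1 p.2) (f := fun q => (Θ z q, q))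
    hs.hasMFDerivAt h2).mfderiv
  have h4 := congrArg (fun A : Q →L[ℝ] EuclideanSpace ℝ (Fin d) => A ε) h3
  have h5 := mfderiv_prod_eq_add_apply (v := ((mfderiv 𝓘(ℝ, Q) (𝓡 d) (Θ z) q ε, ε) :
    TangentSpace ((𝓡 d).prod 𝓘(ℝ, Q)) (Θ z q, q))) hs
  refine congrArg (S.α _) ((h4.trans h5).trans ?_)
  exact add_comm (G := EuclideanSpace ℝ (Fin d)) _ _

theorem generator_eq_zero {Θ : M → Q → M} (hΘ : S.IsContactFamily Θ) {q ε : Q}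
    (h : ∀ z ∈ S.star, ∀ᶠ τ in 𝓝 (0 : ℝ), Θ z (q + τ • ε) = Θ z q) {w : M} (hw : w ∈ S.star) :
    S.generator Θ ε w q = 0 := by
  obtain ⟨z, hz, rfl⟩ := (hΘ.bijOn q).surjOn hw
  show S.generator Θ ε (Θ z q) q = 0
  rw [hΘ.generator_apply hz]
  have h0 : q + (0 : ℝ) • ε = q := by simp
  have hm : MDifferentiableAt 𝓘(ℝ, Q) (𝓡 d) (Θ z) (q + (0 : ℝ) • ε) :=
    (hΘ.contMDiffAt_right hz _).mdifferentiableAt (by simp)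
  have h1 := mfderiv_comp_fderiv (u := Θ z) (ψ := fun τ : ℝ => q + τ • ε) hm
    (hasDerivAt_line q ε 0).hasFDerivAt (1 : ℝ)
  have h2 : (fun τ : ℝ => Θ z (q + τ • ε)) =ᶠ[𝓝 0] fun _ => Θ z q := h z hz
  have h3 : mfderiv 𝓘(ℝ, ℝ) (𝓡 d) (fun τ : ℝ => Θ z (q + τ • ε)) 0 (1 : ℝ) = 0 :=
    (congrArg (fun A : ℝ →L[ℝ] EuclideanSpace ℝ (Fin d) => A (1 : ℝ))
      (h2.mfderiv_eq (I := 𝓘(ℝ, ℝ)) (I' := 𝓡 d))).trans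
      (congrArg (fun A : ℝ →L[ℝ] EuclideanSpace ℝ (Fin d) => A (1 : ℝ))
        (mfderiv_const (I := 𝓘(ℝ, ℝ))))
  have h4 : mfderiv 𝓘(ℝ, Q) (𝓡 d) (Θ z) q ε = 0 := by
    have h5 := h1.symm.trans h3
    have h6 : (ContinuousLinearMap.toSpanSingleton ℝ ε) (1 : ℝ) = ε := one_smul ℝ ε
    rw [h6] at h5
    rwa [h0] at h5
  rw [h4]
  exact map_zero _

end IsContactFamily

end Liouville

/-! ### Loops of contactomorphisms as contact families. -/

namespace Liouville

variable {d : ℕ} {M : Type*} [TopologicalSpace M] [T2Space M]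
  [ChartedSpace (EuclideanSpace ℝ (Fin d)) M]
  [IsManifold (𝓡 d) ∞ M] {S : Liouville d M} {E : M → ℝ}

namespace IsEquivariantSymplecto

variable {φ : M → M} (hφ : S.IsEquivariantSymplecto φ)
include hφ

theorem contMDiffAt {z : M} (hz : z ∈ S.star) : ContMDiffAt (𝓡 d) (𝓡 d) ∞ φ z :=
  hφ.smooth.contMDiffAt (S.isOpen_star.mem_nhds hz)

theorem bijective_mfderiv {z : M} (hz : z ∈ S.star) :
    Function.Bijective (mfderiv (𝓡 d) (𝓡 d) φ z) := by
  suffices h : Function.Injective (mfderiv (𝓡 d) (𝓡 d) φ z) from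
    bijective_of_injective (E := EuclideanSpace ℝ (Fin d)) (mfderiv (𝓡 d) (𝓡 d) φ z) h
  rw [injective_iff_map_eq_zero]
  intro v hv
  refine S.nondegenerate z v fun w => ?_
  have h1 := hφ.symplectic z hz v w
  rw [symp, symp] at h1
  rw [← h1]
  have h2 : mfderiv (𝓡 d) (𝓡 d) φ z v = (0 : ℝ) • (0 : TangentSpace (𝓡 d) (φ z)) :=
    hv.trans (smul_zero _).symm
  rw [h2, dForm_smul_left, zero_mul]

/-- Equivariance says that φ intertwines the flow of L with itself; this is its infinitesimal form.
-/
theorem mfderiv_L {z : M} (hz : z ∈ S.star) :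
    mfderiv (𝓡 d) (𝓡 d) φ z (S.L z) = S.L (φ z) := by
  have h1 : (fun t => φ (S.flow t z)) = fun t => S.flow t (φ z) := by
    ext t
    simpa using hφ.equivariant z hz (Real.exp t) (Real.exp_pos t)
  have hm : MDifferentiableAt (𝓡 d) (𝓡 d) φ (S.flow 0 z) := by
    rw [S.flow_zero]
    exact (hφ.contMDiffAt hz).mdifferentiableAt (by simp)
  have h2 : HasMFDerivAt 𝓘(ℝ, ℝ) (𝓡 d) (fun t => φ (S.flow t z)) 0 _ :=
    HasMFDerivAt.comp (0 : ℝ) hm.hasMFDerivAt (S.flow_integral z 0)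
  have h3 := congrArg (fun A : ℝ →L[ℝ] EuclideanSpace ℝ (Fin d) => A (1 : ℝ)) h2.mfderiv
  have h4 : mfderiv 𝓘(ℝ, ℝ) (𝓡 d) (fun t => S.flow t (φ z)) 0 (1 : ℝ) = S.L (S.flow 0 (φ z)) :=
    S.velocity_flow 0 (φ z)
  rw [h1] at h3
  have h5 := h3.symm.trans h4
  have h6 : mfderiv (𝓡 d) (𝓡 d) φ (S.flow 0 z) ((1 : ℝ) • S.L (S.flow 0 z)) =
    S.L (S.flow 0 (φ z)) := h5
  rw [one_smul, S.flow_zero, S.flow_zero] at h6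
  exact h6

/-- The form α = i_L ω is built from L and ω, both of which φ preserves. -/
theorem form {z : M} (hz : z ∈ S.star) (v : TangentSpace (𝓡 d) z) :
    S.α (φ z) (mfderiv (𝓡 d) (𝓡 d) φ z v) = S.α z v := by
  rw [← S.contraction, ← S.contraction, ← hφ.mfderiv_L hz]
  exact hφ.symplectic z hz _ _

end IsEquivariantSymplecto

namespace IsLoopHomotopy

variable {f : ℝ → ℝ → M → M} (hf : S.IsLoopHomotopy f)
include hf

/-- Reparametrization by functions on all of Q, with σ valued in [0,1], turns smoothness over the
closed interval into smoothness at every parameter. -/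
theorem isContactFamily {Q : Type*} [NormedAddCommGroup Q] [NormedSpace ℝ Q] {χ σ : Q → ℝ}
    (hχ : ContDiff ℝ ∞ χ) (hσ : ContDiff ℝ ∞ σ) (hσI : ∀ q, σ q ∈ Icc (0 : ℝ) 1) :
    S.IsContactFamily (fun z q => f (χ q) (σ q) z) := by
  have hs := fun q => hf.symplecto (χ q) (σ q) (hσI q)
  refine ⟨fun z hz q => ?_, fun q => (hs q).bijOn, fun z hz q => (hs q).bijective_mfderiv hz,
    fun z hz q v => (hs q).form hz v⟩
  have h1 : ContMDiff ((𝓡 d).prod 𝓘(ℝ, Q)) (𝓘(ℝ, ℝ).prod (𝓘(ℝ, ℝ).prod (𝓡 d))) ∞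
      (fun p : M × Q => (χ p.2, σ p.2, p.1)) :=
    (hχ.contMDiff.comp contMDiff_snd).prodMk ((hσ.contMDiff.comp contMDiff_snd).prodMk
      contMDiff_fst)
  have h2 : ContMDiffOn ((𝓡 d).prod 𝓘(ℝ, Q)) (𝓡 d) ∞ (fun p : M × Q => f (χ p.2) (σ p.2) p.1)
      (S.star ×ˢ univ) :=
    ContMDiffOn.comp (g := fun q : ℝ × ℝ × M => f q.1 q.2.1 q.2.2)
      (f := fun p : M × Q => (χ p.2, σ p.2, p.1)) hf.smooth h1.contMDiffOn
      fun p hp => ⟨mem_univ _, hσI p.2, hp.1⟩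
  exact h2.contMDiffAt ((S.isOpen_star.prod isOpen_univ).mem_nhds ⟨hz, mem_univ _⟩)

variable {F : ℝ → ℝ → M → ℝ} (hF : ∀ s ∈ Icc (0 : ℝ) 1, S.Generates (F s) (fun t => f t s))
include hF

/-- Pairing the generating equation with L gives α(velocity) = dF(L), and this is F by Euler's
identity. -/
theorem form_velocity {s : ℝ} (hs : s ∈ Icc (0 : ℝ) 1) (t : ℝ) {z : M} (hz : z ∈ S.star) :
    S.α (f t s z) (mfderiv 𝓘(ℝ, ℝ) (𝓡 d) (fun τ => f τ s z) t (1 : ℝ)) = F s t (f t s z) := by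
  obtain ⟨h1, h2⟩ := hF s hs t
  have hm : f t s z ∈ S.star := (hf.symplecto t s hs).bijOn.mapsTo hz
  have h3 : S.symp (f t s z) (S.L (f t s z))
      (mfderiv 𝓘(ℝ, ℝ) (𝓡 d) (fun τ => f τ s z) t (1 : ℝ)) =
      differential (𝓡 d) (F s t) (f t s z) (S.L (f t s z)) := h2 z hz (S.L (f t s z))
  rw [← S.contraction]
  exact h3.trans (h1.isHomogeneous.differential_L hm (h1.mdifferentiableAt hm))

/-- The generator of the reparametrized homotopy in a direction that only changes the time. -/
theorem generator_eq {χ σ : ℝ → ℝ} (hχ : ContDiff ℝ ∞ χ) (hσ : ContDiff ℝ ∞ σ)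
    (hσI : ∀ q, σ q ∈ Icc (0 : ℝ) 1) {w : M} (hw : w ∈ S.star) (t s : ℝ) :
    S.generator (fun z (q : ℝ × ℝ) => f (χ q.1) (σ q.2) z) (1, 0) w (t, s) =
      deriv χ t * F (σ s) (χ t) w := by
  have hfam := hf.isContactFamily (Q := ℝ × ℝ) (χ := fun q => χ q.1) (σ := fun q => σ q.2)
    (hχ.comp contDiff_fst) (hσ.comp contDiff_snd) (fun q => hσI q.2)
  obtain ⟨z, hz, rfl⟩ := (hfam.bijOn (t, s)).surjOn hw
  rw [hfam.generator_apply hz]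
  show S.α (f (χ t) (σ s) z) _ = deriv χ t * F (σ s) (χ t) (f (χ t) (σ s) z)
  rw [← hf.form_velocity hF (hσI s) (χ t) hz]
  have h1 := mfderiv_comp_fderiv (u := fun q : ℝ × ℝ => f (χ q.1) (σ q.2) z)
    (ψ := fun τ : ℝ => (τ, s)) ((hfam.contMDiffAt_right hz (t, s)).mdifferentiableAt (by simp))
    (hasFDerivAt_prodMk_left t s) (1 : ℝ)
  have hc := hf.isContactFamily (Q := ℝ) (χ := id) (σ := fun _ => σ s)
    contDiff_id contDiff_const (fun _ => hσI s)
  have h2 := mfderiv_comp_fderiv (u := fun t => f t (σ s) z) (ψ := χ)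
    ((hc.contMDiffAt_right hz (χ t)).mdifferentiableAt (by simp))
    (hχ.differentiable (by simp) t).hasDerivAt.hasFDerivAt (1 : ℝ)
  have h3 := h1.symm.trans h2
  refine (congrArg (S.α (f (χ t) (σ s) z)) h3).trans ?_
  have h4 : (ContinuousLinearMap.toSpanSingleton ℝ (deriv χ t)) (1 : ℝ) = deriv χ t • (1 : ℝ) := by
    simp
  rw [h4]
  have h5 := map_smul (mfderiv 𝓘(ℝ, ℝ) (𝓡 d) (fun t => f t (σ s) z) (χ t)) (deriv χ t) (1 : ℝ)
  refine (congrArg (S.α (f (χ t) (σ s) z)) h5).trans ?_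
  exact map_smul (S.α (f (χ t) (σ s) z)) _ _

theorem eq_zero_of_zero (t : ℝ) {z : M} (hz : z ∈ S.star) : F 0 t z = 0 := by
  have h0 : (0 : ℝ) ∈ Icc (0 : ℝ) 1 := ⟨le_rfl, zero_le_one⟩
  have h1 := hf.form_velocity hF h0 t hz
  have h2 : (fun τ => f τ 0 z) = fun _ => z := funext fun τ => hf.constant τ z hz
  have h3 : mfderiv 𝓘(ℝ, ℝ) (𝓡 d) (fun τ => f τ 0 z) t (1 : ℝ) = 0 := by
    rw [h2]
    exact congrArg (fun A : ℝ →L[ℝ] EuclideanSpace ℝ (Fin d) => A (1 : ℝ))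
      (mfderiv_const (I := 𝓘(ℝ, ℝ)))
  rw [h3, map_zero, hf.constant t z hz] at h1
  exact h1.symm

/-- The quotient F_1/E has degree zero, so it is enough to bound F_1 from below on the compact set
{E = 1} × [0,1], where it is positive. -/
theorem exists_le (hE : S.IsContactHamiltonian E) (hE_pos : ∀ z ∈ S.star, 0 < E z)
    (hF_pos : ∀ t, ∀ z ∈ S.star, 0 < F 1 t z) :
    ∃ γ > 0, ∀ t ∈ Icc (0 : ℝ) 1, ∀ z ∈ S.star, γ * E z ≤ F 1 t z := by
  have h1 : (1 : ℝ) ∈ Icc (0 : ℝ) 1 := ⟨zero_le_one, le_rfl⟩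
  have hfam := hf.isContactFamily (Q := ℝ) (χ := id) (σ := fun _ => 1)
    contDiff_id contDiff_const (fun _ => h1)
  have hgen : ∀ t, ∀ w ∈ S.star, S.generator (fun z t => f (id t) 1 z) 1 w t = F 1 t w := by
    intro t w hw
    obtain ⟨z, hz, rfl⟩ := (hfam.bijOn t).surjOn hw
    exact (hfam.generator_apply hz t 1).trans (hf.form_velocity hF h1 t hz)
  -- Joint continuity of F_1 in z and t is not part of its definition; it follows because F_1 is the
  -- generator of a smooth family.
  have hcont : ContinuousOn (fun p : M × ℝ => F 1 p.2 p.1) ({z | E z = 1} ×ˢ Icc 0 1) := by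
    have h2 : ContinuousOn (fun p : M × ℝ => S.generator (fun z t => f (id t) 1 z) 1 p.1 p.2)
        ({z | E z = 1} ×ˢ Icc 0 1) := fun p hp =>
      (hfam.contMDiffAt_generator 1 ((mem_star_iff_pos hE.isHomogeneous hE_pos).2
        (by rw [show E p.1 = 1 from hp.1]; exact one_pos)) p.2).continuousAt.continuousWithinAt
    refine h2.congr fun p hp => (hgen p.2 p.1 ?_).symm
    exact (mem_star_iff_pos hE.isHomogeneous hE_pos).2
      (by rw [show E p.1 = 1 from hp.1]; exact one_pos)
  have hK : IsCompact ({z | E z = 1} ×ˢ Icc (0 : ℝ) 1) := by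
    refine IsCompact.prod ?_ isCompact_Icc
    exact (isCompact_sublevel hE.isHomogeneous hE.continuous hE_pos 1).of_isClosed_subset
      (isClosed_eq hE.continuous continuous_const) fun z hz => le_of_eq hz
  obtain ⟨γ, hγ, hle⟩ : ∃ γ > 0, ∀ p ∈ ({z | E z = 1} ×ˢ Icc (0 : ℝ) 1), γ ≤ F 1 p.2 p.1 := by
    rcases ({z | E z = 1} ×ˢ Icc (0 : ℝ) 1).eq_empty_or_nonempty with he | hne
    · exact ⟨1, one_pos, fun p hp => by rw [he] at hp; exact absurd hp (notMem_empty p)⟩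
    · obtain ⟨p₀, hp₀, hmin⟩ := hK.exists_isMinOn hne hcont
      refine ⟨F 1 p₀.2 p₀.1, hF_pos _ _ ?_, fun p hp => hmin hp⟩
      exact (mem_star_iff_pos hE.isHomogeneous hE_pos).2
        (by rw [show E p₀.1 = 1 from hp₀.1]; exact one_pos)
  refine ⟨γ, hγ, fun t ht z hz => ?_⟩
  have h2 := hle (S.flow (-Real.log (E z)) z, t)
    ⟨apply_flow_neg_log hE.isHomogeneous hE_pos hz, ht⟩
  have h3 := (hF 1 h1 t).1.isHomogeneous.flow z hz (-Real.log (E z))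
  have h4 : γ ≤ Real.exp (-Real.log (E z)) * F 1 t z := by rw [← h3]; exact h2
  rw [Real.exp_neg, Real.exp_log (hE_pos z hz)] at h4
  have h5 := mul_le_mul_of_nonneg_left h4 (hE_pos z hz).le
  rwa [← mul_assoc, mul_inv_cancel₀ (hE_pos z hz).ne', one_mul, mul_comm] at h5

end IsLoopHomotopy

end Liouville

/-- Make a function of `q = (t, s)` periodic in `t`. -/
noncomputable def periodize {A B : Type*} (X : A → ℝ × ℝ → B) (z : A) (q : ℝ × ℝ) : B :=
  X z (Int.fract q.1, q.2)

theorem periodize_add_one {A B : Type*} (X : A → ℝ × ℝ → B) (z : A) (t s : ℝ) :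
    periodize X z (t + 1, s) = periodize X z (t, s) := by
  simp [periodize]

/-- Locally a periodization is an integer translate of the original function, so smoothness and
differential identities pass to it. The hypothesis supplies the matching across the jump of the
fractional part. -/
theorem periodize_eventually_eq {A B : Type*} {X : A → ℝ × ℝ → B} {C : Set A}
    (h : ∀ z ∈ C, ∀ t s : ℝ, |t| < 1 / 3 → X z (t + 1, s) = X z (t, s)) (q₀ : ℝ × ℝ) :
    ∀ᶠ q in 𝓝 q₀, ∀ z ∈ C, periodize X z q = X z (q - ((⌊q₀.1 + 1 / 6⌋ : ℝ), 0)) := by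
  -- The shift by 1/6 puts q₀.1 - n in [-1/6, 5/6), so nearby times have t - n in (-1/3, 1), where
  -- the fractional part is t - n or t - n + 1.
  set n := ⌊q₀.1 + 1 / 6⌋
  have h1 : (n : ℝ) ≤ q₀.1 + 1 / 6 := Int.floor_le _
  have h2 : q₀.1 + 1 / 6 < n + 1 := Int.lt_floor_add_one _
  have h3 : ∀ᶠ q : ℝ × ℝ in 𝓝 q₀, (n : ℝ) - 1 / 3 < q.1 :=
    continuousAt_fst (lt_mem_nhds (by linarith))
  have h4 : ∀ᶠ q : ℝ × ℝ in 𝓝 q₀, q.1 < n + 1 := continuousAt_fst (gt_mem_nhds (by linarith))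
  filter_upwards [h3, h4] with q hq hq' z hz
  have hsub : q - ((n : ℝ), (0 : ℝ)) = (q.1 - n, q.2) := by ext <;> simp
  rw [hsub, periodize]
  by_cases h0 : (n : ℝ) ≤ q.1
  · rw [show Int.fract q.1 = q.1 - n from
      Int.fract_eq_iff.2 ⟨by linarith, by linarith, n, by ring⟩]
  · push Not at h0
    rw [show Int.fract q.1 = q.1 - n + 1 from
      Int.fract_eq_iff.2 ⟨by linarith, by linarith, n - 1, by push_cast; ring⟩]
    exact h z hz _ _ (abs_lt.2 ⟨by linarith, by linarith⟩)

/-! ### Profiles in time and in the deformation parameter. -/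

section Profiles

open Real

theorem smoothTransition_scaled_contDiff (a b : ℝ) :
    ContDiff ℝ ∞ (fun t => smoothTransition (a * t - b)) :=
  Real.smoothTransition.contDiff.comp ((contDiff_const.mul contDiff_id).sub contDiff_const)

/-- The time profile: `0` for `t ≤ 1/3`, `1` for `t ≥ 2/3`. -/
noncomputable def step (t : ℝ) : ℝ := smoothTransition (3 * t - 1)

theorem step_contDiff : ContDiff ℝ ∞ step := smoothTransition_scaled_contDiff 3 1

theorem step_mem (t : ℝ) : step t ∈ Icc (0 : ℝ) 1 :=
  ⟨smoothTransition.nonneg _, smoothTransition.le_one _⟩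

theorem step_of_le {t : ℝ} (h : t ≤ 1 / 3) : step t = 0 :=
  smoothTransition.zero_of_nonpos (by linarith)

theorem step_of_ge {t : ℝ} (h : 2 / 3 ≤ t) : step t = 1 :=
  smoothTransition.one_of_one_le (by linarith)

theorem deriv_step_nonneg (t : ℝ) : 0 ≤ deriv step t :=
  Monotone.deriv_nonneg fun a b h => smoothTransition.monotone (by linarith)

/-- The speed profile: it moves from `0` to `-μ` on `[0, 1/3]` and from `-μ` to `γ` on
`[2/3, 1]`. -/
noncomputable def speed (μ γ s : ℝ) : ℝ :=
  -μ * smoothTransition (3 * s - 0) + (μ + γ) * smoothTransition (3 * s - 2)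

theorem speed_contDiff (μ γ : ℝ) : ContDiff ℝ ∞ (speed μ γ) :=
  (contDiff_const.mul (smoothTransition_scaled_contDiff 3 0)).add
    (contDiff_const.mul (smoothTransition_scaled_contDiff 3 2))

variable {μ γ s : ℝ}

theorem speed_of_nonpos (h : s ≤ 0) : speed μ γ s = 0 := by
  rw [speed, smoothTransition.zero_of_nonpos (by linarith),
    smoothTransition.zero_of_nonpos (by linarith)]
  ring

theorem speed_of_one_le (h : 1 ≤ s) : speed μ γ s = γ := by
  rw [speed, smoothTransition.one_of_one_le (by linarith),
    smoothTransition.one_of_one_le (by linarith)]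
  ring

/-- The pointwise estimate behind the lower bound for the deformed Hamiltonian. -/
theorem neg_le_speed {κ e φ : ℝ} (hμ : 0 < μ) (hγ : 0 < γ) (hκ : 0 ≤ κ) (he : 0 ≤ e)
    (h0 : s ≤ 1 / 3 → φ = 0) (h1 : -μ * e ≤ φ) (h2 : 2 / 3 ≤ s → γ * e ≤ φ) :
    -μ * e ≤ speed μ γ s * (1 - κ) * e + κ * φ := by
  have ha := smoothTransition.nonneg (3 * s - 0)
  have hb := smoothTransition.le_one (3 * s - 0)
  have ha' := smoothTransition.nonneg (3 * s - 2)
  have hb' := smoothTransition.le_one (3 * s - 2)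
  have hκe := mul_nonneg hκ he
  -- The derivative κ of the step may exceed 1, so speed and loop must not change together. For s ≤
  -- 1/3 the loop is constant; up to 2/3 the speed is -μ and only φ ≥ -μe is needed; afterwards the
  -- loop is the final one, and φ ≥ γe makes up for every speed between -μ and γ.
  rcases le_total s (1 / 3) with h | h
  · have h3 : speed μ γ s = -μ * smoothTransition (3 * s - 0) := by
      rw [speed, smoothTransition.zero_of_nonpos (x := 3 * s - 2) (by linarith)]
      ring
    rw [h3, h0 h]
    set x := smoothTransition (3 * s - 0)
    have h4 : 0 ≤ μ * (1 - x) * e := mul_nonneg (mul_nonneg hμ.le (by linarith)) he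
    have h5 : 0 ≤ μ * x * (κ * e) := mul_nonneg (mul_nonneg hμ.le ha) hκe
    nlinarith
  have h3 : smoothTransition (3 * s - 0) = 1 := smoothTransition.one_of_one_le (by linarith)
  rcases le_total s (2 / 3) with h' | h'
  · have h4 : speed μ γ s = -μ := by
      rw [speed, h3, smoothTransition.zero_of_nonpos (x := 3 * s - 2) (by linarith)]
      ring
    rw [h4]
    nlinarith [mul_le_mul_of_nonneg_left h1 hκ]
  · rw [speed, h3]
    set x := smoothTransition (3 * s - 2)
    have h4 : 0 ≤ (μ + γ) * x * e := mul_nonneg (mul_nonneg (by linarith) ha') he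
    have h5 : 0 ≤ (μ + γ) * (1 - x) * (κ * e) :=
      mul_nonneg (mul_nonneg (by linarith) (by linarith)) hκe
    nlinarith [mul_le_mul_of_nonneg_left (h2 h') hκ]

end Profiles

/-! ### Deformations of E/R and periodization in time. -/

namespace Liouville

variable {d : ℕ} {M : Type*} [TopologicalSpace M] [T2Space M]
  [ChartedSpace (EuclideanSpace ℝ (Fin d)) M]
  [IsManifold (𝓡 d) ∞ M] (S : Liouville d M)

/-- A homotopy `H(·, t, s)`, `s ∈ [0,1]`, of 1-periodic contact Hamiltonians that starts at `E / R`,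
and a solution `K` of the zero-curvature equation. -/
structure IsDeformation (E : M → ℝ) (R μ γ : ℝ) (H K : M → ℝ × ℝ → ℝ) : Prop where
  smooth_left : ∀ z ∈ S.star, ∀ q, ContMDiffAt ((𝓡 d).prod 𝓘(ℝ, ℝ × ℝ)) 𝓘(ℝ, ℝ) ∞
    (fun p : M × (ℝ × ℝ) => H p.1 p.2) (z, q)
  smooth_right : ∀ z ∈ S.star, ∀ q, ContMDiffAt ((𝓡 d).prod 𝓘(ℝ, ℝ × ℝ)) 𝓘(ℝ, ℝ) ∞
    (fun p : M × (ℝ × ℝ) => K p.1 p.2) (z, q)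
  homogeneous : ∀ q, S.IsHomogeneous (fun z => H z q)
  differential_right : ∀ z ∈ S.star, ∀ q,
    differential (𝓡 d) (fun z => K z q) z (S.L z) = K z q
  periodic_left : ∀ z t s, H z (t + 1, s) = H z (t, s)
  periodic_right : ∀ z t s, K z (t + 1, s) = K z (t, s)
  curvature : ∀ z ∈ S.star, ∀ q, fderiv ℝ (H z) q (0, 1) - fderiv ℝ (K z) q (1, 0) +
    differential (𝓡 d) (fun z => H z q) z
      (S.sharp (differential (𝓡 d) (fun z => K z q) z)) = 0
  start : ∀ z t, H z (t, 0) = E z / R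
  lower : ∀ z t, ∀ s ∈ Icc (0 : ℝ) 1, (1 / R - μ) * E z ≤ H z (t, s)
  final : ∀ z t, (1 / R + γ) * E z ≤ H z (t, 1)
  support : ∀ z ∈ S.star, ∀ q : ℝ × ℝ, q.2 < 0 ∨ 1 < q.2 → K z q = 0

variable {S}

theorem differential_congr {h h' : M → ℝ} {z : M} (hh : h =ᶠ[𝓝 z] h') :
    differential (𝓡 d) h z = differential (𝓡 d) h' z := by
  ext v
  exact congrArg (fun A : EuclideanSpace ℝ (Fin d) →L[ℝ] ℝ => A v)
    (hh.mfderiv_eq (I := 𝓡 d) (I' := 𝓘(ℝ, ℝ)))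

section Periodize

variable {X : M → ℝ × ℝ → ℝ} {Y : M → ℝ × ℝ → ℝ}
  (h : ∀ z ∈ S.star, ∀ t s : ℝ, |t| < 1 / 3 → X z (t + 1, s) = X z (t, s))
  (hY : ∀ z ∈ S.star, ∀ q, Y z q = periodize X z q)
include h hY

/-- The periodization of `X` is locally a translate of `X`. -/
theorem periodize_local (q₀ : ℝ × ℝ) {n : ℤ} (hn₀ : n = ⌊q₀.1 + 1 / 6⌋) :
    (∀ z ∈ S.star, (fun p : M × (ℝ × ℝ) => Y p.1 p.2) =ᶠ[𝓝 (z, q₀)]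
      fun p => X p.1 (p.2 - ((n : ℝ), 0))) ∧
    (∀ z ∈ S.star, fderiv ℝ (Y z) q₀ = fderiv ℝ (X z) (q₀ - ((n : ℝ), 0))) ∧
    (∀ z ∈ S.star, Y z q₀ = X z (q₀ - ((n : ℝ), 0))) ∧
    ∀ z ∈ S.star, differential (𝓡 d) (fun z => Y z q₀) z =
      differential (𝓡 d) (fun z => X z (q₀ - ((n : ℝ), 0))) z := by
  have hn := periodize_eventually_eq h q₀
  rw [← hn₀] at hn
  refine ⟨fun z hz => ?_, fun z hz => ?_, fun z hz => ?_, fun z hz => ?_⟩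
  · rw [Filter.EventuallyEq, nhds_prod_eq]
    have h1 : ∀ᶠ y in 𝓝 z, y ∈ S.star := S.isOpen_star.mem_nhds hz
    filter_upwards [h1.prod_mk hn] with p hp
    rw [hY _ hp.1, hp.2 _ hp.1]
  · have h1 : Y z =ᶠ[𝓝 q₀] fun q => X z (q - ((n : ℝ), 0)) := by
      filter_upwards [hn] with q hq
      rw [hY z hz, hq z hz]
    rw [h1.fderiv_eq]
    exact fderiv_comp_sub (f := X z) ((n : ℝ), (0 : ℝ))
  · rw [hY z hz, hn.self_of_nhds z hz]
  · refine differential_congr ?_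
    filter_upwards [S.isOpen_star.mem_nhds hz] with y hy
    rw [hY y hy, hn.self_of_nhds y hy]

theorem contMDiffAt_periodize {z : M} (hz : z ∈ S.star) (q : ℝ × ℝ)
    (hX : ∀ q, ContMDiffAt ((𝓡 d).prod 𝓘(ℝ, ℝ × ℝ)) 𝓘(ℝ, ℝ) ∞
      (fun p : M × (ℝ × ℝ) => X p.1 p.2) (z, q)) :
    ContMDiffAt ((𝓡 d).prod 𝓘(ℝ, ℝ × ℝ)) 𝓘(ℝ, ℝ) ∞
      (fun p : M × (ℝ × ℝ) => Y p.1 p.2) (z, q) := by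
  have hn := (periodize_local h hY q rfl).1
  set n := ⌊q.1 + 1 / 6⌋
  refine ContMDiffAt.congr_of_eventuallyEq ?_ (hn z hz)
  refine ContMDiffAt.comp (g := fun p : M × (ℝ × ℝ) => X p.1 p.2)
    (f := fun p : M × (ℝ × ℝ) => (p.1, p.2 - ((n : ℝ), (0 : ℝ)))) (z, q) (hX _)
    (contMDiffAt_fst.prodMk ?_)
  exact ContMDiffAt.comp (g := fun q : ℝ × ℝ => q - ((n : ℝ), (0 : ℝ))) (f := Prod.snd) (z, q)
    ((contDiff_id.sub contDiff_const).contDiffAt.contMDiffAt) contMDiffAt_snd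

end Periodize

end Liouville

/-! ### Construction of the deformation from the homotopy of loops. -/

namespace Liouville

variable {d : ℕ} {M : Type*} [TopologicalSpace M] [T2Space M]
  [ChartedSpace (EuclideanSpace ℝ (Fin d)) M]
  [IsManifold (𝓡 d) ∞ M] {S : Liouville d M} {E : M → ℝ}

/-- Composing a family with the Hamiltonian flow of `E`, run for the time `a`. -/
theorem generator_hamiltonianFlow_comp {Q : Type*} [NormedAddCommGroup Q] [NormedSpace ℝ Q]
    {e : M → ℝ → M} (he : S.IsContactFamily e) (he0 : ∀ z ∈ S.star, e z 0 = z)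
    (headd : ∀ z ∈ S.star, ∀ s t, e (e z s) t = e z (t + s))
    (hgen : ∀ w ∈ S.star, ∀ t, S.generator e 1 w t = E w)
    {Θ : M → Q → M} (hΘ : S.IsContactFamily Θ) {a : Q → ℝ} (ha : ContDiff ℝ ∞ a)
    {w : M} (hw : w ∈ S.star) (q ε : Q) :
    S.generator (fun z q => e (Θ z q) (a q)) ε w q =
      fderiv ℝ a q ε * E w + S.generator Θ ε (e w (-a q)) q := by
  have he' := he.comp_param ha
  obtain ⟨z, hz, rfl⟩ := ((hΘ.comp he').bijOn q).surjOn hw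
  have hz' := hΘ.mem_star hz q
  show S.generator (fun z q => e (Θ z q) (a q)) ε (e (Θ z q) (a q)) q =
    fderiv ℝ a q ε * E (e (Θ z q) (a q)) + S.generator Θ ε (e (e (Θ z q) (a q)) (-a q)) q
  rw [headd _ hz', neg_add_cancel, he0 _ hz', hΘ.generator_comp he' hz,
    he.generator_comp_param ha (he.mem_star hz' _)]
  have h1 : fderiv ℝ a q ε = fderiv ℝ a q ε • (1 : ℝ) := by simp
  rw [h1, IsContactFamily.generator_smul, hgen _ (he.mem_star hz' _)]
  simp

/-- The time for which the Hamiltonian flow of `E` is run. -/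
noncomputable def runTime (R μ γ : ℝ) (q : ℝ × ℝ) : ℝ :=
  q.1 / R + speed μ γ q.2 * (q.1 - step q.1)

section RunTime

variable (R μ γ : ℝ)

theorem contDiff_runTime : ContDiff ℝ ∞ (runTime R μ γ) :=
  (contDiff_fst.div_const R).add (((speed_contDiff μ γ).comp contDiff_snd).mul
    (contDiff_fst.sub (step_contDiff.comp contDiff_fst)))

theorem fderiv_runTime (t s : ℝ) :
    fderiv ℝ (runTime R μ γ) (t, s) (1, 0) = 1 / R + speed μ γ s * (1 - deriv step t) := by
  have h1 : HasDerivAt (fun t : ℝ => ((t, s) : ℝ × ℝ)) (1, 0) t :=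
    (hasDerivAt_id t).prodMk (hasDerivAt_const t s)
  have h2 := (((contDiff_runTime R μ γ).differentiable (by simp)
    (t, s)).hasFDerivAt).comp_hasDerivAt t h1
  have h3 : HasDerivAt (fun t : ℝ => t / R + speed μ γ s * (t - step t))
      (1 / R + speed μ γ s * (1 - deriv step t)) t :=
    ((hasDerivAt_id t).div_const R).add (((hasDerivAt_id t).sub
      (step_contDiff.differentiable (by simp) t).hasDerivAt).const_mul _)
  exact h2.unique h3

/-- For |t| < 1/3 the step is 0 at t and 1 at t + 1, so the correction t - step t takes the same
value there and the running time only gains the constant 1/R. This is what makes the generators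
periodic. -/
theorem fderiv_runTime_add_one {t : ℝ} (ht : |t| < 1 / 3) (s : ℝ) :
    fderiv ℝ (runTime R μ γ) (t + 1, s) = fderiv ℝ (runTime R μ γ) (t, s) := by
  obtain ⟨h1, h2⟩ := abs_lt.1 ht
  have h3 := fderiv_comp_add_right (𝕜 := ℝ) (f := runTime R μ γ) (x := (t, s)) ((1 : ℝ), (0 : ℝ))
  have h4 : (t, s) + ((1 : ℝ), (0 : ℝ)) = (t + 1, s) := by simp
  rw [h4] at h3
  rw [← h3]
  have h5 : (fun q => runTime R μ γ (q + ((1 : ℝ), (0 : ℝ)))) =ᶠ[𝓝 (t, s)]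
      fun q => runTime R μ γ q + 1 / R := by
    have h6 : ∀ᶠ q : ℝ × ℝ in 𝓝 (t, s), -(1 / 3) < q.1 := continuousAt_fst (lt_mem_nhds h1)
    have h7 : ∀ᶠ q : ℝ × ℝ in 𝓝 (t, s), q.1 < 1 / 3 := continuousAt_fst (gt_mem_nhds h2)
    filter_upwards [h6, h7] with q hq hq'
    simp only [runTime, Prod.fst_add, Prod.snd_add, add_zero]
    rw [step_of_le hq'.le, step_of_ge (by linarith)]
    ring
  rw [h5.fderiv_eq]
  simp

end RunTime

/-- Both functions are generators of a single two-parameter family, the loop homotopy followed by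
the flow of E: H in the direction of t and K in that of s. Zero curvature and homogeneity are
general facts about generators, the profiles give the bounds, and γ does not depend on R. -/
theorem IsLoopHomotopy.exists_deformation {f : ℝ → ℝ → M → M} (hf : S.IsLoopHomotopy f)
    {F : ℝ → ℝ → M → ℝ} (hF : ∀ s ∈ Icc (0 : ℝ) 1, S.Generates (F s) (fun t => f t s))
    (hE : S.IsContactHamiltonian E) (hE_pos : ∀ z ∈ S.star, 0 < E z)
    (hF_pos : ∀ t, ∀ z ∈ S.star, 0 < F 1 t z) {μ : ℝ} (hμ : 0 < μ)
    (hFμ : ∀ s ∈ Icc (0 : ℝ) 1, ∀ t, ∀ z ∈ S.star, -μ * E z < F s t z) :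
    ∃ γ > 0, ∀ R > 0, ∃ H K, S.IsDeformation E R μ γ H K := by
  classical
  obtain ⟨γ, hγ, hγF⟩ := hf.exists_le hF hE hE_pos hF_pos
  refine ⟨γ, hγ, fun R hR => ?_⟩
  obtain ⟨e, he, he0, headd, hEe, hegen⟩ := exists_hamiltonianFlow hE hE_pos
  let fs : M → ℝ × ℝ → M := fun z q => f (step q.1) (step q.2) z
  have hfs : S.IsContactFamily fs := hf.isContactFamily (Q := ℝ × ℝ) (χ := fun q => step q.1)
    (σ := fun q => step q.2) (step_contDiff.comp contDiff_fst) (step_contDiff.comp contDiff_snd)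
    (fun q => step_mem q.2)
  have hrun := contDiff_runTime R μ γ
  let Θ : M → ℝ × ℝ → M := fun z q => e (fs z q) (runTime R μ γ q)
  have hΘ : S.IsContactFamily Θ := hfs.comp (he.comp_param hrun)
  have hgen : ∀ w ∈ S.star, ∀ q ε, S.generator Θ ε w q = fderiv ℝ (runTime R μ γ) q ε * E w +
      S.generator fs ε (e w (-runTime R μ γ q)) q := fun w hw q ε =>
    generator_hamiltonianFlow_comp he he0 headd hegen hfs hrun hw q ε
  have hgen1 : ∀ w ∈ S.star, ∀ t s, S.generator Θ (1, 0) w (t, s) =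
      (1 / R + speed μ γ s * (1 - deriv step t)) * E w +
        deriv step t * F (step s) (step t) (e w (-runTime R μ γ (t, s))) := by
    intro w hw t s
    rw [hgen w hw, fderiv_runTime, hf.generator_eq hF step_contDiff step_contDiff step_mem
      (he.mem_star hw _)]
  -- For t outside [1/3, 2/3] the step has brought the loop to its base point, so this factor is
  -- locally constant and does not contribute to the generators.
  have hfs0 : ∀ q : ℝ × ℝ, (q.1 < 1 / 3 ∨ 2 / 3 < q.1) → ∀ ε, ∀ w ∈ S.star,
      S.generator fs ε w q = 0 := by
    intro q hq ε w hw
    have hid : ∀ z ∈ S.star, ∀ q : ℝ × ℝ, (q.1 < 1 / 3 ∨ 2 / 3 < q.1) → fs z q = z := by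
      rintro z hz q (hq | hq)
      · show f (step q.1) (step q.2) z = z
        rw [step_of_le hq.le, hf.based _ (step_mem _) z hz]
      · show f (step q.1) (step q.2) z = z
        have := hf.periodic 0 _ (step_mem q.2) z hz
        rw [zero_add] at this
        rw [step_of_ge hq.le, this, hf.based _ (step_mem _) z hz]
    refine hfs.generator_eq_zero (fun z hz => ?_) hw
    have hopen : IsOpen {q : ℝ × ℝ | q.1 < 1 / 3 ∨ 2 / 3 < q.1} :=
      (isOpen_lt continuous_fst continuous_const).union
        (isOpen_lt continuous_const continuous_fst)
    have hc : Filter.Tendsto (fun τ : ℝ => q + τ • ε) (𝓝 0) (𝓝 q) := by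
      have := (hasDerivAt_line q ε 0).continuousAt.tendsto
      simpa using this
    filter_upwards [hc (hopen.mem_nhds hq)] with τ hτ
    rw [hid z hz _ hτ, hid z hz _ hq]
  have hjump : ∀ ε, ∀ z ∈ S.star, ∀ t s : ℝ, |t| < 1 / 3 →
      S.generator Θ ε z (t + 1, s) = S.generator Θ ε z (t, s) := by
    intro ε z hz t s ht
    obtain ⟨h1, h2⟩ := abs_lt.1 ht
    rw [hgen z hz, hgen z hz, fderiv_runTime_add_one R μ γ ht,
      hfs0 (t + 1, s) (Or.inr (by show 2 / 3 < t + 1; linarith)) _ _ (he.mem_star hz _),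
      hfs0 (t, s) (Or.inl h2) _ _ (he.mem_star hz _)]
  -- Only H must vanish on the core, where generators have no meaning; values of K there are later
  -- suppressed by a cut-off.
  let H : M → ℝ × ℝ → ℝ := fun z q =>
    if z ∈ S.star then periodize (S.generator Θ (1, 0)) z q else 0
  let K : M → ℝ × ℝ → ℝ := periodize (S.generator Θ (0, 1))
  have hH : ∀ z ∈ S.star, ∀ q, H z q = periodize (S.generator Θ (1, 0)) z q := fun z hz q =>
    if_pos hz
  have hHc : ∀ z, z ∉ S.star → ∀ q, H z q = 0 := fun z hz q => if_neg hz
  have hEc : ∀ z, z ∉ S.star → E z = 0 := fun z hz => hE.core z (not_not.1 hz)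
  have hlower : ∀ z ∈ S.star, ∀ t s, s ∈ Icc (0 : ℝ) 1 → (1 / R - μ) * E z ≤ H z (t, s) := by
    intro z hz t s hs
    rw [hH z hz, periodize, hgen1 z hz]
    have hy := he.mem_star hz (-runTime R μ γ (Int.fract t, s))
    have hEy := hEe z hz (-runTime R μ γ (Int.fract t, s))
    have h1 := neg_le_speed (s := s) (κ := deriv step (Int.fract t)) (e := E z)
      (φ := F (step s) (step (Int.fract t)) (e z (-runTime R μ γ (Int.fract t, s)))) hμ hγ
      (deriv_step_nonneg _) (hE_pos z hz).le
      (fun h => by rw [step_of_le h]; exact hf.eq_zero_of_zero hF _ hy)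
      (by rw [← hEy]; exact (hFμ _ (step_mem s) _ _ hy).le)
      (fun h => by rw [step_of_ge h, ← hEy]; exact hγF _ (step_mem _) _ hy)
    show _ ≤ (1 / R + speed μ γ s * (1 - deriv step (Int.fract t))) * E z + _
    linarith
  refine ⟨H, K, ?_, ?_, ?_, ?_, ?_, ?_, ?_, ?_, ?_, ?_, ?_⟩
  · exact fun z hz q => contMDiffAt_periodize (hjump (1, 0)) hH hz q
      fun q => hΘ.contMDiffAt_generator _ hz q
  · exact fun z hz q => contMDiffAt_periodize (hjump (0, 1)) (fun _ _ _ => rfl) hz q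
      fun q => hΘ.contMDiffAt_generator _ hz q
  · intro q
    refine ⟨fun z hz t => ?_, fun z hz => hHc z (not_not.2 hz) q⟩
    rw [hH _ (S.flow_mem_star hz t), hH z hz]
    exact S.apply_flow_of_differential
      (fun w hw => hΘ.mdifferentiableAt_generator (1, 0) hw (Int.fract q.1, q.2))
      (fun w hw => hΘ.differential_generator_L hw _ _) hz t
  · intro z hz q
    exact hΘ.differential_generator_L hz (Int.fract q.1, q.2) (0, 1)
  · intro z t s
    show (if _ then _ else _) = (if _ then _ else _)
    rw [periodize_add_one]
  · exact fun z t s => periodize_add_one _ z t s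
  · intro z hz q
    obtain ⟨-, hn1, -, hn2⟩ := periodize_local (hjump (1, 0)) hH q rfl
    obtain ⟨-, hm1, -, hm2⟩ := periodize_local (X := S.generator Θ (0, 1)) (Y := K)
      (hjump (0, 1)) (fun _ _ _ => rfl) q rfl
    rw [hn1 z hz, hm1 z hz, hn2 z hz, hm2 z hz]
    exact hΘ.zero_curvature hz _ (1, 0) (0, 1)
  · intro z t
    by_cases hz : z ∈ S.star
    · rw [hH z hz, periodize, hgen1 z hz]
      show (1 / R + speed μ γ 0 * _) * E z + _ * F (step 0) _ _ = E z / R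
      rw [speed_of_nonpos le_rfl, step_of_le (t := 0) (by norm_num),
        hf.eq_zero_of_zero hF _ (he.mem_star hz _)]
      ring
    · rw [hHc z hz, hEc z hz, zero_div]
  · intro z t s hs
    by_cases hz : z ∈ S.star
    · exact hlower z hz t s hs
    · rw [hHc z hz, hEc z hz, mul_zero]
  · intro z t
    by_cases hz : z ∈ S.star
    · rw [hH z hz, periodize, hgen1 z hz]
      show _ ≤ (1 / R + speed μ γ 1 * _) * E z + _ * F (step 1) _ _
      have h1 := hγF (step (Int.fract t)) (step_mem _) _
        (he.mem_star hz (-runTime R μ γ (Int.fract t, 1)))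
      rw [hEe z hz] at h1
      rw [speed_of_one_le le_rfl, step_of_ge (t := 1) (by norm_num)]
      have h2 := mul_le_mul_of_nonneg_left h1 (deriv_step_nonneg (Int.fract t))
      linarith
    · rw [hHc z hz, hEc z hz, mul_zero]
  · intro z hz q hq
    -- Both profiles are constant for s < 0 and for s > 1, so the family does not depend on s there.
    refine hΘ.generator_eq_zero (fun z hz => ?_) hz
    have hopen : IsOpen {s : ℝ | s < 0 ∨ 1 < s} := isOpen_Iio.union isOpen_Ioi
    have hc : Filter.Tendsto (fun τ : ℝ => q.2 + τ) (𝓝 0) (𝓝 q.2) := by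
      have : Continuous (fun τ : ℝ => q.2 + τ) := by fun_prop
      simpa using this.tendsto 0
    have hc0 : ∀ᶠ τ in 𝓝 (0 : ℝ), step (q.2 + τ) = step q.2 ∧
        speed μ γ (q.2 + τ) = speed μ γ q.2 := by
      rcases hq with hq | hq
      · filter_upwards [hc (isOpen_Iio.mem_nhds hq)] with τ (hτ : q.2 + τ < 0)
        rw [step_of_le (by linarith), step_of_le (by linarith), speed_of_nonpos hτ.le,
          speed_of_nonpos hq.le]
        exact ⟨rfl, rfl⟩
      · filter_upwards [hc (isOpen_Ioi.mem_nhds hq)] with τ (hτ : 1 < q.2 + τ)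
        rw [step_of_ge (by linarith), step_of_ge (by linarith), speed_of_one_le hτ.le,
          speed_of_one_le hq.le]
        exact ⟨rfl, rfl⟩
    filter_upwards [hc0] with τ ⟨h1, h2⟩
    have h3 : (Int.fract q.1, q.2) + τ • ((0 : ℝ), (1 : ℝ)) = (Int.fract q.1, q.2 + τ) := by
      simp
    rw [h3]
    show e (f (step (Int.fract q.1)) (step (q.2 + τ)) z) (runTime R μ γ (Int.fract q.1, q.2 + τ)) =
      e (f (step (Int.fract q.1)) (step q.2) z) (runTime R μ γ (Int.fract q.1, q.2))
    simp only [runTime]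
    rw [h1, h2]

end Liouville

/-- Solutions of a scalar linear equation differ by a positive factor from their initial values. -/
theorem linear_ode {u g : ℝ → ℝ} (hg : Continuous g) {a b : ℝ}
    (hu : ∀ s ∈ Ioo a b, HasDerivAt u (g s * u s) s) {s s' : ℝ} (hs : s ∈ Ioo a b)
    (hs' : s' ∈ Ioo a b) : u s = Real.exp (∫ τ in s'..s, g τ) * u s' := by
  let G : ℝ → ℝ := fun s => ∫ τ in s'..s, g τ
  have hG : ∀ s, HasDerivAt G (g s) s := fun s =>
    intervalIntegral.integral_hasDerivAt_right (hg.intervalIntegrable _ _)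
      (hg.stronglyMeasurableAtFilter _ _) hg.continuousAt
  have hder : ∀ s ∈ Ioo a b, HasDerivAt (fun s => Real.exp (-G s) * u s) 0 s := by
    intro s hs
    refine ((hG s).neg.exp.mul (hu s hs)).congr_deriv ?_
    simp only [Pi.neg_apply]
    ring
  have hc := isOpen_Ioo.is_const_of_deriv_eq_zero isPreconnected_Ioo
    (fun s hs => (hder s hs).differentiableAt.differentiableWithinAt)
    (fun s hs => (hder s hs).deriv) hs hs'
  have hG0 : G s' = 0 := intervalIntegral.integral_same
  simp only [hG0, neg_zero, Real.exp_zero, one_mul] at hc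
  rw [← hc, ← mul_assoc, ← Real.exp_add, add_neg_cancel, Real.exp_zero, one_mul]

/-! ### Exchange of the time derivative and the differential. -/

section MixedPartials

variable {E' : Type*} [NormedAddCommGroup E'] [NormedSpace ℝ E']
  {H : Type*} [TopologicalSpace H] {J : ModelWithCorners ℝ E' H} [J.Boundaryless]
  {N : Type*} [TopologicalSpace N] [ChartedSpace H N] [IsManifold J ∞ N]

/-- The derivative in time of the differential is the differential of the derivative in time. -/
theorem hasDerivAt_differential {T : ℝ → N → ℝ} {t₀ : ℝ} {z : N}
    (hT : ContMDiffAt (𝓘(ℝ, ℝ).prod J) 𝓘(ℝ, ℝ) ∞ (fun p : ℝ × N => T p.1 p.2) (t₀, z))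
    (v : TangentSpace J z) :
    HasDerivAt (fun t => differential J (T t) z v)
      (differential J (fun y => deriv (fun t => T t y) t₀) z v) t₀ := by
  set e := extChartAt J z
  set u : ℝ × E' → ℝ := fun q => T q.1 (e.symm q.2)
  set y₀ := e z
  have hy₀ : e.symm y₀ = z := extChartAt_to_inv z
  have hes : ContMDiffAt 𝓘(ℝ, E') J ∞ e.symm y₀ :=
    (contMDiffOn_extChartAt_symm z).contMDiffAt (extChartAt_target_mem_nhds z)
  have hu : ContDiffAt ℝ ∞ u (t₀, y₀) := by
    rw [← contMDiffAt_iff_contDiffAt]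
    have h1 : ContMDiffAt 𝓘(ℝ, ℝ × E') (𝓘(ℝ, ℝ).prod J) ∞
        (fun q : ℝ × E' => (q.1, e.symm q.2)) (t₀, y₀) := by
      refine ContMDiffAt.prodMk ?_ ?_
      · exact contDiffAt_fst.contMDiffAt
      · exact ContMDiffAt.comp (g := e.symm) (f := fun q : ℝ × E' => q.2) (t₀, y₀) hes
          contDiffAt_snd.contMDiffAt
    refine ContMDiffAt.comp (g := fun p : ℝ × N => T p.1 p.2)
      (f := fun q : ℝ × E' => (q.1, e.symm q.2)) (t₀, y₀) ?_ h1
    show ContMDiffAt _ _ _ _ (t₀, e.symm y₀)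
    rw [hy₀]
    exact hT
  have hund : ∀ᶠ q in 𝓝 ((t₀, y₀) : ℝ × E'), DifferentiableAt ℝ u q :=
    ((hu.of_le (m := 1) (by simp)).eventually (by simp)).mono
      fun q hq => hq.differentiableAt (by simp)
  have hB : DifferentiableAt ℝ (fderiv ℝ u) (t₀, y₀) :=
    (hu.fderiv_right (m := ∞) (by simp)).differentiableAt (by simp)
  set v' : E' := mfderiv J 𝓘(ℝ, E') e z v
  have hchart : ∀ {g : N → ℝ} {g' : E' → ℝ} {A : E' →L[ℝ] ℝ}, HasFDerivAt g' A y₀ →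
      g =ᶠ[𝓝 z] g' ∘ e → differential J g z v = A v' := by
    intro g g' A hA h
    have h8 := h.mfderiv_eq (I := J) (I' := 𝓘(ℝ, ℝ))
    have h9 := mfderiv_comp (I := J) z hA.differentiableAt.mdifferentiableAt
      (mdifferentiableAt_extChartAt (I := J) (mem_chart_source _ z))
    rw [mfderiv_eq_fderiv, hA.fderiv] at h9
    exact (congrArg (fun L : E' →L[ℝ] ℝ => L v) h8).trans
      (congrArg (fun L : E' →L[ℝ] ℝ => L v) h9)
  have hspace : ∀ t, DifferentiableAt ℝ u (t, y₀) →
      differential J (T t) z v = fderiv ℝ u (t, y₀) (0, v') := by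
    intro t ht
    have h1 : HasFDerivAt (fun y : E' => u (t, y))
        ((fderiv ℝ u (t, y₀)).comp (ContinuousLinearMap.inr ℝ ℝ E')) y₀ :=
      HasFDerivAt.comp (g := u) (f := fun y : E' => (t, y)) y₀ ht.hasFDerivAt
        (hasFDerivAt_prodMk_right (𝕜 := ℝ) t y₀)
    rw [hchart h1 (g := T t)]
    · rfl
    · filter_upwards [extChartAt_source_mem_nhds (I := J) z] with y hy
      show T t y = T t (e.symm (e y))
      rw [e.left_inv hy]
  have h1 : HasDerivAt (fun t => fderiv ℝ u (t, y₀) (0, v'))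
      (fderiv ℝ (fderiv ℝ u) (t₀, y₀) (1, 0) (0, v')) t₀ := by
    have h2 : HasDerivAt (fun t : ℝ => ((t, y₀) : ℝ × E')) (1, 0) t₀ :=
      (hasDerivAt_id t₀).prodMk (hasDerivAt_const t₀ y₀)
    have h3 := hB.hasFDerivAt.comp_hasDerivAt t₀ h2
    simpa using h3.clm_apply (hasDerivAt_const t₀ ((0 : ℝ), v'))
  have h2 : differential J (fun y => deriv (fun t => T t y) t₀) z v =
      fderiv ℝ (fderiv ℝ u) (t₀, y₀) (0, v') (1, 0) := by
    have h3 : HasFDerivAt (fun y : E' => fderiv ℝ u (t₀, y) (1, 0))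
        (((fderiv ℝ (fderiv ℝ u) (t₀, y₀)).comp (ContinuousLinearMap.inr ℝ ℝ E')).flip (1, 0))
        y₀ := by
      have h4 := (HasFDerivAt.comp y₀ (f := fun y : E' => (t₀, y)) hB.hasFDerivAt
        (hasFDerivAt_prodMk_right t₀ y₀)).clm_apply (hasFDerivAt_const ((1 : ℝ), (0 : E')) y₀)
      refine HasFDerivAt.congr_fderiv h4 ?_
      ext w
      simp
    rw [hchart h3]
    · rfl
    · have h6 : Filter.Tendsto (fun y : N => ((t₀, e y) : ℝ × E')) (𝓝 z) (𝓝 (t₀, y₀)) :=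
        (continuousAt_const.prodMk (continuousAt_extChartAt (I := J) z))
      filter_upwards [extChartAt_source_mem_nhds (I := J) z, h6.eventually hund] with y hy hy2
      have h70 : HasDerivAt (fun t : ℝ => ((t, e y) : ℝ × E')) (1, 0) t₀ :=
        (hasDerivAt_id t₀).prodMk (hasDerivAt_const t₀ (e y))
      have h7 : HasDerivAt (fun t => u (t, e y)) (fderiv ℝ u (t₀, e y) (1, 0)) t₀ :=
        HasFDerivAt.comp_hasDerivAt (f := fun t : ℝ => ((t, e y) : ℝ × E')) t₀ hy2.hasFDerivAt h70
      have h8 : (fun t => T t y) = fun t => u (t, e y) := by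
        ext t
        show T t y = T t (e.symm (e y))
        rw [e.left_inv hy]
      rw [h8, h7.deriv]
      rfl
  have hsymm : fderiv ℝ (fderiv ℝ u) (t₀, y₀) (1, 0) (0, v') =
      fderiv ℝ (fderiv ℝ u) (t₀, y₀) (0, v') (1, 0) :=
    (hu.isSymmSndFDerivAt (by simpa using WithTop.coe_le_coe.2 (le_top : (2 : ℕ∞) ≤ ⊤))).eq _ _
  rw [h2, ← hsymm]
  refine h1.congr_of_eventuallyEq ?_
  have hprod : ContinuousAt (fun t : ℝ => ((t, y₀) : ℝ × E')) t₀ := by fun_prop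
  filter_upwards [hprod.eventually hund] with t ht
  exact hspace t ht

end MixedPartials

/-! ### Curves and vector fields on M × Q. -/

section Product

variable {d : ℕ} {M : Type*} [TopologicalSpace M] [ChartedSpace (EuclideanSpace ℝ (Fin d)) M]
  [IsManifold (𝓡 d) ∞ M]
  {Q : Type*} [NormedAddCommGroup Q] [NormedSpace ℝ Q]

theorem hasMFDerivAt_curve_prodMk {γ : ℝ → M} {δ : ℝ → Q} {t : ℝ}
    {v : TangentSpace (𝓡 d) (γ t)} {w : Q}
    (hγ : HasMFDerivAt 𝓘(ℝ, ℝ) (𝓡 d) γ t ((1 : ℝ →L[ℝ] ℝ).smulRight v))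
    (hδ : HasDerivAt δ w t) :
    HasMFDerivAt 𝓘(ℝ, ℝ) ((𝓡 d).prod 𝓘(ℝ, Q)) (fun τ => (γ τ, δ τ)) t
      ((1 : ℝ →L[ℝ] ℝ).smulRight ((v, w) : TangentSpace ((𝓡 d).prod 𝓘(ℝ, Q)) (γ t, δ t))) := by
  have h1 : HasMFDerivAt 𝓘(ℝ, ℝ) 𝓘(ℝ, Q) δ t ((1 : ℝ →L[ℝ] ℝ).smulRight w) :=
    hδ.hasFDerivAt.hasMFDerivAt
  exact (hγ.prodMk h1).smulRight_one
    (Prod.ext (one_smul ℝ (show EuclideanSpace ℝ (Fin d) from v)) (one_smul ℝ w))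

theorem hasMFDerivAt_curve_fst {γ : ℝ → M × Q} {t : ℝ}
    {v : TangentSpace ((𝓡 d).prod 𝓘(ℝ, Q)) (γ t)}
    (hγ : HasMFDerivAt 𝓘(ℝ, ℝ) ((𝓡 d).prod 𝓘(ℝ, Q)) γ t ((1 : ℝ →L[ℝ] ℝ).smulRight v)) :
    HasMFDerivAt 𝓘(ℝ, ℝ) (𝓡 d) (fun τ => (γ τ).1) t
      ((1 : ℝ →L[ℝ] ℝ).smulRight (v.1 : TangentSpace (𝓡 d) (γ t).1)) := by
  have h1 := HasMFDerivAt.comp t (hasMFDerivAt_fst (I := 𝓡 d) (I' := 𝓘(ℝ, Q)) (γ t)) hγ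
  exact h1.smulRight_one (one_smul ℝ (show EuclideanSpace ℝ (Fin d) from v.1))

theorem hasDerivAt_curve_snd {γ : ℝ → M × Q} {t : ℝ}
    {v : TangentSpace ((𝓡 d).prod 𝓘(ℝ, Q)) (γ t)}
    (hγ : HasMFDerivAt 𝓘(ℝ, ℝ) ((𝓡 d).prod 𝓘(ℝ, Q)) γ t ((1 : ℝ →L[ℝ] ℝ).smulRight v)) :
    HasDerivAt (fun τ => (γ τ).2) (v.2 : Q) t := by
  have h1 := HasMFDerivAt.comp t (hasMFDerivAt_snd (I := 𝓡 d) (I' := 𝓘(ℝ, Q)) (γ t)) hγ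
  have h2 : HasMFDerivAt 𝓘(ℝ, ℝ) 𝓘(ℝ, Q) (fun τ => (γ τ).2) t
      ((1 : ℝ →L[ℝ] ℝ).smulRight (v.2 : Q)) :=
    HasMFDerivAt.smulRight_one (v := (v.2 : Q)) h1 (one_smul ℝ (show Q from v.2))
  have h3 : HasFDerivAt (fun τ => (γ τ).2) ((1 : ℝ →L[ℝ] ℝ).smulRight (v.2 : Q)) t :=
    hasMFDerivAt_iff_hasFDerivAt.1 h2
  exact h3.hasDerivAt.congr_deriv (one_smul ℝ (show Q from v.2))

/-- The chart on the vector space factor is the identity, so only the first component is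
transformed. -/
theorem chartCoord_prod {z₀ z : M} {q₀ q : Q} (hz : z ∈ (chartAt (EuclideanSpace ℝ (Fin d)) z₀).source)
    (v : TangentSpace (𝓡 d) z) (w : Q) :
    chartCoord ((𝓡 d).prod 𝓘(ℝ, Q)) (z₀, q₀) (z, q)
      ((v, w) : TangentSpace ((𝓡 d).prod 𝓘(ℝ, Q)) (z, q)) =
      (chartCoord (𝓡 d) z₀ z v, w) := by
  have h1 := (mdifferentiableAt_extChartAt (I := 𝓡 d) hz).hasMFDerivAt
  have h2 : HasMFDerivAt ((𝓡 d).prod 𝓘(ℝ, Q)) (𝓘(ℝ, EuclideanSpace ℝ (Fin d)).prod 𝓘(ℝ, Q))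
      (fun p : M × Q => (extChartAt (𝓡 d) z₀ p.1, p.2)) (z, q) _ :=
    (HasMFDerivAt.comp (z, q) (g := extChartAt (𝓡 d) z₀) (f := Prod.fst) h1
      (hasMFDerivAt_fst (I := 𝓡 d) (I' := 𝓘(ℝ, Q)) (z, q))).prodMk
      (hasMFDerivAt_snd (I := 𝓡 d) (I' := 𝓘(ℝ, Q)) (z, q))
  have h3 : (extChartAt ((𝓡 d).prod 𝓘(ℝ, Q)) (z₀, q₀) : M × Q → EuclideanSpace ℝ (Fin d) × Q) =
      fun p : M × Q => (extChartAt (𝓡 d) z₀ p.1, p.2) := by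
    ext p
    · simp
    · rfl
  have h4 := h2.mfderiv
  rw [← modelWithCornersSelf_prod, chartedSpaceSelf_prod] at h4
  rw [← h3] at h4
  exact congrArg (fun A : EuclideanSpace ℝ (Fin d) × Q →L[ℝ] EuclideanSpace ℝ (Fin d) × Q =>
    A (v, w)) h4

theorem contMDiffAt_tangent_prodMk {V : ∀ p : M × Q, TangentSpace (𝓡 d) p.1} {W : M × Q → Q}
    {p₀ : M × Q} (hV : ContMDiffAt ((𝓡 d).prod 𝓘(ℝ, Q)) (𝓡 d).tangent ∞
      (fun p : M × Q => (⟨p.1, V p⟩ : TangentBundle (𝓡 d) M)) p₀)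
    (hW : ContMDiffAt ((𝓡 d).prod 𝓘(ℝ, Q)) 𝓘(ℝ, Q) ∞ W p₀) :
    ContMDiffAt ((𝓡 d).prod 𝓘(ℝ, Q)) ((𝓡 d).prod 𝓘(ℝ, Q)).tangent ∞
      (fun p : M × Q => (⟨p, (V p, W p)⟩ : TangentBundle ((𝓡 d).prod 𝓘(ℝ, Q)) (M × Q))) p₀ := by
  refine (contMDiffAt_tangentBundle_iff (b := fun p : M × Q => p) contMDiffAt_id).2 ?_
  have h1 := (contMDiffAt_tangentBundle_iff (b := fun p : M × Q => p.1) contMDiffAt_fst).1 hV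
  refine (h1.prodMk_space hW).congr_of_eventuallyEq ?_
  have hs : ∀ᶠ p in 𝓝 p₀, p.1 ∈ (chartAt (EuclideanSpace ℝ (Fin d)) p₀.1).source :=
    continuousAt_fst ((chartAt _ p₀.1).open_source.mem_nhds (mem_chart_source _ p₀.1))
  filter_upwards [hs] with p hp
  exact chartCoord_prod (q₀ := p₀.2) (q := p.2) hp (V p) (W p)

end Product

/-! ### Contact vector fields on M × ℝ. -/

namespace Liouville

variable {d : ℕ} {M : Type*} [TopologicalSpace M] [ChartedSpace (EuclideanSpace ℝ (Fin d)) M]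
  [IsManifold (𝓡 d) ∞ M] (S : Liouville d M)

variable (d) in
/-- A smooth function of `(z, (t, s))`, 1-periodic in `t`, with compact support in the other two
variables, contained in `s ∈ [0,1]`. -/
structure IsCutoffHamiltonian (k : M → ℝ × ℝ → ℝ) (C : Set M) : Prop where
  smooth : ContMDiff ((𝓡 d).prod 𝓘(ℝ, ℝ × ℝ)) 𝓘(ℝ, ℝ) ∞ (fun p : M × (ℝ × ℝ) => k p.1 p.2)
  periodic : ∀ z t s, k z (t + 1, s) = k z (t, s)
  isCompact : IsCompact C
  support : ∀ z (q : ℝ × ℝ), z ∉ C ∨ q.2 < 0 ∨ 1 < q.2 → k z q = 0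

/-- The `M`-component of the contact vector field of `k`. -/
noncomputable def contactFieldM (k : M → ℝ × ℝ → ℝ) (z : M) (q : ℝ × ℝ) : TangentSpace (𝓡 d) z :=
  S.sharp (differential (𝓡 d) (fun z => k z q) z) - fderiv ℝ (k z) q (1, 0) • S.L z

/-- The `t`-component of the contact vector field of `k`. -/
noncomputable def contactFieldT (k : M → ℝ × ℝ → ℝ) (z : M) (q : ℝ × ℝ) : ℝ :=
  differential (𝓡 d) (fun z => k z q) z (S.L z) - k z q

/-- The contact vector field of the `s`-dependent contact Hamiltonian `k` on `M × ℝ` with the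
contact form `α - dt`, extended by `∂/∂s`. -/
noncomputable def contactField (k : M → ℝ × ℝ → ℝ) (p : M × (ℝ × ℝ)) :
    TangentSpace ((𝓡 d).prod 𝓘(ℝ, ℝ × ℝ)) p :=
  (S.contactFieldM k p.1 p.2, ((S.contactFieldT k p.1 p.2, 1) : ℝ × ℝ))

namespace IsCutoffHamiltonian

variable {S} {k : M → ℝ × ℝ → ℝ} {C : Set M} (hk : IsCutoffHamiltonian d k C)
include hk

theorem contMDiff_differential_L : ContMDiff ((𝓡 d).prod 𝓘(ℝ, ℝ × ℝ)) 𝓘(ℝ, ℝ) ∞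
    (fun p : M × (ℝ × ℝ) => differential (𝓡 d) (fun z => k z p.2) p.1 (S.L p.1)) := by
  rintro ⟨z, q⟩
  refine (contMDiffAt_form_apply S.smooth_α
    (S.contMDiffAt_sgrad (hk.smooth (z, q)))).congr_of_eventuallyEq ?_
  exact Filter.Eventually.of_forall fun p => (S.α_sharp _).symm

theorem contMDiff_contactField : ContMDiff ((𝓡 d).prod 𝓘(ℝ, ℝ × ℝ))
    ((𝓡 d).prod 𝓘(ℝ, ℝ × ℝ)).tangent ∞ (fun p : M × (ℝ × ℝ) =>
      (⟨p, S.contactField k p⟩ : TangentBundle ((𝓡 d).prod 𝓘(ℝ, ℝ × ℝ)) (M × (ℝ × ℝ)))) := by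
  rintro ⟨z, q⟩
  have h1 := S.contMDiffAt_sgrad (hk.smooth (z, q))
  have h2 := (contMDiffAt_fderiv_snd (hk.smooth (z, q))).clm_apply
    (contMDiffAt_const (c := ((1, 0) : ℝ × ℝ)))
  have h3 : ContMDiffAt ((𝓡 d).prod 𝓘(ℝ, ℝ × ℝ)) (𝓡 d).tangent ∞
      (fun p : M × (ℝ × ℝ) => (⟨p.1, S.L p.1⟩ : TangentBundle (𝓡 d) M)) (z, q) :=
    ContMDiffAt.comp (g := fun z => (⟨z, S.L z⟩ : TangentBundle (𝓡 d) M)) (f := Prod.fst) (z, q)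
      (S.smooth_L z) contMDiffAt_fst
  have h4 : ContMDiffAt ((𝓡 d).prod 𝓘(ℝ, ℝ × ℝ)) 𝓘(ℝ, ℝ) ∞
      (fun p : M × (ℝ × ℝ) => S.contactFieldT k p.1 p.2) (z, q) :=
    (hk.contMDiff_differential_L (z, q)).sub (hk.smooth (z, q))
  have h5 : ContMDiffAt ((𝓡 d).prod 𝓘(ℝ, ℝ × ℝ)) 𝓘(ℝ, ℝ × ℝ) ∞
      (fun p : M × (ℝ × ℝ) => ((S.contactFieldT k p.1 p.2, 1) : ℝ × ℝ)) (z, q) :=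
    h4.prodMk_space contMDiffAt_const
  exact contMDiffAt_tangent_prodMk (V := fun p => S.contactFieldM k p.1 p.2)
    (contMDiffAt_tangent_sub h1 (contMDiffAt_tangent_smul h2 h3)) h5

theorem periodic_int (z : M) (t s : ℝ) (n : ℤ) : k z (t + n, s) = k z (t, s) :=
  (show Function.Periodic (fun t => k z (t, s)) 1 from fun t => hk.periodic z t s).int_mul n t
    |> (by simpa using ·)

theorem contactFieldM_add_int (z : M) (t s : ℝ) (n : ℤ) :
    S.contactFieldM k z (t + n, s) = S.contactFieldM k z (t, s) := by
  have h1 : (fun z => k z (t + n, s)) = fun z => k z (t, s) := by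
    ext z
    exact hk.periodic_int z t s n
  have h2 : (fun q : ℝ × ℝ => k z (q + ((n : ℝ), (0 : ℝ)))) = k z := by
    ext q
    have h := hk.periodic_int z q.1 q.2 n
    have h' : q + ((n : ℝ), (0 : ℝ)) = (q.1 + n, q.2) := by ext <;> simp
    rw [h', h]
  have h3 : fderiv ℝ (k z) (t + n, s) = fderiv ℝ (k z) (t, s) := by
    have := fderiv_comp_add_right (f := k z) (x := ((t, s) : ℝ × ℝ)) (𝕜 := ℝ) (((n : ℝ), (0 : ℝ)))
    rw [h2] at this
    rw [this]
    simp
  rw [contactFieldM, contactFieldM, h1, h3]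

theorem contactFieldT_add_int (z : M) (t s : ℝ) (n : ℤ) :
    S.contactFieldT k z (t + n, s) = S.contactFieldT k z (t, s) := by
  have h1 : (fun z => k z (t + n, s)) = fun z => k z (t, s) := by
    ext z
    exact hk.periodic_int z t s n
  rw [contactFieldT, contactFieldT, h1, hk.periodic_int]

variable [T2Space M]

theorem contactField_eq_zero {z : M} {q : ℝ × ℝ} (h : z ∉ C ∨ q.2 < 0 ∨ 1 < q.2) :
    S.contactFieldM k z q = 0 ∧ S.contactFieldT k z q = 0 := by
  have hopen : IsOpen {p : M × (ℝ × ℝ) | p.1 ∉ C ∨ p.2.2 < 0 ∨ 1 < p.2.2} :=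
    (hk.isCompact.isClosed.isOpen_compl.preimage continuous_fst).union
      ((isOpen_Iio.preimage (continuous_snd.comp continuous_snd)).union
        (isOpen_Ioi.preimage (continuous_snd.comp continuous_snd)))
  have h0 : ∀ᶠ p : M × (ℝ × ℝ) in 𝓝 (z, q), k p.1 p.2 = 0 := by
    filter_upwards [hopen.mem_nhds h] with p hp
    exact hk.support _ _ hp
  have h1 : (fun z => k z q) =ᶠ[𝓝 z] fun _ => 0 :=
    (Continuous.prodMk_left q).continuousAt.eventually h0
  have h2 : k z =ᶠ[𝓝 q] fun _ => 0 :=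
    (Continuous.prodMk_right z).continuousAt.eventually h0
  have h3 : differential (𝓡 d) (fun z => k z q) z = 0 := by
    rw [differential_congr h1]
    exact mfderiv_const
  have h4 : fderiv ℝ (k z) q = 0 := by
    rw [h2.fderiv_eq]
    simp
  constructor
  · rw [contactFieldM, h3, h4]
    have h5 : S.sharp (0 : TangentSpace (𝓡 d) z →L[ℝ] ℝ) = 0 := by
      refine S.nondegenerate _ _ fun w => ?_
      rw [dForm_swap]
      have := S.symp_sharp (0 : TangentSpace (𝓡 d) z →L[ℝ] ℝ) w
      rw [symp] at this
      rw [this]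
      simp
    rw [h5]
    simp
  · rw [contactFieldT, h3, hk.support z q h]
    simp

end IsCutoffHamiltonian

variable {S} {k : M → ℝ × ℝ → ℝ}

theorem hasMFDerivAt_contactField {γ : ℝ → M} {δ : ℝ → ℝ × ℝ} {t : ℝ}
    (h1 : HasMFDerivAt 𝓘(ℝ, ℝ) (𝓡 d) γ t
      ((1 : ℝ →L[ℝ] ℝ).smulRight (S.contactFieldM k (γ t) (δ t))))
    (h2 : HasDerivAt δ (S.contactFieldT k (γ t) (δ t), 1) t) :
    HasMFDerivAt 𝓘(ℝ, ℝ) ((𝓡 d).prod 𝓘(ℝ, ℝ × ℝ)) (fun τ => (γ τ, δ τ)) t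
      ((1 : ℝ →L[ℝ] ℝ).smulRight (S.contactField k (γ t, δ t))) :=
  hasMFDerivAt_curve_prodMk h1 h2

namespace IsCutoffHamiltonian

variable {C : Set M} (hk : IsCutoffHamiltonian d k C)
include hk

theorem hasMFDerivAt_translate {γ : ℝ → M × (ℝ × ℝ)} {t : ℝ} (n : ℤ)
    (h : HasMFDerivAt 𝓘(ℝ, ℝ) ((𝓡 d).prod 𝓘(ℝ, ℝ × ℝ)) γ t
      ((1 : ℝ →L[ℝ] ℝ).smulRight (S.contactField k (γ t)))) :
    HasMFDerivAt 𝓘(ℝ, ℝ) ((𝓡 d).prod 𝓘(ℝ, ℝ × ℝ))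
      (fun τ => ((γ τ).1, ((γ τ).2.1 + n, (γ τ).2.2))) t
      ((1 : ℝ →L[ℝ] ℝ).smulRight (S.contactField k ((γ t).1, ((γ t).2.1 + n, (γ t).2.2)))) := by
  have h1 := hasMFDerivAt_curve_fst h
  have h2 := hasDerivAt_curve_snd h
  refine hasMFDerivAt_contactField (γ := fun τ => (γ τ).1)
    (δ := fun τ => ((γ τ).2.1 + n, (γ τ).2.2)) ?_ ?_
  · rw [hk.contactFieldM_add_int]
    exact h1
  · rw [hk.contactFieldT_add_int]
    have h3 := h2.add_const (((n : ℝ), (0 : ℝ)) : ℝ × ℝ)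
    refine h3.congr_of_eventuallyEq (Filter.Eventually.of_forall fun τ => ?_)
    ext <;> simp

variable [T2Space M]

/-- The t and s directions are not compact, but the field is periodic in t and reduces to ∂/∂s when
z is outside C or s is outside [0,1]. A common existence time over one period thus suffices. -/
theorem exists_contactFlow :
    ∃ Φ : ℝ → M × (ℝ × ℝ) → M × (ℝ × ℝ), (∀ p, Φ 0 p = p) ∧
      ∀ p, IsMIntegralCurve (fun t => Φ t p) (S.contactField k) := by
  have hcomp : IsCompact (C ×ˢ (Icc (0 : ℝ) 1 ×ˢ Icc (-1 : ℝ) 2)) :=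
    hk.isCompact.prod (isCompact_Icc.prod isCompact_Icc)
  obtain ⟨ε, hε, h⟩ := exists_uniform_time hk.contMDiff_contactField hcomp
  -- The bound by 1 keeps a trajectory that starts with s outside [-1, 2] outside [0,1], where it is
  -- an explicit line.
  refine exists_flow hk.contMDiff_contactField (ε := min ε 1) (by positivity) ?_
  rintro ⟨z, t, s⟩
  by_cases hp : z ∈ C ∧ s ∈ Icc (-1 : ℝ) 2
  · obtain ⟨γ, hγ0, hγ⟩ := h (z, (Int.fract t, s))
      ⟨hp.1, ⟨Int.fract_nonneg t, (Int.fract_lt_one t).le⟩, hp.2⟩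
    refine ⟨fun τ => ((γ τ).1, ((γ τ).2.1 + ⌊t⌋, (γ τ).2.2)), ?_, ?_⟩
    · simp [hγ0]
    · intro τ hτ
      have hτ' : τ ∈ Ioo (-ε) ε :=
        ⟨by linarith [hτ.1, min_le_left ε 1], by linarith [hτ.2, min_le_left ε 1]⟩
      exact (hk.hasMFDerivAt_translate ⌊t⌋
        ((hγ τ hτ').hasMFDerivAt (isOpen_Ioo.mem_nhds hτ'))).hasMFDerivWithinAt
  · refine ⟨fun τ => (z, (t, s + τ)), by simp, fun τ hτ => ?_⟩
    have hτ1 : -1 < τ := by linarith [hτ.1, min_le_right ε 1]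
    have hτ2 : τ < 1 := by linarith [hτ.2, min_le_right ε 1]
    have hout : z ∉ C ∨ s + τ < 0 ∨ 1 < s + τ := by
      by_contra! hcon
      exact hp ⟨hcon.1, by linarith [hcon.2.1], by linarith [hcon.2.2]⟩
    obtain ⟨h1, h2⟩ := hk.contactField_eq_zero (q := (t, s + τ)) hout
    refine (hasMFDerivAt_contactField (γ := fun _ => z) (δ := fun τ => (t, s + τ)) ?_ ?_
      ).hasMFDerivWithinAt
    · rw [h1]
      exact (hasMFDerivAt_const z τ).smulRight_one rfl
    · rw [h2]
      exact (hasDerivAt_const τ t).prodMk ((hasDerivAt_id τ).const_add s)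

end IsCutoffHamiltonian

end Liouville

/-! ### Cut-off of K and the transport along its contact field. -/

namespace Liouville

variable {d : ℕ} {M : Type*} [TopologicalSpace M] [T2Space M]
  [ChartedSpace (EuclideanSpace ℝ (Fin d)) M] [IsManifold (𝓡 d) ∞ M] {S : Liouville d M}

section Cutoff

variable {E : M → ℝ} {R μ γ : ℝ} {H K : M → ℝ × ℝ → ℝ}

theorem IsDeformation.continuous (hD : S.IsDeformation E R μ γ H K) :
    Continuous (fun p : M × (ℝ × ℝ) => H p.1 p.2) :=
  S.continuous_of_isHomogeneous
    (fun p hp => (hD.smooth_left p.1 hp.1 p.2).continuousAt.continuousWithinAt) hD.homogeneous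

theorem IsDeformation.periodic_int (hD : S.IsDeformation E R μ γ H K) (z : M) (t s : ℝ) (n : ℤ) :
    H z (t + n, s) = H z (t, s) := by
  have h : Function.Periodic (fun t => H z (t, s)) 1 := fun t => hD.periodic_left z t s
  simpa using h.int_mul n t

/-- By homogeneity and periodicity, compactness of {E = 1} × [0,1]² suffices. The bound keeps the
hypersurfaces {H = 1} away from the core. -/
theorem IsDeformation.exists_le (hD : S.IsDeformation E R μ γ H K)
    (hE : S.IsContactHamiltonian E) (hE_pos : ∀ z ∈ S.star, 0 < E z) :
    ∃ C > 0, ∀ z t, ∀ s ∈ Icc (0 : ℝ) 1, H z (t, s) ≤ C * E z := by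
  have hcomp : IsCompact ({z | E z = 1} ×ˢ (Icc (0 : ℝ) 1 ×ˢ Icc (0 : ℝ) 1)) := by
    refine IsCompact.prod ?_ (isCompact_Icc.prod isCompact_Icc)
    exact (isCompact_sublevel hE.isHomogeneous hE.continuous hE_pos 1).of_isClosed_subset
      (isClosed_singleton.preimage hE.continuous) fun z hz => le_of_eq hz
  obtain ⟨C, hC⟩ := hcomp.exists_bound_of_continuousOn hD.continuous.continuousOn
  refine ⟨|C| + 1, by positivity, fun z t s hs => ?_⟩
  by_cases hz : z ∈ S.star
  · have hEz := hE_pos z hz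
    have h1 := hC (S.flow (-Real.log (E z)) z, (Int.fract t, s))
      ⟨apply_flow_neg_log hE.isHomogeneous hE_pos hz,
        ⟨Int.fract_nonneg t, (Int.fract_lt_one t).le⟩, hs⟩
    have h2 := (hD.homogeneous (Int.fract t, s)).flow z hz (-Real.log (E z))
    rw [Real.exp_neg, Real.exp_log hEz] at h2
    have h3 : H z (Int.fract t, s) = H z (t, s) := by
      have := hD.periodic_int z (Int.fract t) s ⌊t⌋
      rw [← this, Int.fract_add_floor]
    rw [h3] at h2
    have h4 : (E z)⁻¹ * H z (t, s) ≤ C := by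
      rw [← h2]
      exact (le_abs_self _).trans h1
    rw [inv_mul_le_iff₀ hEz, mul_comm] at h4
    nlinarith [le_abs_self C]
  · have hc : z ∈ S.core := not_not.1 hz
    rw [show H z (t, s) = 0 from (hD.homogeneous (t, s)).core z hc, hE.core z hc, mul_zero]

/-- A cut-off of `K` that agrees with `K` near the hypersurfaces `{H = 1}`. -/
theorem IsDeformation.exists_cutoff (hD : S.IsDeformation E R μ γ H K)
    (hE : S.IsContactHamiltonian E) (hE_pos : ∀ z ∈ S.star, 0 < E z) (hm : 0 < 1 / R - μ) :
    ∃ (k : M → ℝ × ℝ → ℝ) (C : Set M), IsCutoffHamiltonian d k C ∧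
      ∀ z t, ∀ s ∈ Icc (0 : ℝ) 1, H z (t, s) = 1 →
        ∀ᶠ p in 𝓝 ((z, (t, s)) : M × (ℝ × ℝ)), p.1 ∈ S.star ∧ k p.1 p.2 = K p.1 p.2 := by
  obtain ⟨C, hC0, hC⟩ := hD.exists_le hE hE_pos
  set m := 1 / R - μ
  -- On {H = 1} the two bounds on H give 1/C ≤ E ≤ 1/m, and a = 1/(2C), b > 1/m place this range
  -- strictly inside (a, b).
  set a := 1 / (2 * C)
  set b := 2 / m + a
  have ha : 0 < a := by positivity
  have hab : a ≤ b := le_add_of_nonneg_left (by positivity)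
  obtain ⟨η, hη, hη1, hη0, hη2⟩ := exists_bump ha hab
  refine ⟨fun z q => η (E z) * K z q, {z | E z ≤ b + a}, ⟨?_, ?_, ?_, ?_⟩, ?_⟩
  · rintro ⟨z, q⟩
    by_cases hz : z ∈ S.star
    · have h1 : ContMDiffAt ((𝓡 d).prod 𝓘(ℝ, ℝ × ℝ)) 𝓘(ℝ, ℝ) ∞
          (fun p : M × (ℝ × ℝ) => η (E p.1)) (z, q) :=
        ContMDiffAt.comp (g := η) (f := fun p : M × (ℝ × ℝ) => E p.1) (z, q)
          hη.contDiffAt.contMDiffAt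
          (ContMDiffAt.comp (g := E) (f := Prod.fst) (z, q) (hE.contMDiffAt hz) contMDiffAt_fst)
      exact h1.mul (hD.smooth_right z hz q)
    · have h0 : E z = 0 := hE.core z (not_not.1 hz)
      have h1 : ∀ᶠ p : M × (ℝ × ℝ) in 𝓝 (z, q), E p.1 < a / 2 :=
        (hE.continuous.comp continuous_fst).continuousAt.eventually
          (gt_mem_nhds (by show E z < a / 2; rw [h0]; positivity))
      refine (contMDiffAt_const (c := (0 : ℝ))).congr_of_eventuallyEq ?_
      filter_upwards [h1] with p hp
      rw [hη0 _ hp.le, zero_mul]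
  · intro z t s
    rw [hD.periodic_right]
  · exact isCompact_sublevel hE.isHomogeneous hE.continuous hE_pos _
  · intro z q h
    show η (E z) * K z q = 0
    by_cases hz : z ∈ S.star
    · rcases h with h | h
      · rw [hη2 _ (le_of_lt (not_le.1 h)), zero_mul]
      · rw [hD.support z hz q h, mul_zero]
    · rw [hE.core z (not_not.1 hz), hη0 0 (by positivity), zero_mul]
  · intro z t s hs h1
    have hlow : 1 / C ≤ E z := by
      rw [div_le_iff₀ hC0, mul_comm, ← h1]
      exact hC z t s hs
    have hup : E z ≤ 1 / m := by
      rw [le_div_iff₀ hm, mul_comm, ← h1]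
      exact hD.lower z t s hs
    have ha' : a < E z := lt_of_lt_of_le (one_div_lt_one_div_of_lt hC0 (by linarith)) hlow
    have hb' : E z < b := by
      have : 1 / m ≤ 2 / m := by gcongr; norm_num
      linarith
    have hE1 : ContinuousAt (fun p : M × (ℝ × ℝ) => E p.1) (z, (t, s)) :=
      (hE.continuous.comp continuous_fst).continuousAt
    have h2 : ∀ᶠ p : M × (ℝ × ℝ) in 𝓝 (z, (t, s)), a < E p.1 ∧ E p.1 < b :=
      (hE1.eventually (lt_mem_nhds ha')).and (hE1.eventually (gt_mem_nhds hb'))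
    filter_upwards [h2] with p hp
    refine ⟨(mem_star_iff_pos hE.isHomogeneous hE_pos).2 (ha.trans hp.1), ?_⟩
    rw [hη1 _ ⟨hp.1.le, hp.2.le⟩, one_mul]

end Cutoff

section Transport

/-- The motion of `M × ℝ` from time `r` to time `s` along a flow on `M × (ℝ × ℝ)` in which the last
coordinate is time. -/
def transport (Φ : ℝ → M × (ℝ × ℝ) → M × (ℝ × ℝ)) (r s : ℝ) (p : M × ℝ) : M × ℝ :=
  ((Φ (s - r) (p.1, (p.2, r))).1, (Φ (s - r) (p.1, (p.2, r))).2.1)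

variable {k : M → ℝ × ℝ → ℝ} {C : Set M} (hk : IsCutoffHamiltonian d k C)
  {Φ : ℝ → M × (ℝ × ℝ) → M × (ℝ × ℝ)} (h0 : ∀ p, Φ 0 p = p)
  (hΦ : ∀ p, IsMIntegralCurve (fun t => Φ t p) (S.contactField k))

include h0 in
theorem transport_self (r : ℝ) (p : M × ℝ) : transport Φ r r p = p := by
  rw [transport, sub_self, h0]

include h0 hΦ

theorem flow_time (τ : ℝ) (p : M × (ℝ × ℝ)) : (Φ τ p).2.2 = p.2.2 + τ := by
  have h1 : ∀ t, HasDerivAt (fun t => (Φ t p).2.2 - t) 0 t := by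
    intro t
    have h2 : HasDerivAt (fun t => (Φ t p).2.2) 1 t :=
      (hasFDerivAt_snd (𝕜 := ℝ) (E := ℝ) (F := ℝ)).comp_hasDerivAt t
        (hasDerivAt_curve_snd (hΦ p t))
    exact (h2.sub (hasDerivAt_id t)).congr_deriv (sub_self (1 : ℝ))
  have h3 := is_const_of_deriv_eq_zero (fun t => (h1 t).differentiableAt) (fun t => (h1 t).deriv) τ 0
  rw [h0, sub_zero] at h3
  linarith

theorem flow_eq_transport (r s : ℝ) (p : M × ℝ) :
    Φ (s - r) (p.1, (p.2, r)) = ((transport Φ r s p).1, ((transport Φ r s p).2, s)) := by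
  refine Prod.ext rfl (Prod.ext rfl ?_)
  rw [flow_time h0 hΦ]
  show r + (s - r) = s
  ring

theorem isMIntegralCurve_transport (r : ℝ) (p : M × ℝ) :
    IsMIntegralCurve (fun s => ((transport Φ r s p).1, ((transport Φ r s p).2, s)))
      (S.contactField k) := by
  have h1 := (hΦ (p.1, (p.2, r))).comp_add (-r)
  have h2 : (fun t => Φ t (p.1, (p.2, r))) ∘ (· + -r) =
      fun s => ((transport Φ r s p).1, ((transport Φ r s p).2, s)) :=
    funext fun s => flow_eq_transport h0 hΦ r s p
  rwa [h2] at h1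

theorem hasMFDerivAt_transport_fst (r s : ℝ) (p : M × ℝ) :
    HasMFDerivAt 𝓘(ℝ, ℝ) (𝓡 d) (fun s => (transport Φ r s p).1) s
      ((1 : ℝ →L[ℝ] ℝ).smulRight
        (S.contactFieldM k (transport Φ r s p).1 ((transport Φ r s p).2, s))) :=
  hasMFDerivAt_curve_fst (isMIntegralCurve_transport h0 hΦ r p s)

theorem hasDerivAt_transport_snd (r s : ℝ) (p : M × ℝ) :
    HasDerivAt (fun s => (transport Φ r s p).2)
      (S.contactFieldT k (transport Φ r s p).1 ((transport Φ r s p).2, s)) s :=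
  (hasFDerivAt_fst (𝕜 := ℝ) (E := ℝ) (F := ℝ)).comp_hasDerivAt s
    (hasDerivAt_curve_snd (isMIntegralCurve_transport h0 hΦ r p s))

include hk

theorem transport_transport (r s s' : ℝ) (p : M × ℝ) :
    transport Φ s s' (transport Φ r s p) = transport Φ r s' p := by
  have h1 := ContactSqueezing.flow_add hk.contMDiff_contactField h0 hΦ (s' - s) (s - r)
    (p.1, (p.2, r))
  rw [flow_eq_transport h0 hΦ r s p] at h1
  rw [transport, ← h1, sub_add_sub_cancel]
  rfl

theorem contMDiff_transport (r : ℝ) :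
    ContMDiff (𝓘(ℝ, ℝ).prod ((𝓡 d).prod 𝓘(ℝ, ℝ))) ((𝓡 d).prod 𝓘(ℝ, ℝ)) ∞
      (fun q : ℝ × (M × ℝ) => transport Φ r q.1 q.2) := by
  have h1 : ContMDiff (𝓘(ℝ, ℝ).prod ((𝓡 d).prod 𝓘(ℝ, ℝ)))
      (𝓘(ℝ, ℝ).prod ((𝓡 d).prod 𝓘(ℝ, ℝ × ℝ))) ∞
      (fun q : ℝ × (M × ℝ) => (q.1 - r, (q.2.1, ((q.2.2, r) : ℝ × ℝ)))) := by
    refine ContMDiff.prodMk (contMDiff_fst.sub contMDiff_const) ?_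
    exact (contMDiff_fst.comp contMDiff_snd).prodMk
      ((contMDiff_snd.comp contMDiff_snd).prodMk_space contMDiff_const)
  have h2 := (ContactSqueezing.contMDiff_flow hk.contMDiff_contactField h0 hΦ).comp h1
  refine (contMDiff_fst.comp h2).prodMk ?_
  have h3 : ContMDiff 𝓘(ℝ, ℝ × ℝ) 𝓘(ℝ, ℝ) ∞ (Prod.fst : ℝ × ℝ → ℝ) := contDiff_fst.contMDiff
  exact h3.comp (contMDiff_snd.comp h2)

/-- Periodicity of the field makes the translate of a trajectory a trajectory, and uniqueness
identifies it; the transport therefore descends to M × S¹. -/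
theorem transport_add_int (r s : ℝ) (z : M) (t : ℝ) (n : ℤ) :
    transport Φ r s (z, t + n) =
      ((transport Φ r s (z, t)).1, (transport Φ r s (z, t)).2 + n) := by
  have h1 : IsMIntegralCurve (fun τ => ((Φ τ (z, (t, r))).1, ((Φ τ (z, (t, r))).2.1 + n,
      (Φ τ (z, (t, r))).2.2))) (S.contactField k) := fun τ =>
    hk.hasMFDerivAt_translate n (hΦ (z, (t, r)) τ)
  have h2 := integralCurve_unique hk.contMDiff_contactField (hΦ (z, (t + n, r))) h1 (t₀ := 0)
    (by simp [h0])
  have h3 := congrFun h2 (s - r)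
  exact Prod.ext (congrArg (fun p : M × (ℝ × ℝ) => p.1) h3 :)
    (congrArg (fun p : M × (ℝ × ℝ) => p.2.1) h3 :)

end Transport

end Liouville

section ChainRule

variable {d : ℕ} {M : Type*} [TopologicalSpace M] [ChartedSpace (EuclideanSpace ℝ (Fin d)) M]
  [IsManifold (𝓡 d) ∞ M]
  {E' : Type*} [NormedAddCommGroup E'] [NormedSpace ℝ E']
  {H : Type*} [TopologicalSpace H] {J : ModelWithCorners ℝ E' H}
  {N : Type*} [TopologicalSpace N] [ChartedSpace H N]

theorem differential_comp_prod {g : M → ℝ → ℝ} {Z : N → M} {T : N → ℝ} {p : N}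
    (hg : MDifferentiableAt ((𝓡 d).prod 𝓘(ℝ, ℝ)) 𝓘(ℝ, ℝ) (fun x : M × ℝ => g x.1 x.2) (Z p, T p))
    (hZ : MDifferentiableAt J (𝓡 d) Z p) (hT : MDifferentiableAt J 𝓘(ℝ, ℝ) T p)
    (w : TangentSpace J p) : differential J (fun p => g (Z p) (T p)) p w =
      differential (𝓡 d) (fun z => g z (T p)) (Z p) (mfderiv J (𝓡 d) Z p w) +
        deriv (g (Z p)) (T p) * differential J T p w := by
  have h1 := (HasMFDerivAt.comp (g := fun x : M × ℝ => g x.1 x.2) (f := fun p => (Z p, T p)) p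
    hg.hasMFDerivAt (hZ.hasMFDerivAt.prodMk hT.hasMFDerivAt)).mfderiv
  have h2 := congrArg (fun A : E' →L[ℝ] ℝ => A w) h1
  refine Eq.trans h2 ?_
  have h3 := mfderiv_prod_eq_add_apply
    (v := ((mfderiv J (𝓡 d) Z p w, mfderiv J 𝓘(ℝ, ℝ) T p w) :
      TangentSpace ((𝓡 d).prod 𝓘(ℝ, ℝ)) (Z p, T p))) hg
  refine Eq.trans h3 ?_
  have h4 : mfderiv 𝓘(ℝ, ℝ) 𝓘(ℝ, ℝ) (fun q => g (Z p) q) (T p) = fderiv ℝ (g (Z p)) (T p) :=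
    mfderiv_eq_fderiv
  refine congrArg (fun a : ℝ => differential (𝓡 d) (fun z => g z (T p)) (Z p)
    (mfderiv J (𝓡 d) Z p w) + a) ?_
  refine Eq.trans (congrArg (fun A : ℝ →L[ℝ] ℝ => A (differential J T p w)) h4) ?_
  rw [mul_comm]
  exact fderiv_eq_smul_deriv _

end ChainRule

/-! ### The transport preserves the contact structure and the hypersurfaces {H = 1}. -/

namespace Liouville

variable {d : ℕ} {M : Type*} [TopologicalSpace M] [T2Space M]
  [ChartedSpace (EuclideanSpace ℝ (Fin d)) M] [IsManifold (𝓡 d) ∞ M] {S : Liouville d M}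
  {k : M → ℝ × ℝ → ℝ} {C : Set M} (hk : IsCutoffHamiltonian d k C)
  {Φ : ℝ → M × (ℝ × ℝ) → M × (ℝ × ℝ)} (h0 : ∀ p, Φ 0 p = p)
  (hΦ : ∀ p, IsMIntegralCurve (fun t => Φ t p) (S.contactField k))
include hk h0 hΦ

/-- The value of the contact form `α - dt` on the image of `w` under the transport. -/
theorem hasDerivAt_contactForm_transport (r s : ℝ) (p : M × ℝ)
    (w : TangentSpace ((𝓡 d).prod 𝓘(ℝ, ℝ)) p) :
    HasDerivAt (fun s => S.α (transport Φ r s p).1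
        (mfderiv ((𝓡 d).prod 𝓘(ℝ, ℝ)) (𝓡 d) (fun p => (transport Φ r s p).1) p w) -
        differential ((𝓡 d).prod 𝓘(ℝ, ℝ)) (fun p => (transport Φ r s p).2) p w)
      (-fderiv ℝ (k (transport Φ r s p).1) ((transport Φ r s p).2, s) (1, 0) *
        (S.α (transport Φ r s p).1
          (mfderiv ((𝓡 d).prod 𝓘(ℝ, ℝ)) (𝓡 d) (fun p => (transport Φ r s p).1) p w) -
          differential ((𝓡 d).prod 𝓘(ℝ, ℝ)) (fun p => (transport Φ r s p).2) p w)) s := by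
  have hsm := contMDiff_transport hk h0 hΦ r
  have hZ : ContMDiff (𝓘(ℝ, ℝ).prod ((𝓡 d).prod 𝓘(ℝ, ℝ))) (𝓡 d) ∞
      (fun q : ℝ × (M × ℝ) => (transport Φ r q.1 q.2).1) := contMDiff_fst.comp hsm
  have hT : ContMDiff (𝓘(ℝ, ℝ).prod ((𝓡 d).prod 𝓘(ℝ, ℝ))) 𝓘(ℝ, ℝ) ∞
      (fun q : ℝ × (M × ℝ) => (transport Φ r q.1 q.2).2) := contMDiff_snd.comp hsm
  have hZs : MDifferentiableAt ((𝓡 d).prod 𝓘(ℝ, ℝ)) (𝓡 d) (fun p => (transport Φ r s p).1) p :=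
    ((hZ (s, p)).comp p (contMDiffAt_const.prodMk contMDiffAt_id)).mdifferentiableAt (by simp)
  have hTs : MDifferentiableAt ((𝓡 d).prod 𝓘(ℝ, ℝ)) 𝓘(ℝ, ℝ)
      (fun p => (transport Φ r s p).2) p :=
    ((hT (s, p)).comp p (contMDiffAt_const.prodMk contMDiffAt_id)).mdifferentiableAt (by simp)
  have h1 := hasDerivAt_form_mfderiv S.smooth_α (Θ := fun s p => (transport Φ r s p).1) (hZ (s, p)) w
  have h2 := hasDerivAt_differential (T := fun s p => (transport Φ r s p).2) (hT (s, p)) w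
  -- Cartan's formula handles α and the exchange of derivatives handles dt. The terms d(dk(L))
  -- cancel, leaving dk of the image vector plus ω(field, image vector).
  refine (h1.sub h2).congr_deriv ?_
  have hvel : ∀ p, velocity (fun s => (transport Φ r s p).1) s =
      S.contactFieldM k (transport Φ r s p).1 ((transport Φ r s p).2, s) := by
    intro p
    have h3 := (hasMFDerivAt_transport_fst h0 hΦ r s p).mfderiv
    refine Eq.trans (congrArg (fun A : ℝ →L[ℝ] EuclideanSpace ℝ (Fin d) => A 1) h3) ?_
    exact one_smul ℝ (show EuclideanSpace ℝ (Fin d) from S.contactFieldM k _ _)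
  have hαvel : (fun p => S.α (transport Φ r s p).1 (velocity (fun s => (transport Φ r s p).1) s)) =
      fun p => differential (𝓡 d) (fun z => k z ((transport Φ r s p).2, s)) (transport Φ r s p).1
        (S.L (transport Φ r s p).1) := by
    ext p
    rw [hvel, contactFieldM, map_sub, map_smul, S.α_L, S.α_sharp, smul_zero, sub_zero]
  have hder : (fun p => deriv (fun s => (transport Φ r s p).2) s) =
      fun p => differential (𝓡 d) (fun z => k z ((transport Φ r s p).2, s)) (transport Φ r s p).1
        (S.L (transport Φ r s p).1) - k (transport Φ r s p).1 ((transport Φ r s p).2, s) := by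
    ext p
    exact (hasDerivAt_transport_snd h0 hΦ r s p).deriv
  rw [hαvel, hder]
  set Z : M × ℝ → M := fun p => (transport Φ r s p).1
  set T : M × ℝ → ℝ := fun p => (transport Φ r s p).2
  have hslice : ContMDiff ((𝓡 d).prod 𝓘(ℝ, ℝ)) ((𝓡 d).prod 𝓘(ℝ, ℝ × ℝ)) ∞
      (fun x : M × ℝ => (x.1, ((x.2, s) : ℝ × ℝ))) :=
    contMDiff_fst.prodMk (contMDiff_snd.prodMk_space contMDiff_const)
  have hZT : MDifferentiableAt ((𝓡 d).prod 𝓘(ℝ, ℝ)) ((𝓡 d).prod 𝓘(ℝ, ℝ × ℝ))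
      (fun p => (Z p, ((T p, s) : ℝ × ℝ))) p :=
    ((hslice (Z p, T p)).mdifferentiableAt (by simp)).comp (f := fun p => (Z p, T p)) p
      (hZs.prodMk hTs)
  have hA : MDifferentiableAt ((𝓡 d).prod 𝓘(ℝ, ℝ)) 𝓘(ℝ, ℝ)
      (fun p => differential (𝓡 d) (fun z => k z (T p, s)) (Z p) (S.L (Z p))) p :=
    MDifferentiableAt.comp p (f := fun p => (Z p, ((T p, s) : ℝ × ℝ)))
      ((hk.contMDiff_differential_L (S := S) (Z p, (T p, s))).mdifferentiableAt (by simp)) hZT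
  have hB : MDifferentiableAt ((𝓡 d).prod 𝓘(ℝ, ℝ)) 𝓘(ℝ, ℝ) (fun p => k (Z p) (T p, s)) p :=
    MDifferentiableAt.comp p (f := fun p => (Z p, ((T p, s) : ℝ × ℝ)))
      ((hk.smooth (Z p, (T p, s))).mdifferentiableAt (by simp)) hZT
  have hdB := differential_comp_prod (g := fun z t => k z (t, s)) (Z := Z) (T := T)
    (((hk.smooth (Z p, (T p, s))).mdifferentiableAt (by simp)).comp
      (f := fun x : M × ℝ => (x.1, ((x.2, s) : ℝ × ℝ))) (Z p, T p)
      ((hslice (Z p, T p)).mdifferentiableAt (by simp))) hZs hTs w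
  have hsub : differential ((𝓡 d).prod 𝓘(ℝ, ℝ))
      (fun p => differential (𝓡 d) (fun z => k z (T p, s)) (Z p) (S.L (Z p)) - k (Z p) (T p, s))
      p w = differential ((𝓡 d).prod 𝓘(ℝ, ℝ))
        (fun p => differential (𝓡 d) (fun z => k z (T p, s)) (Z p) (S.L (Z p))) p w -
        differential ((𝓡 d).prod 𝓘(ℝ, ℝ)) (fun p => k (Z p) (T p, s)) p w :=
    congrArg (fun A : EuclideanSpace ℝ (Fin d) × ℝ →L[ℝ] ℝ => A w) (mfderiv_sub hA hB)
  have hkt : deriv (fun t => k (Z p) (t, s)) (T p) = fderiv ℝ (k (Z p)) (T p, s) (1, 0) := by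
    have h3 : DifferentiableAt ℝ (k (Z p)) (T p, s) :=
      mdifferentiableAt_iff_differentiableAt.1
        (((hk.smooth (Z p, (T p, s))).comp (T p, s) contMDiffAt_prodMk_right).mdifferentiableAt
          (by simp))
    have h4 : HasDerivAt (fun t : ℝ => ((t, s) : ℝ × ℝ)) (1, 0) (T p) :=
      (hasDerivAt_id (T p)).prodMk (hasDerivAt_const (T p) s)
    exact (HasFDerivAt.comp_hasDerivAt (f := fun t : ℝ => ((t, s) : ℝ × ℝ)) (T p) h3.hasFDerivAt
      h4).deriv
  set V := mfderiv ((𝓡 d).prod 𝓘(ℝ, ℝ)) (𝓡 d) Z p w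
  -- The term ω(sgrad k, V) = -dk(V) cancels the M-part of dk; what remains is -∂_t k times α - dt.
  have hω : dForm S.α (Z p) (velocity (fun s => (transport Φ r s p).1) s) V =
      -differential (𝓡 d) (fun z => k z (T p, s)) (Z p) V -
        fderiv ℝ (k (Z p)) (T p, s) (1, 0) * S.α (Z p) V := by
    have h3 : dForm S.α (Z p) (velocity (fun s => (transport Φ r s p).1) s) V =
        dForm S.α (Z p) (S.contactFieldM k (Z p) (T p, s)) V :=
      congrArg (fun X => dForm S.α (Z p) X V) (hvel p)
    rw [h3, contactFieldM, dForm_sub_left, dForm_smul_left, S.contraction, dForm_swap]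
    have h4 := S.symp_sharp (differential (𝓡 d) (fun z => k z (T p, s)) (Z p)) V
    rw [symp] at h4
    rw [h4]
  rw [hkt] at hdB
  rw [hsub, hdB]
  refine Eq.trans (congrArg (fun a : ℝ => _ + a - _) hω) ?_
  ring

theorem continuous_transport_left (r : ℝ) (p : M × ℝ) : Continuous fun s => transport Φ r s p :=
  (contMDiff_transport hk h0 hΦ r).continuous.comp (Continuous.prodMk_left p)

theorem continuous_conformalFactor (r : ℝ) (p : M × ℝ) : Continuous fun s =>
    -fderiv ℝ (k (transport Φ r s p).1) ((transport Φ r s p).2, s) (1, 0) := by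
  have h1 : Continuous fun p : M × (ℝ × ℝ) => fderiv ℝ (k p.1) p.2 := by
    have h2 : ContMDiff ((𝓡 d).prod 𝓘(ℝ, ℝ × ℝ)) 𝓘(ℝ, ℝ × ℝ →L[ℝ] ℝ) ∞
        (fun p : M × (ℝ × ℝ) => fderiv ℝ (k p.1) p.2) := fun p =>
      contMDiffAt_fderiv_snd (hk.smooth p)
    exact h2.continuous
  have h2 := continuous_transport_left hk h0 hΦ r p
  have h3 : Continuous fun s => ((transport Φ r s p).1, ((transport Φ r s p).2, s)) :=
    (continuous_fst.comp h2).prodMk ((continuous_snd.comp h2).prodMk continuous_id)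
  exact ((h1.comp h3).clm_apply continuous_const).neg

/-- The transport preserves the contact structure `ker (α - dt)`. -/
theorem contactForm_transport (r s : ℝ) (p : M × ℝ) (w : TangentSpace ((𝓡 d).prod 𝓘(ℝ, ℝ)) p) :
    ∃ c > 0, S.α (transport Φ r s p).1
        (mfderiv ((𝓡 d).prod 𝓘(ℝ, ℝ)) (𝓡 d) (fun p => (transport Φ r s p).1) p w) -
        differential ((𝓡 d).prod 𝓘(ℝ, ℝ)) (fun p => (transport Φ r s p).2) p w =
      c * (S.α p.1 w.1 - w.2) := by
  have h1 := linear_ode (continuous_conformalFactor hk h0 hΦ r p)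
    (a := min r s - 1) (b := max r s + 1)
    (fun s _ => hasDerivAt_contactForm_transport hk h0 hΦ r s p w) (s := s) (s' := r)
    ⟨by linarith [min_le_right r s], by linarith [le_max_right r s]⟩
    ⟨by linarith [min_le_left r s], by linarith [le_max_left r s]⟩
  refine ⟨_, Real.exp_pos _, h1.trans (congrArg₂ (fun a b : ℝ => a * b) rfl ?_)⟩
  have h2 : (fun p => (transport Φ r r p).1) = Prod.fst := funext fun p => by
    rw [transport_self h0]
  have h3 : (fun p => (transport Φ r r p).2) = Prod.snd := funext fun p => by
    rw [transport_self h0]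
  have h4 : S.α (transport Φ r r p).1
      (mfderiv ((𝓡 d).prod 𝓘(ℝ, ℝ)) (𝓡 d) (fun p => (transport Φ r r p).1) p w) =
      S.α p.1 w.1 := by
    refine form_congr (by rw [transport_self h0]) ?_
    rw [h2]
    exact congrArg (fun A : EuclideanSpace ℝ (Fin d) × ℝ →L[ℝ] EuclideanSpace ℝ (Fin d) => A w)
      (mfderiv_fst (I := 𝓡 d) (I' := 𝓘(ℝ, ℝ)) (x := p))
  have h5 : differential ((𝓡 d).prod 𝓘(ℝ, ℝ)) (fun p => (transport Φ r r p).2) p w = w.2 := by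
    rw [h3]
    exact congrArg (fun A : EuclideanSpace ℝ (Fin d) × ℝ →L[ℝ] ℝ => A w)
      (mfderiv_snd (I := 𝓡 d) (I' := 𝓘(ℝ, ℝ)) (x := p))
  rw [h4]
  exact congrArg (fun a : ℝ => S.α p.1 w.1 - a) h5

section Levels

variable {E : M → ℝ} {R μ γ : ℝ} {H K : M → ℝ × ℝ → ℝ} (hD : S.IsDeformation E R μ γ H K)
  (hkK : ∀ z t, ∀ s ∈ Icc (0 : ℝ) 1, H z (t, s) = 1 →
    ∀ᶠ p in 𝓝 ((z, (t, s)) : M × (ℝ × ℝ)), p.1 ∈ S.star ∧ k p.1 p.2 = K p.1 p.2)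
include hD

/-- Where k = K the t-component of the field vanishes by homogeneity of K. Homogeneity of H gives
dH(L) = H, and the curvature equation turns the derivative into -∂_t K (H - 1), the same linear
equation as for the contact form. -/
theorem hasDerivAt_level {r s : ℝ} {p : M × ℝ}
    (h : ∀ᶠ x in 𝓝 (((transport Φ r s p).1, ((transport Φ r s p).2, s)) : M × (ℝ × ℝ)),
      x.1 ∈ S.star ∧ k x.1 x.2 = K x.1 x.2) :
    HasDerivAt (fun s => H (transport Φ r s p).1 ((transport Φ r s p).2, s) - 1)
      (-fderiv ℝ (k (transport Φ r s p).1) ((transport Φ r s p).2, s) (1, 0) *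
        (H (transport Φ r s p).1 ((transport Φ r s p).2, s) - 1)) s := by
  have hz := h.self_of_nhds.1
  have h1 := hasDerivAt_comp_prod (g := H) (γ := fun s => (transport Φ r s p).1)
    (δ := fun s => ((transport Φ r s p).2, s))
    ((hD.smooth_left _ hz _).mdifferentiableAt (by simp)) (hasMFDerivAt_transport_fst h0 hΦ r s p)
    ((hasDerivAt_transport_snd h0 hΦ r s p).prodMk (hasDerivAt_id s))
  refine (h1.sub_const 1).congr_deriv ?_
  set z := (transport Φ r s p).1
  set t := (transport Φ r s p).2
  have hK1 : (fun z => k z (t, s)) =ᶠ[𝓝 z] fun z => K z (t, s) :=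
    (Continuous.prodMk_left ((t, s) : ℝ × ℝ)).continuousAt.eventually (h.mono fun x hx => hx.2)
  have hK2 : k z =ᶠ[𝓝 (t, s)] K z :=
    (Continuous.prodMk_right z).continuousAt.eventually (h.mono fun x hx => hx.2)
  have hdK := differential_congr (d := d) hK1
  have hT : S.contactFieldT k z (t, s) = 0 := by
    rw [contactFieldT, hdK, hD.differential_right z hz, hK2.self_of_nhds, sub_self]
  have hL := (hD.homogeneous (t, s)).differential_L hz
    (((hD.smooth_left z hz (t, s)).comp z contMDiffAt_prodMk_left).mdifferentiableAt (by simp))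
  have hc := hD.curvature z hz (t, s)
  rw [hT, contactFieldM, map_sub, map_smul, hL, hdK, hK2.fderiv_eq, smul_eq_mul]
  linear_combination hc

include hkK

/-- The linear equation is available only near {H = 1}, where k = K, and this suffices: along a
trajectory the zeros of H - 1 form an open and closed set of times. Either H - 1 vanishes
identically, or it has no zero and keeps its sign. -/
theorem level_lt_iff (p : M × ℝ) {s : ℝ} (hs : s ∈ Icc (0 : ℝ) 1) :
    H (transport Φ 0 s p).1 ((transport Φ 0 s p).2, s) < 1 ↔ H p.1 (p.2, 0) < 1 := by
  set u : ℝ → ℝ := fun s => H (transport Φ 0 s p).1 ((transport Φ 0 s p).2, s) - 1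
  have htr := continuous_transport_left hk h0 hΦ 0 p
  have hcur : Continuous fun s => ((transport Φ 0 s p).1, ((transport Φ 0 s p).2, s)) :=
    (continuous_fst.comp htr).prodMk ((continuous_snd.comp htr).prodMk continuous_id)
  have hu : Continuous u := (hD.continuous.comp hcur).sub continuous_const
  -- Near a time with H = 1 the linear equation holds, so a zero of u there persists.
  have hlocal : ∀ s ∈ Icc (0 : ℝ) 1, u s = 0 → ∀ᶠ s' in 𝓝 s, u s' = 0 := by
    intro s hs hus
    have h1 := hkK _ _ s hs (sub_eq_zero.1 hus)
    have h2 : ∀ᶠ s' in 𝓝 s,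
        HasDerivAt u (-fderiv ℝ (k (transport Φ 0 s' p).1) ((transport Φ 0 s' p).2, s') (1, 0) *
          u s') s' := by
      filter_upwards [hcur.continuousAt.eventually h1.eventually_nhds] with s' hs'
      exact hasDerivAt_level hk h0 hΦ hD hs'
    obtain ⟨ε, hε, hball⟩ := Metric.eventually_nhds_iff.1 h2
    have h3 : ∀ s' ∈ Ioo (s - ε) (s + ε), u s' = 0 := by
      intro s' hs'
      have h4 := linear_ode (continuous_conformalFactor hk h0 hΦ 0 p) (u := u)
        (a := s - ε) (b := s + ε) (fun τ hτ => hball (by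
          rw [Real.dist_eq, abs_lt]; constructor <;> linarith [hτ.1, hτ.2])) hs'
        (s' := s) ⟨by linarith, by linarith⟩
      rw [h4, hus, mul_zero]
    filter_upwards [Ioo_mem_nhds (by linarith : s - ε < s) (by linarith : s < s + ε)] with s' hs'
    exact h3 s' hs'
  have h1 : u 0 = H p.1 (p.2, 0) - 1 := by
    simp only [u, transport_self h0]
  suffices h : u s < 0 ↔ u 0 < 0 by
    rw [h1] at h
    exact sub_neg.symm.trans (h.trans sub_neg)
  by_cases hz : ∃ s₀ ∈ Icc (0 : ℝ) 1, u s₀ = 0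
  · obtain ⟨s₀, hs₀, hus₀⟩ := hz
    have : PreconnectedSpace (Icc (0 : ℝ) 1) := Subtype.preconnectedSpace isPreconnected_Icc
    have hclopen : IsClopen {x : Icc (0 : ℝ) 1 | u x = 0} := by
      refine ⟨isClosed_singleton.preimage (hu.comp continuous_subtype_val),
        isOpen_iff_mem_nhds.2 fun x hx => ?_⟩
      exact continuous_subtype_val.continuousAt.eventually (hlocal x x.2 hx)
    have hall := hclopen.eq_univ ⟨⟨s₀, hs₀⟩, hus₀⟩
    have hall' : ∀ x : Icc (0 : ℝ) 1, u x = 0 := fun x => hall.symm.subset (mem_univ x)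
    rw [hall' ⟨s, hs⟩, hall' ⟨0, by simp⟩]
  · push Not at hz
    have hivt : ∀ a ∈ Icc (0 : ℝ) 1, ∀ b ∈ Icc (0 : ℝ) 1, u a < 0 → u b < 0 := by
      intro a ha b hb hua
      by_contra! hub
      obtain ⟨c, hc, hc0⟩ := isPreconnected_Icc.intermediate_value ha hb hu.continuousOn
        ⟨hua.le, hub⟩
      exact hz c hc hc0
    exact ⟨hivt s hs 0 (by simp), hivt 0 (by simp) s hs⟩

end Levels

end Liouville

/-! ### The covering of the circle and its local inverses. -/

section CircleParam

open Real

/-- The covering `ℝ → S¹ = ℝ/ℤ`. -/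
noncomputable def circleParam (t : ℝ) : Circle := Circle.exp (2 * π * t)

/-- A right inverse of the covering `ℝ → S¹`, smooth near the image of `t₀`. -/
noncomputable def circleLift (t₀ : ℝ) (θ : Circle) : ℝ :=
  t₀ + Complex.arg ((θ / circleParam t₀ : Circle) : ℂ) / (2 * π)

theorem circleParam_add (t t' : ℝ) : circleParam (t + t') = circleParam t * circleParam t' := by
  rw [circleParam, mul_add, Circle.exp_add]
  rfl

theorem circleParam_int (n : ℤ) : circleParam n = 1 := Circle.exp_two_pi_mul_int n

theorem circleParam_circleLift (t₀ : ℝ) (θ : Circle) : circleParam (circleLift t₀ θ) = θ := by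
  rw [circleLift, circleParam_add]
  have h : circleParam (Complex.arg ((θ / circleParam t₀ : Circle) : ℂ) / (2 * π)) =
      θ / circleParam t₀ := by
    rw [circleParam, mul_div_cancel₀ _ (by positivity), Circle.exp_arg]
  rw [h, mul_div_cancel]

theorem circleParam_eq_iff {t t' : ℝ} (h : circleParam t = circleParam t') :
    ∃ n : ℤ, t = t' + n := by
  obtain ⟨n, hn⟩ := Circle.exp_eq_exp.1 h
  refine ⟨n, ?_⟩
  have hπ := Real.pi_pos
  have : 2 * π * (t - (t' + n)) = 0 := by linear_combination hn
  rcases mul_eq_zero.1 this with h1 | h1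
  · linarith
  · linarith

/-- Within 1/2 of t₀ the angle relative to t₀ stays in (-π, π), away from the cut of the argument.
-/
theorem circleLift_circleParam (t₀ : ℝ) : ∀ᶠ t in 𝓝 t₀, circleLift t₀ (circleParam t) = t := by
  filter_upwards [Ioo_mem_nhds (by linarith : t₀ - 1 / 2 < t₀) (by linarith : t₀ < t₀ + 1 / 2)]
    with t ht
  have hπ := Real.pi_pos
  have h1 : circleParam t / circleParam t₀ = Circle.exp (2 * π * (t - t₀)) := by
    rw [div_eq_iff_eq_mul]
    show circleParam t = circleParam (t - t₀) * circleParam t₀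
    rw [← circleParam_add, sub_add_cancel]
  rw [circleLift, h1, Circle.arg_exp (by nlinarith [ht.1]) (by nlinarith [ht.2])]
  field_simp
  ring

theorem contMDiff_circleParam : ContMDiff 𝓘(ℝ, ℝ) (𝓡 1) ∞ circleParam := by
  have h : ContMDiff 𝓘(ℝ, ℝ) 𝓘(ℝ, ℝ) ∞ (fun t : ℝ => 2 * π * t) :=
    (contDiff_const.mul contDiff_id).contMDiff
  exact contMDiff_circleExp.comp h

theorem contMDiff_circle_coe : ContMDiff (𝓡 1) 𝓘(ℝ, ℂ) ∞ (fun z : Circle => (z : ℂ)) :=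
  haveI : Fact (Module.finrank ℝ ℂ = 1 + 1) := finrank_real_complex_fact'
  contMDiff_coe_sphere

/-- The covering has derivative 2πi times itself, and the conjugate factor in `dtForm` removes the
point of the circle; 1/(2π) is the right normalization. -/
theorem dtForm_mfderiv_circleParam (t τ : ℝ) :
    dtForm (circleParam t) (mfderiv 𝓘(ℝ, ℝ) (𝓡 1) circleParam t τ) = τ := by
  have h1 := mfderiv_comp t ((contMDiff_circle_coe (circleParam t)).mdifferentiableAt (by simp))
    ((contMDiff_circleParam t).mdifferentiableAt (by simp))
  have h2 : HasDerivAt (fun t : ℝ => (circleParam t : ℂ))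
      ((circleParam t : ℂ) * (2 * π * Complex.I)) t := by
    have h3 : (fun t : ℝ => (circleParam t : ℂ)) =
        fun t : ℝ => Complex.exp (2 * π * Complex.I * t) := by
      ext t
      rw [circleParam, Circle.coe_exp]
      congr 1
      push_cast
      ring
    have h4 := ((hasDerivAt_id (t : ℂ)).const_mul (2 * π * Complex.I)).cexp.comp_ofReal
    simp only [id_eq, mul_one] at h4
    have h5 : (circleParam t : ℂ) = Complex.exp (2 * π * Complex.I * t) := congrFun h3 t
    rw [h3, h5]
    exact h4
  have h5 : mfderiv (𝓡 1) 𝓘(ℝ, ℂ) (fun z : Circle => (z : ℂ)) (circleParam t)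
      (mfderiv 𝓘(ℝ, ℝ) (𝓡 1) circleParam t τ) =
      (τ : ℂ) * ((circleParam t : ℂ) * (2 * (π : ℂ) * Complex.I)) := by
    refine (congrArg (fun A : ℝ →L[ℝ] ℂ => A τ) h1).symm.trans ?_
    rw [mfderiv_eq_fderiv]
    refine Eq.trans (congrArg (fun A : ℝ →L[ℝ] ℂ => A τ) h2.hasFDerivAt.fderiv) ?_
    simp
  have h6 : (starRingEnd ℂ) (circleParam t : ℂ) * (circleParam t : ℂ) = 1 := by
    rw [mul_comm, Complex.mul_conj]
    simp
  show (2 * π)⁻¹ * ((starRingEnd ℂ) (circleParam t : ℂ) *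
    (show ℂ from mfderiv (𝓡 1) 𝓘(ℝ, ℂ) (fun z : Circle => (z : ℂ)) (circleParam t)
      (mfderiv 𝓘(ℝ, ℝ) (𝓡 1) circleParam t τ))).im = τ
  have h7 : (starRingEnd ℂ) (circleParam t : ℂ) *
      ((τ : ℂ) * ((circleParam t : ℂ) * (2 * (π : ℂ) * Complex.I))) =
      ((τ * (2 * π) : ℝ) : ℂ) * Complex.I := by
    push_cast
    linear_combination (τ * (2 * (π : ℂ) * Complex.I)) * h6
  refine Eq.trans (congrArg (fun w : ℂ => (2 * π)⁻¹ * ((starRingEnd ℂ) (circleParam t : ℂ) *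
    w).im) h5) ?_
  refine Eq.trans (congrArg (fun w : ℂ => (2 * π)⁻¹ * w.im) h7) ?_
  have hπ := Real.pi_pos.ne'
  rw [Complex.im_ofReal_mul, Complex.I_im]
  field_simp

theorem surjective_mfderiv_circleParam (t : ℝ) :
    Function.Surjective (mfderiv 𝓘(ℝ, ℝ) (𝓡 1) circleParam t) := by
  have hinj : Function.Injective (mfderiv 𝓘(ℝ, ℝ) (𝓡 1) circleParam t) := by
    intro a b hab
    rw [← dtForm_mfderiv_circleParam t a, ← dtForm_mfderiv_circleParam t b, hab]
  let A : ℝ →ₗ[ℝ] EuclideanSpace ℝ (Fin 1) := (mfderiv 𝓘(ℝ, ℝ) (𝓡 1) circleParam t).toLinearMap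
  exact (LinearMap.injective_iff_surjective_of_finrank_eq_finrank (f := A) (by simp)).1 hinj

theorem contMDiffAt_circleLift (t₀ : ℝ) :
    ContMDiffAt (𝓡 1) 𝓘(ℝ, ℝ) ∞ (circleLift t₀) (circleParam t₀) := by
  have h1 : IsManifold (𝓡 1) ∞ Circle := IsManifold.of_le (n := ω) (by simp)
  refine contMDiffAt_leftInverse (contMDiff_circleParam t₀) ⟨?_, surjective_mfderiv_circleParam t₀⟩
    (circleLift_circleParam t₀)
  intro a b hab
  rw [← dtForm_mfderiv_circleParam t₀ a, ← dtForm_mfderiv_circleParam t₀ b, hab]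

end CircleParam

section MFDeriv

variable {E₁ : Type*} [NormedAddCommGroup E₁] [NormedSpace ℝ E₁]
  {H₁ : Type*} [TopologicalSpace H₁] {I₁ : ModelWithCorners ℝ E₁ H₁}
  {N₁ : Type*} [TopologicalSpace N₁] [ChartedSpace H₁ N₁]
  {E₂ : Type*} [NormedAddCommGroup E₂] [NormedSpace ℝ E₂]
  {H₂ : Type*} [TopologicalSpace H₂] {I₂ : ModelWithCorners ℝ E₂ H₂}
  {N₂ : Type*} [TopologicalSpace N₂] [ChartedSpace H₂ N₂]

theorem injective_mfderiv_of_leftInverse {φ : N₁ → N₂} {ψ : N₂ → N₁} {x : N₁}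
    (hφ : MDifferentiableAt I₁ I₂ φ x) (hψ : MDifferentiableAt I₂ I₁ ψ (φ x))
    (h : ∀ y, ψ (φ y) = y) : Function.Injective (mfderiv I₁ I₂ φ x) := by
  have h1 := mfderiv_comp x hψ hφ
  have h2 : ψ ∘ φ = id := funext h
  have key : ∀ v : E₁, mfderiv I₂ I₁ ψ (φ x) (mfderiv I₁ I₂ φ x v) = v := by
    intro v
    have h3 := congrArg (fun G : N₁ → N₁ => (mfderiv I₁ I₁ G x : E₁ →L[ℝ] E₁) v) h2
    have h4 : mfderiv I₁ I₁ (id : N₁ → N₁) x v = v :=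
      congrArg (fun A : E₁ →L[ℝ] E₁ => A v) (mfderiv_id (I := I₁) (x := x))
    exact (congrArg (fun A : E₁ →L[ℝ] E₁ => A v) h1).symm.trans (h3.trans h4)
  intro v w hvw
  rw [← key v, ← key w]
  exact congrArg (mfderiv I₂ I₁ ψ (φ x)) hvw

end MFDeriv

/-! ### Descent of the transport to M × S¹. -/

namespace Liouville

variable {d : ℕ} {M : Type*} [TopologicalSpace M] [T2Space M]
  [ChartedSpace (EuclideanSpace ℝ (Fin d)) M] [IsManifold (𝓡 d) ∞ M] {S : Liouville d M}
  {k : M → ℝ × ℝ → ℝ} {C : Set M} (hk : IsCutoffHamiltonian d k C)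
  {Φ : ℝ → M × (ℝ × ℝ) → M × (ℝ × ℝ)} (h0 : ∀ p, Φ 0 p = p)
  (hΦ : ∀ p, IsMIntegralCurve (fun t => Φ t p) (S.contactField k))

/-- The covering `M × ℝ → M × S¹`. -/
noncomputable def covering (p : M × ℝ) : M × Circle := (p.1, circleParam p.2)

theorem contMDiff_covering :
    ContMDiff ((𝓡 d).prod 𝓘(ℝ, ℝ)) ((𝓡 d).prod (𝓡 1)) ∞ (covering : M × ℝ → M × Circle) :=
  contMDiff_fst.prodMk (contMDiff_circleParam.comp contMDiff_snd)

theorem surjective_covering : Function.Surjective (covering : M × ℝ → M × Circle) := fun x =>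
  ⟨(x.1, circleLift 0 x.2), Prod.ext rfl (circleParam_circleLift 0 x.2)⟩

/-- The transport on `M × S¹` induced by the 1-periodic transport on `M × ℝ`. -/
noncomputable def circleTransport (Φ : ℝ → M × (ℝ × ℝ) → M × (ℝ × ℝ)) (r s : ℝ) (x : M × Circle) :
    M × Circle :=
  covering (transport Φ r s (x.1, circleLift 0 x.2))

/-- The contact form on the derivative of a map to `M × S¹` that lifts to `M × ℝ`. -/
theorem contactForm_mfderiv_covering {Z : M × ℝ → M} {T : M × ℝ → ℝ} {p : M × ℝ}
    (hZ : MDifferentiableAt ((𝓡 d).prod 𝓘(ℝ, ℝ)) (𝓡 d) Z p)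
    (hT : MDifferentiableAt ((𝓡 d).prod 𝓘(ℝ, ℝ)) 𝓘(ℝ, ℝ) T p)
    (w : TangentSpace ((𝓡 d).prod 𝓘(ℝ, ℝ)) p) :
    S.contactForm (Z p, circleParam (T p)) (mfderiv ((𝓡 d).prod 𝓘(ℝ, ℝ)) ((𝓡 d).prod (𝓡 1))
      (fun p => (Z p, circleParam (T p))) p w) =
      S.α (Z p) (mfderiv ((𝓡 d).prod 𝓘(ℝ, ℝ)) (𝓡 d) Z p w) -
        differential ((𝓡 d).prod 𝓘(ℝ, ℝ)) T p w := by
  have hθ := HasMFDerivAt.comp p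
    ((contMDiff_circleParam (T p)).mdifferentiableAt (by simp)).hasMFDerivAt hT.hasMFDerivAt
  have h1 := (hZ.hasMFDerivAt.prodMk hθ).mfderiv
  have h2 := congrArg (fun A : EuclideanSpace ℝ (Fin d) × ℝ →L[ℝ]
    EuclideanSpace ℝ (Fin d) × EuclideanSpace ℝ (Fin 1) => A w) h1
  refine Eq.trans (congrArg (S.contactForm (Z p, circleParam (T p))) h2) ?_
  refine congrArg (fun a : ℝ => S.α (Z p) (mfderiv ((𝓡 d).prod 𝓘(ℝ, ℝ)) (𝓡 d) Z p w) - a) ?_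
  exact dtForm_mfderiv_circleParam (T p) _

theorem surjective_mfderiv_covering (p : M × ℝ) : Function.Surjective
    (mfderiv ((𝓡 d).prod 𝓘(ℝ, ℝ)) ((𝓡 d).prod (𝓡 1)) (covering : M × ℝ → M × Circle) p) := by
  rintro ⟨v, τ⟩
  obtain ⟨c, hc⟩ := surjective_mfderiv_circleParam p.2 τ
  refine ⟨(v, c), ?_⟩
  have hθ := HasMFDerivAt.comp p
    ((contMDiff_circleParam p.2).mdifferentiableAt (by simp)).hasMFDerivAt
    (hasMFDerivAt_snd (I := 𝓡 d) (I' := 𝓘(ℝ, ℝ)) p)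
  have h1 := ((hasMFDerivAt_fst (I := 𝓡 d) (I' := 𝓘(ℝ, ℝ)) p).prodMk hθ).mfderiv
  have h2 := congrArg (fun A : EuclideanSpace ℝ (Fin d) × ℝ →L[ℝ]
    EuclideanSpace ℝ (Fin d) × EuclideanSpace ℝ (Fin 1) => A (v, c)) h1
  refine Eq.trans h2 ?_
  exact Prod.ext rfl hc

include hk h0 hΦ

/-- Two lifts of a point differ by an integer, which the transport respects and the covering
forgets. -/
theorem circleTransport_covering (r s : ℝ) (p : M × ℝ) :
    circleTransport Φ r s (covering p) = covering (transport Φ r s p) := by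
  obtain ⟨n, hn⟩ := circleParam_eq_iff (circleParam_circleLift 0 (circleParam p.2))
  have h1 : ((covering p).1, circleLift 0 (covering p).2) = (p.1, p.2 + (n : ℝ)) :=
    Prod.ext rfl hn
  rw [circleTransport, h1, transport_add_int hk h0 hΦ]
  refine Prod.ext rfl ?_
  show circleParam (_ + (n : ℝ)) = circleParam _
  rw [circleParam_add, circleParam_int, mul_one]

theorem circleTransport_circleTransport (r s s' : ℝ) (x : M × Circle) :
    circleTransport Φ s s' (circleTransport Φ r s x) = circleTransport Φ r s' x := by
  obtain ⟨p, rfl⟩ := surjective_covering x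
  simp only [circleTransport_covering hk h0 hΦ, transport_transport hk h0 hΦ]

theorem circleTransport_self (r : ℝ) (x : M × Circle) : circleTransport Φ r r x = x := by
  obtain ⟨p, rfl⟩ := surjective_covering x
  rw [circleTransport_covering hk h0 hΦ, transport_self h0]

/-- The lift based at 0 has a cut, but it may be replaced by the lift based at p.2, which is smooth
near the point considered and yields the same map on M × S¹. -/
theorem contMDiff_circleTransport (r : ℝ) :
    ContMDiff (𝓘(ℝ, ℝ).prod ((𝓡 d).prod (𝓡 1))) ((𝓡 d).prod (𝓡 1)) ∞
      (fun q : ℝ × (M × Circle) => circleTransport Φ r q.1 q.2) := by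
  rintro ⟨s, x⟩
  obtain ⟨p, rfl⟩ := surjective_covering x
  have h1 : (fun q : ℝ × (M × Circle) => circleTransport Φ r q.1 q.2) =
      fun q => covering (transport Φ r q.1 (q.2.1, circleLift p.2 q.2.2)) := by
    ext1 q
    rw [← circleTransport_covering hk h0 hΦ]
    congr 1
    exact Prod.ext rfl (circleParam_circleLift p.2 q.2.2).symm
  rw [h1]
  have h2 : ContMDiffAt (𝓘(ℝ, ℝ).prod ((𝓡 d).prod (𝓡 1))) 𝓘(ℝ, ℝ) ∞
      (fun q : ℝ × (M × Circle) => circleLift p.2 q.2.2) (s, covering p) :=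
    ContMDiffAt.comp (g := circleLift p.2) (f := fun q : ℝ × (M × Circle) => q.2.2)
      (s, covering p) (contMDiffAt_circleLift p.2)
      (contMDiffAt_snd.comp (f := Prod.snd) (s, covering p) contMDiffAt_snd)
  have h3 : ContMDiffAt (𝓘(ℝ, ℝ).prod ((𝓡 d).prod (𝓡 1))) (𝓘(ℝ, ℝ).prod ((𝓡 d).prod 𝓘(ℝ, ℝ))) ∞
      (fun q : ℝ × (M × Circle) => (q.1, (q.2.1, circleLift p.2 q.2.2))) (s, covering p) :=
    contMDiffAt_fst.prodMk
      ((contMDiffAt_fst.comp (f := Prod.snd) (s, covering p) contMDiffAt_snd).prodMk h2)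
  exact ContMDiffAt.comp (g := fun q : ℝ × (M × ℝ) => covering (transport Φ r q.1 q.2))
    (s, covering p) ((contMDiff_covering.comp (contMDiff_transport hk h0 hΦ r)) _) h3

theorem contMDiff_circleTransport_right (r s : ℝ) :
    ContMDiff ((𝓡 d).prod (𝓡 1)) ((𝓡 d).prod (𝓡 1)) ∞
      (circleTransport Φ r s : M × Circle → M × Circle) :=
  (contMDiff_circleTransport hk h0 hΦ r).comp (contMDiff_const.prodMk contMDiff_id)

/-- Every tangent vector of M × S¹ lifts to M × ℝ, and there the transport multiplies α - dt by a
positive factor. -/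
theorem contactForm_circleTransport (r s : ℝ) (x : M × Circle)
    (v : TangentSpace ((𝓡 d).prod (𝓡 1)) x) :
    S.contactForm (circleTransport Φ r s x)
      (mfderiv ((𝓡 d).prod (𝓡 1)) ((𝓡 d).prod (𝓡 1)) (circleTransport Φ r s) x v) = 0 ↔
      S.contactForm x v = 0 := by
  obtain ⟨p, rfl⟩ := surjective_covering x
  obtain ⟨w, rfl⟩ := surjective_mfderiv_covering p v
  have hcov : MDifferentiableAt ((𝓡 d).prod 𝓘(ℝ, ℝ)) ((𝓡 d).prod (𝓡 1))
      (covering : M × ℝ → M × Circle) p := (contMDiff_covering p).mdifferentiableAt (by simp)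
  have hct : MDifferentiableAt ((𝓡 d).prod (𝓡 1)) ((𝓡 d).prod (𝓡 1))
      (circleTransport Φ r s) (covering p) :=
    (contMDiff_circleTransport_right hk h0 hΦ r s _).mdifferentiableAt (by simp)
  have htr : ContMDiff ((𝓡 d).prod 𝓘(ℝ, ℝ)) ((𝓡 d).prod 𝓘(ℝ, ℝ)) ∞ (transport Φ r s) :=
    (contMDiff_transport hk h0 hΦ r).comp (contMDiff_const.prodMk contMDiff_id)
  have hZ : MDifferentiableAt ((𝓡 d).prod 𝓘(ℝ, ℝ)) (𝓡 d) (fun p => (transport Φ r s p).1) p :=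
    ((contMDiff_fst.comp htr) p).mdifferentiableAt (by simp)
  have hT : MDifferentiableAt ((𝓡 d).prod 𝓘(ℝ, ℝ)) 𝓘(ℝ, ℝ) (fun p => (transport Φ r s p).2) p :=
    ((contMDiff_snd.comp htr) p).mdifferentiableAt (by simp)
  obtain ⟨c, hc, hform⟩ := contactForm_transport hk h0 hΦ r s p w
  have hbase : S.contactForm (covering p)
      (mfderiv ((𝓡 d).prod 𝓘(ℝ, ℝ)) ((𝓡 d).prod (𝓡 1)) covering p w) = S.α p.1 w.1 - w.2 := by
    refine (contactForm_mfderiv_covering (S := S) (Z := Prod.fst) (T := Prod.snd)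
      mdifferentiableAt_fst mdifferentiableAt_snd w).trans ?_
    have h4 : mfderiv ((𝓡 d).prod 𝓘(ℝ, ℝ)) (𝓡 d) (Prod.fst : M × ℝ → M) p w = w.1 :=
      congrArg (fun A : EuclideanSpace ℝ (Fin d) × ℝ →L[ℝ] EuclideanSpace ℝ (Fin d) => A w)
        (mfderiv_fst (I := 𝓡 d) (I' := 𝓘(ℝ, ℝ)) (x := p))
    have h5 : differential ((𝓡 d).prod 𝓘(ℝ, ℝ)) (Prod.snd : M × ℝ → ℝ) p w = w.2 :=
      congrArg (fun A : EuclideanSpace ℝ (Fin d) × ℝ →L[ℝ] ℝ => A w)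
        (mfderiv_snd (I := 𝓡 d) (I' := 𝓘(ℝ, ℝ)) (x := p))
    exact congrArg₂ (fun (a : EuclideanSpace ℝ (Fin d)) (b : ℝ) => S.α p.1 a - b) h4 h5
  have hchain := congrArg (fun A : EuclideanSpace ℝ (Fin d) × ℝ →L[ℝ]
    EuclideanSpace ℝ (Fin d) × EuclideanSpace ℝ (Fin 1) => A w) (mfderiv_comp p hct hcov)
  have hkey : ∀ G : M × ℝ → M × Circle,
      G = (fun p => ((transport Φ r s p).1, circleParam (transport Φ r s p).2)) →
      S.contactForm (G p) (mfderiv ((𝓡 d).prod 𝓘(ℝ, ℝ)) ((𝓡 d).prod (𝓡 1)) G p w) =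
        c * (S.α p.1 w.1 - w.2) := by
    rintro G rfl
    exact (contactForm_mfderiv_covering hZ hT w).trans hform
  have h6 := hkey (circleTransport Φ r s ∘ covering)
    (funext fun p => circleTransport_covering hk h0 hΦ r s p)
  have h7 : S.contactForm (circleTransport Φ r s (covering p))
      (mfderiv ((𝓡 d).prod (𝓡 1)) ((𝓡 d).prod (𝓡 1)) (circleTransport Φ r s) (covering p)
        (mfderiv ((𝓡 d).prod 𝓘(ℝ, ℝ)) ((𝓡 d).prod (𝓡 1)) covering p w)) =
      c * (S.α p.1 w.1 - w.2) :=
    (congrArg (S.contactForm (circleTransport Φ r s (covering p))) hchain).symm.trans h6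
  rw [h7, hbase, mul_eq_zero, or_iff_right hc.ne']

theorem isContactIsotopyOn_circleTransport (A : Set (M × Circle)) :
    S.IsContactIsotopyOn A (circleTransport Φ 0) := by
  refine ⟨univ, isOpen_univ, subset_univ _, (contMDiff_circleTransport hk h0 hΦ 0).contMDiffOn,
    fun p _ => circleTransport_self hk h0 hΦ 0 p, fun s _ => ⟨fun x _ y _ hxy => ?_, fun x _ =>
      ⟨?_, contactForm_circleTransport hk h0 hΦ 0 s x⟩⟩⟩
  · rw [← circleTransport_self hk h0 hΦ 0 x, ← circleTransport_self hk h0 hΦ 0 y,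
      ← circleTransport_circleTransport hk h0 hΦ 0 s 0 x, hxy,
      circleTransport_circleTransport hk h0 hΦ 0 s 0 y]
  · refine injective_mfderiv_of_leftInverse (ψ := circleTransport Φ s 0)
      ((contMDiff_circleTransport_right hk h0 hΦ 0 s x).mdifferentiableAt (by simp))
      ((contMDiff_circleTransport_right hk h0 hΦ s 0 _).mdifferentiableAt (by simp)) fun y => ?_
    rw [circleTransport_circleTransport hk h0 hΦ, circleTransport_self hk h0 hΦ]

end Liouville

/-! ### The contact isotopy through fiberwise starshaped domains. -/

namespace Liouville

variable {d : ℕ} {M : Type*} [TopologicalSpace M] [T2Space M]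
  [ChartedSpace (EuclideanSpace ℝ (Fin d)) M] [IsManifold (𝓡 d) ∞ M] {S : Liouville d M}
  {E : M → ℝ}

/-- The unit sublevel set of a family, parametrized by the circle, of positive contact
Hamiltonians. -/
theorem isFiberwiseStarshaped_sublevel (hE : S.IsContactHamiltonian E)
    (hE_pos : ∀ z ∈ S.star, 0 < E z) {h : M × Circle → ℝ} (hc : Continuous h)
    (hs : ∀ x : M × Circle, x.1 ∈ S.star → ContMDiffAt ((𝓡 d).prod (𝓡 1)) 𝓘(ℝ, ℝ) ∞ h x)
    (hh : ∀ θ, S.IsHomogeneous (fun z => h (z, θ))) {m : ℝ} (hm : 0 < m)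
    (hle : ∀ x, m * E x.1 ≤ h x) : S.IsFiberwiseStarshaped {x | h x < 1} := by
  have hopen : IsOpen {x | h x < 1} := isOpen_lt hc continuous_const
  have hfr : frontier {x | h x < 1} ⊆ {x | h x = 1} := frontier_lt_subset_eq hc continuous_const
  have hslice : ∀ z ∈ S.star, ∀ θ, ContMDiffAt (𝓡 d) 𝓘(ℝ, ℝ) ∞ (fun z => h (z, θ)) z :=
    fun z hz θ => (hs (z, θ) hz).comp z (contMDiffAt_id.prodMk contMDiffAt_const)
  refine ⟨hopen, ?_, fun θ => ?_, fun p hp => ?_⟩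
  · refine ((isCompact_sublevel hE.isHomogeneous hE.continuous hE_pos (1 / m)).prod
      (isCompact_univ (X := Circle))).of_isClosed_subset isClosed_frontier fun x hx => ⟨?_, mem_univ _⟩
    show E x.1 ≤ 1 / m
    rw [le_div_iff₀ hm, mul_comm]
    exact (hle x).trans (hfr hx).le
  · exact isStarshaped_sublevel (hh θ) (hc.comp (Continuous.prodMk_left θ))
      (fun z hz => (mul_pos hm (hE_pos z hz)).trans_le (hle (z, θ)))
      fun z hz => (hslice z hz θ).contMDiffWithinAt
  · obtain ⟨z, θ⟩ := p
    have h1 : h (z, θ) = 1 := hfr hp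
    have hz : z ∈ S.star := by
      by_contra hz
      have h2 := (hh θ).core z (not_not.1 hz)
      rw [h1] at h2
      exact one_ne_zero h2
    have hd : MDifferentiableAt ((𝓡 d).prod (𝓡 1)) 𝓘(ℝ, ℝ) (fun x => h x - 1) (z, θ) :=
      ((hs (z, θ) hz).sub contMDiffAt_const).mdifferentiableAt (by simp)
    have hdL : mfderiv ((𝓡 d).prod (𝓡 1)) 𝓘(ℝ, ℝ) (fun x => h x - 1) (z, θ)
        ((S.L z, (0 : TangentSpace (𝓡 1) θ)) : TangentSpace (𝓡 d) z × TangentSpace (𝓡 1) θ) =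
        (1 : ℝ) := by
      have h2 : HasMFDerivAt 𝓘(ℝ, ℝ) ((𝓡 d).prod (𝓡 1)) (fun t => (S.flow t z, θ)) 0
          ((1 : ℝ →L[ℝ] ℝ).smulRight ((S.L (S.flow 0 z), (0 : TangentSpace (𝓡 1) θ)) :
            TangentSpace ((𝓡 d).prod (𝓡 1)) (S.flow 0 z, θ))) := by
        refine ((S.flow_integral z 0).prodMk (hasMFDerivAt_const θ (0 : ℝ))).smulRight_one ?_
        exact Prod.ext (one_smul ℝ (show EuclideanSpace ℝ (Fin d) from S.L _)) rfl
      have hz0 := S.flow_zero z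
      have h3 := hasDerivAt_comp_curve h2 (g := fun x => h x - 1) (by rwa [hz0])
      have h4 : HasDerivAt (fun t => h (S.flow t z, θ) - 1) 1 0 := by
        have h5 : (fun t => h (S.flow t z, θ) - 1) = fun t => Real.exp t - 1 := by
          ext t
          rw [show h (S.flow t z, θ) = Real.exp t * h (z, θ) from (hh θ).flow z hz t, h1, mul_one]
        rw [h5]
        simpa using (Real.hasDerivAt_exp 0).sub_const 1
      have h6 := h3.unique h4
      rw [hz0] at h6
      exact h6
    refine ⟨fun x => h x - 1, ⟨⟨S.star ×ˢ univ, S.isOpen_star.prod isOpen_univ, ⟨hz, mem_univ _⟩,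
      fun x hx => ((hs x hx.1).sub contMDiffAt_const).contMDiffWithinAt, ?_⟩, fun h0 => ?_⟩,
      S.L z, ?_⟩
    · ext x
      simp [and_comm]
    · have h7 := congrArg (fun A : EuclideanSpace ℝ (Fin d) × EuclideanSpace ℝ (Fin 1) →L[ℝ] ℝ =>
        A (S.L z, (0 : EuclideanSpace ℝ (Fin 1)))) h0
      exact (one_ne_zero : (1 : ℝ) ≠ 0) (hdL.symm.trans h7)
    · intro h7
      exact (one_ne_zero : (1 : ℝ) ≠ 0) (hdL.symm.trans h7)

variable {R μ γ : ℝ} {H K : M → ℝ × ℝ → ℝ} (hD : S.IsDeformation E R μ γ H K)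
  (hE : S.IsContactHamiltonian E) (hE_pos : ∀ z ∈ S.star, 0 < E z)

namespace IsDeformation

include hD

theorem apply_circleLift (x : M × Circle) (t₀ s : ℝ) :
    H x.1 (circleLift 0 x.2, s) = H x.1 (circleLift t₀ x.2, s) := by
  obtain ⟨n, hn⟩ := circleParam_eq_iff
    ((circleParam_circleLift 0 x.2).trans (circleParam_circleLift t₀ x.2).symm)
  rw [hn, hD.periodic_int]

theorem continuous_circle (s : ℝ) :
    Continuous fun x : M × Circle => H x.1 (circleLift 0 x.2, s) := by
  rw [continuous_iff_continuousAt]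
  rintro ⟨z, θ⟩
  obtain ⟨t₀, rfl⟩ : ∃ t₀, circleParam t₀ = θ := ⟨_, circleParam_circleLift 0 θ⟩
  have h1 : (fun x : M × Circle => H x.1 (circleLift 0 x.2, s)) =
      fun x => H x.1 (circleLift t₀ x.2, s) := funext fun x => hD.apply_circleLift x t₀ s
  rw [h1]
  have h2 : ContinuousAt (fun x : M × Circle => circleLift t₀ x.2) (z, circleParam t₀) :=
    ContinuousAt.comp (f := Prod.snd) (g := circleLift t₀) (contMDiffAt_circleLift t₀).continuousAt
      continuousAt_snd
  exact ContinuousAt.comp (g := fun p : M × (ℝ × ℝ) => H p.1 p.2)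
    (f := fun x : M × Circle => (x.1, (circleLift t₀ x.2, s))) hD.continuous.continuousAt
    (continuousAt_fst.prodMk (h2.prodMk continuousAt_const))

theorem contMDiffAt_circle (s : ℝ) (x : M × Circle) (hx : x.1 ∈ S.star) :
    ContMDiffAt ((𝓡 d).prod (𝓡 1)) 𝓘(ℝ, ℝ) ∞
      (fun x : M × Circle => H x.1 (circleLift 0 x.2, s)) x := by
  obtain ⟨z, θ⟩ := x
  obtain ⟨t₀, rfl⟩ : ∃ t₀, circleParam t₀ = θ := ⟨_, circleParam_circleLift 0 θ⟩
  have h1 : (fun x : M × Circle => H x.1 (circleLift 0 x.2, s)) =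
      fun x => H x.1 (circleLift t₀ x.2, s) := funext fun x => hD.apply_circleLift x t₀ s
  rw [h1]
  have h2 : ContMDiffAt ((𝓡 d).prod (𝓡 1)) 𝓘(ℝ, ℝ) ∞ (fun x : M × Circle => circleLift t₀ x.2)
      (z, circleParam t₀) :=
    ContMDiffAt.comp (f := Prod.snd) (g := circleLift t₀) (z, circleParam t₀)
      (contMDiffAt_circleLift t₀) contMDiffAt_snd
  exact ContMDiffAt.comp (g := fun p : M × (ℝ × ℝ) => H p.1 p.2)
    (f := fun x : M × Circle => (x.1, ((circleLift t₀ x.2, s) : ℝ × ℝ))) (z, circleParam t₀)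
    (hD.smooth_left z hx _) (contMDiffAt_fst.prodMk (h2.prodMk_space contMDiffAt_const))

include hE hE_pos

/-- The contact isotopy that moves `{H_0 < 1} = {E < R}` to `{H_s < 1}`. -/
theorem exists_isotopy (hR : 0 < R) (hm : 0 < 1 / R - μ) :
    ∃ Ψ : ℝ → M × Circle → M × Circle, S.IsContactIsotopyOn (closure (sublevel E R)) Ψ ∧
      (∀ s ∈ Icc (0 : ℝ) 1, S.IsFiberwiseStarshaped (Ψ s '' sublevel E R)) ∧
      (∀ s ∈ Icc (0 : ℝ) 1, ∀ x ∈ closure (sublevel E R), (1 / R - μ) * E (Ψ s x).1 ≤ 1) ∧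
      ∀ x ∈ closure (sublevel E R), (1 / R + γ) * E (Ψ 1 x).1 ≤ 1 := by
  obtain ⟨k, C, hk, hkK⟩ := hD.exists_cutoff hE hE_pos hm
  obtain ⟨Φ, h0, hΦ⟩ := hk.exists_contactFlow (S := S)
  have hlevel : ∀ s ∈ Icc (0 : ℝ) 1, ∀ x : M × Circle,
      H (circleTransport Φ 0 s x).1 (circleLift 0 (circleTransport Φ 0 s x).2, s) < 1 ↔
        x ∈ sublevel E R := by
    intro s hs x
    obtain ⟨p, rfl⟩ := surjective_covering x
    rw [circleTransport_covering hk h0 hΦ]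
    have h1 : ∀ p : M × ℝ, ∀ s, H (covering p).1 (circleLift 0 (covering p).2, s) =
        H p.1 (p.2, s) := by
      intro p s
      obtain ⟨n, hn⟩ := circleParam_eq_iff (circleParam_circleLift 0 (circleParam p.2))
      show H p.1 (circleLift 0 (circleParam p.2), s) = _
      rw [hn, hD.periodic_int]
    rw [h1, level_lt_iff hk h0 hΦ hD hkK p hs, hD.start, div_lt_one hR]
    exact ⟨fun h => ⟨h, mem_univ _⟩, fun h => h.1⟩
  have himage : ∀ s ∈ Icc (0 : ℝ) 1, circleTransport Φ 0 s '' sublevel E R =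
      {x | H x.1 (circleLift 0 x.2, s) < 1} := by
    intro s hs
    ext x
    constructor
    · rintro ⟨y, hy, rfl⟩
      exact (hlevel s hs y).2 hy
    · intro hx
      have h1 : circleTransport Φ 0 s (circleTransport Φ s 0 x) = x := by
        rw [circleTransport_circleTransport hk h0 hΦ, circleTransport_self hk h0 hΦ]
      refine ⟨circleTransport Φ s 0 x, (hlevel s hs _).1 ?_, h1⟩
      rw [h1]
      exact hx
  -- On the closure only the weak inequality survives; this is why the later bounds on E are not
  -- strict.
  have hclosure : ∀ s ∈ Icc (0 : ℝ) 1, ∀ x ∈ closure (sublevel E R),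
      H (circleTransport Φ 0 s x).1 (circleLift 0 (circleTransport Φ 0 s x).2, s) ≤ 1 := by
    intro s hs x hx
    have hcl : IsClosed {x : M × Circle |
        H (circleTransport Φ 0 s x).1 (circleLift 0 (circleTransport Φ 0 s x).2, s) ≤ 1} :=
      isClosed_le ((hD.continuous_circle s).comp
        (contMDiff_circleTransport_right hk h0 hΦ 0 s).continuous) continuous_const
    exact closure_minimal (fun y hy => ((hlevel s hs y).2 hy).le) hcl hx
  refine ⟨circleTransport Φ 0, isContactIsotopyOn_circleTransport hk h0 hΦ _, fun s hs => ?_,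
    fun s hs x hx => (hD.lower _ _ s hs).trans (hclosure s hs x hx),
    fun x hx => (hD.final _ _).trans (hclosure 1 (by simp) x hx)⟩
  rw [himage s hs]
  exact isFiberwiseStarshaped_sublevel hE hE_pos (hD.continuous_circle s)
    (hD.contMDiffAt_circle s) (fun θ => hD.homogeneous (circleLift 0 θ, s)) hm
    fun x => hD.lower _ _ s hs

end IsDeformation

end Liouville

theorem closure_sublevel_subset {M : Type*} [TopologicalSpace M] {E : M → ℝ} (hE : Continuous E)
    (R : ℝ) : closure (sublevel E R) ⊆ {x : M × Circle | E x.1 ≤ R} :=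
  closure_minimal (fun x hx => (show E x.1 < R from hx.1).le)
    (isClosed_le (hE.comp continuous_fst) continuous_const)

end ContactSqueezing

theorem mainTheorem10 {d : ℕ} {M : Type*} [TopologicalSpace M] [T2Space M]
    [SecondCountableTopology M] [ConnectedSpace M]
    [ChartedSpace (EuclideanSpace ℝ (Fin d)) M] [IsManifold (𝓡 d) ∞ M]
    (S : ContactSqueezing.Liouville d M)
    (E : M → ℝ) (hE : S.IsContactHamiltonian E) (hE_pos : ∀ z ∈ S.star, 0 < E z)
    (f : ℝ → ℝ → M → M) (hf : S.IsLoopHomotopy f)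
    (F : ℝ → ℝ → M → ℝ)
    (hF : ∀ s ∈ Set.Icc (0 : ℝ) 1, S.Generates (F s) (fun t => f t s))
    (hF_pos : ∀ t, ∀ z ∈ S.star, 0 < F 1 t z)
    (μ : ℝ) (hμ : 0 < μ)
    (hFμ : ∀ s ∈ Set.Icc (0 : ℝ) 1, ∀ t, ∀ z ∈ S.star, -μ * E z < F s t z) :
    (∃ γ : ℝ, 0 < γ ∧ ∀ R : ℝ, 0 < R → R < μ⁻¹ →
      S.SqueezesStarshaped (ContactSqueezing.sublevel E R)
        (ContactSqueezing.sublevel E (R / (1 + γ * R))) Set.univ) ∧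
    (∀ R ρ : ℝ, 0 < R → R < μ⁻¹ → 1 / (R⁻¹ - μ) < ρ →
      S.SqueezesStarshaped (ContactSqueezing.sublevel E R)
        (ContactSqueezing.sublevel E R) (ContactSqueezing.sublevel E ρ)) := by
  obtain ⟨γ, hγ, hdef⟩ := hf.exists_deformation hF hE hE_pos hF_pos hμ hFμ
  have hm : ∀ R : ℝ, 0 < R → R < μ⁻¹ → 0 < 1 / R - μ := by
    intro R hR hRμ
    rw [one_div, sub_pos]
    exact (lt_inv_comm₀ hR hμ).1 hRμ
  have hfinal : ∀ R : ℝ, 0 < R → ∀ y, (1 / R + γ) * y ≤ 1 → y ≤ R / (1 + γ * R) := by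
    intro R hR y hy
    rw [le_div_iff₀ (by positivity)]
    have h1 : (1 / R + γ) * y * R = y * (1 + γ * R) := by field_simp
    nlinarith
  -- The closure of A(R) is sent only into {E ≤ R/(1 + γR)}; halving γ provides the open target.
  refine ⟨⟨γ / 2, half_pos hγ, fun R hR hRμ => ?_⟩, fun R ρ hR hRμ hρ => ?_⟩
  · obtain ⟨H, K, hD⟩ := hdef R hR
    obtain ⟨Ψ, hiso, hstar, -, hfin⟩ := hD.exists_isotopy hE hE_pos hR (hm R hR hRμ)
    refine ⟨Ψ, ⟨hiso, ?_, Set.subset_univ _, fun s _ => Set.subset_univ _⟩, hstar⟩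
    rintro - ⟨x, hx, rfl⟩
    refine ⟨(hfinal R hR _ (hfin x hx)).trans_lt ?_, Set.mem_univ _⟩
    refine div_lt_div_of_pos_left hR (by positivity) ?_
    nlinarith [mul_pos hγ hR]
  · obtain ⟨H, K, hD⟩ := hdef R hR
    have hmR := hm R hR hRμ
    obtain ⟨Ψ, hiso, hstar, hin, hfin⟩ := hD.exists_isotopy hE hE_pos hR hmR
    rw [← one_div R] at hρ
    refine ⟨Ψ, ⟨hiso, ?_, fun x hx => ⟨?_, Set.mem_univ _⟩, ?_⟩, hstar⟩
    · rintro - ⟨x, hx, rfl⟩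
      refine ⟨(hfinal R hR _ (hfin x hx)).trans_lt (div_lt_self hR ?_), Set.mem_univ _⟩
      nlinarith [mul_pos hγ hR]
    -- Here R < 1/(1/R - μ) < ρ, the first inequality because R(1/R - μ) = 1 - Rμ < 1.
    · refine (ContactSqueezing.closure_sublevel_subset hE.continuous R hx).trans_lt (lt_trans ?_ hρ)
      rw [lt_div_iff₀ hmR]
      have h1 : R * (1 / R - μ) = 1 - R * μ := by field_simp
      nlinarith [mul_pos hR hμ]
    · rintro s hs - ⟨x, hx, rfl⟩
      refine ⟨lt_of_le_of_lt ?_ hρ, Set.mem_univ _⟩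
      rw [le_div_iff₀ hmR, mul_comm]
      exact hin s hs x hx
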